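/- Let $t\ge 1$ and let $a_1,\dots,a_{2t}$ be non-zero integers. Let $L$ be the closure (with all strands oriented in the same direction) of the braid with three strands given by the word $$w=\sigma_1^{a_1}\sigma_2^{a_2}\cdots\sigma_1^{a_{2t-1}}\sigma_2^{a_{2t}},$$ where $\sigma_1,\sigma_2$ are represented by positive crossings. Say that the exponent $a_i$ is cyclically surrounded by positive exponents if $a_{i-1}>0$ and $a_{i+1}>0$, indices taken modulo $2t$. Assume: 1. no exponent $a_i$ is equal to $1$; 2. there is an exponent $a_j>2$ that is cyclically surrounded by positive exponents; 3. every negative exponent is cyclically surrounded by positive exponents. Let $a_{i_1},\dots,a_{i_r}$ be all the positive exponents that are cyclically surrounded by positive exponents. Then the integral Khovanov homology of $L$ (computed from the closed braid diagram of $w$) has at least $$\left\lfloor \frac{a_{i_1}}{2}\right\rfloor\cdots\left\lfloor \frac{a_{i_r}}{2}\right\rfloor-1$$ different torsion elements of order two, each of them homogeneous, that is, lying in one of the groups $Kh^{h,q}(L)$. -/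

import Mathlib

/-- A crossing of an oriented link diagram whose edges are labelled by `E`: the four edges
`a, b, c, d` at the crossing are listed counterclockwise, starting with the incoming edge of the
under-strand (so `a, c` are the under-edges and `b, d` the over-edges). `positive` records the
sign of the crossing: the over-strand runs from `d` to `b` if it is `true` and from `b` to `d` if
it is `false`. -/
structure LinkCrossing (E : Type) where
  a : E
  b : E
  c : E
  d : E
  positive : Bool

/-- The smoothing of a crossing, as the relation that joins the edge ends at the crossing.
The label `false` stands for `A` and `true` for `B`. The `A`-smoothing opens the two regions swept
by the over-strand when it turns counterclockwise (those between `b, c` and between `d, a`), hence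
it joins `a` to `b` and `c` to `d`; the `B`-smoothing joins `a` to `d` and `b` to `c`. -/
def LinkCrossing.Smoothing {E : Type} (X : LinkCrossing E) : Bool → E → E → Prop
  | false => fun e f => (e = X.a ∧ f = X.b) ∨ (e = X.c ∧ f = X.d)
  | true => fun e f => (e = X.a ∧ f = X.d) ∨ (e = X.b ∧ f = X.c)

/-- The edge `e` touches the crossing `X`. -/
def LinkCrossing.Touches {E : Type} (X : LinkCrossing E) (e : E) : Prop :=
  e = X.a ∨ e = X.b ∨ e = X.c ∨ e = X.d

/-- An oriented link diagram, recorded by its planar diagram code: a finite set of edges, an ordered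
list of crossings, and bivalent vertices (`Join e f`: the edge `e` is continued by the edge `f`). -/
structure LinkDiagram where
  Edge : Type
  finiteEdge : Finite Edge
  numCrossings : ℕ
  crossing : Fin numCrossings → LinkCrossing Edge
  Join : Edge → Edge → Prop

namespace LinkDiagram

variable (D : LinkDiagram)

/-- The number `p` of positive crossings. -/
def numPositive : ℕ := (Finset.univ.filter fun x => (D.crossing x).positive = true).card

/-- The number `n` of negative crossings. -/
def numNegative : ℕ := (Finset.univ.filter fun x => (D.crossing x).positive = false).card

/-- Kauffman states: a label for each crossing, `false` for `A` and `true` for `B`. -/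
abbrev State : Type := Fin D.numCrossings → Bool

/-- Two edges follow each other in the smoothed diagram `sD`. -/
def Follows (s : D.State) (e f : D.Edge) : Prop :=
  D.Join e f ∨ ∃ x, (D.crossing x).Smoothing (s x) e f

/-- The circles of `sD`: the classes of edges for the equivalence relation generated
by `Follows`. -/
def Circle (s : D.State) : Type := Quot (D.Follows s)

/-- The circle of `sD` that contains the edge `e`. -/
def circleOf (s : D.State) (e : D.Edge) : D.Circle s := Quot.mk _ e

instance (s : D.State) : Finite (D.Circle s) :=
  haveI := D.finiteEdge
  Finite.of_surjective (D.circleOf s) Quot.mk_surjective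

noncomputable instance (s : D.State) : Fintype (D.Circle s) := Fintype.ofFinite _

/-- Enhanced states: a Kauffman state `s` with a sign `±1` for each circle of `sD`. -/
structure EnhancedState where
  state : D.State
  sign : D.Circle state → ℤˣ

instance : Finite D.EnhancedState :=
  Finite.of_injective
    (fun S => (⟨S.state, S.sign⟩ : Σ s : D.State, (D.Circle s → ℤˣ)))
    (by rintro ⟨s, e⟩ ⟨s', e'⟩ h; cases h; rfl)

variable {D}

/-- The homological degree `i(S)`: the number of `B`-labels. -/
def EnhancedState.i (S : D.EnhancedState) : ℤ :=
  ((Finset.univ.filter fun x => S.state x = true).card : ℤ)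

/-- `θ(S)`: the number of positive circles minus the number of negative circles. -/
noncomputable def EnhancedState.theta (S : D.EnhancedState) : ℤ := ∑ C, (S.sign C : ℤ)

/-- The quantum degree `j(S) = i(S) + θ(S)`. -/
noncomputable def EnhancedState.j (S : D.EnhancedState) : ℤ := S.i + S.theta

/-- `T` is adjacent to `S` with change crossing `x`: the degrees are `i(T) = i(S) + 1` and
`j(T) = j(S)`, the labels agree except that `x` is labelled `A` in `S` and `B` in `T`, and the signs
agree on the common circles, which are the circles that do not touch `x`. -/
def AdjacentAt (x : Fin D.numCrossings) (S T : D.EnhancedState) : Prop :=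
  T.i = S.i + 1 ∧ T.j = S.j ∧
  S.state x = false ∧ T.state x = true ∧ (∀ y, y ≠ x → T.state y = S.state y) ∧
  ∀ e : D.Edge,
    (∀ f, (D.crossing x).Touches f → D.circleOf S.state e ≠ D.circleOf S.state f) →
    T.sign (D.circleOf T.state e) = S.sign (D.circleOf S.state e)

open Classical in
/-- The incidence number of `S` over `T`: it is `(-1)^k` if `T` is adjacent to `S`, where `k` is the
number of `B`-labelled crossings of `S` previous to the change crossing, and `0` otherwise.
(There is at most one change crossing, so the sum has at most one nonzero term.) -/
noncomputable def incidence (S T : D.EnhancedState) : ℤ :=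
  ∑ x, if AdjacentAt x S T
    then (-1) ^ (Finset.univ.filter fun y => y < x ∧ S.state y = true).card else 0

variable (D)

/-- The enhanced states of degrees `i` and `j`. -/
def Generator (i j : ℤ) : Type := {S : D.EnhancedState // S.i = i ∧ S.j = j}

instance (i j : ℤ) : Finite (D.Generator i j) := Subtype.finite

noncomputable instance (i j : ℤ) : Fintype (D.Generator i j) := Fintype.ofFinite _

/-- The chain group `C^{i,j}(D)`: the free abelian group on the finite set of enhanced states of
degrees `i` and `j`, a chain being recorded by its coefficients. -/
abbrev Chain (i j : ℤ) : Type := D.Generator i j → ℤ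

/-- The differential `d(S) = ∑ i(S,T) T` from degree `i` to degree `i'`
(it is only of interest, and only nonzero, for `i' = i + 1`). -/
noncomputable def differential (i i' j : ℤ) : D.Chain i j →ₗ[ℤ] D.Chain i' j :=
  Matrix.mulVecLin (Matrix.of fun (T : D.Generator i' j) (S : D.Generator i j) =>
    incidence S.1 T.1)

/-- The homology `ker d_i / im d_{i-1}` of the diagram in homological degree `i` and quantum
degree `j`. (`submoduleOf` regards the image as a submodule of the kernel; the image lies in the
kernel for every diagram drawn in the plane.) -/
abbrev DiagramHomology (i j : ℤ) : Type :=
  LinearMap.ker (D.differential i (i + 1) j) ⧸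
    (LinearMap.range (D.differential (i - 1) i j)).submoduleOf
      (LinearMap.ker (D.differential i (i + 1) j))

/-- The integral Khovanov homology `Kh^{h,q}` of the oriented link with diagram `D`: the homology of
the diagram in degrees `i = h + n` and `j = q - p + 2n`. -/
abbrev Kh (h q : ℤ) : Type :=
  D.DiagramHomology (h + D.numNegative) (q - D.numPositive + 2 * D.numNegative)

end LinkDiagram

/-- Braid words on `m + 1` strands. The letter `(k, true)` is the generator `σ_{k+1}`, a positive
crossing of the strands in positions `k` and `k + 1`, and `(k, false)` is its inverse. -/
abbrev BraidWord (m : ℕ) : Type := List (Fin m × Bool)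

namespace BraidWord

variable {m : ℕ} (w : BraidWord m)

/-- The `l`-th crossing of the diagram of the braid `w`, whose strands run upwards. The edge `(k, l)`
is the piece of strand in position `k` (from left to right) just below the `l`-th crossing.
In a positive crossing the over-strand runs from bottom left to top right, in a negative crossing it
runs from bottom right to top left. -/
def crossingAt (l : Fin w.length) : LinkCrossing (Fin (m + 1) × Fin (w.length + 1)) :=
  let k := (w.get l).1
  let bottomLeft := (k.castSucc, l.castSucc)
  let bottomRight := (k.succ, l.castSucc)
  let topLeft := (k.castSucc, l.succ)
  let topRight := (k.succ, l.succ)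
  match (w.get l).2 with
  | true => ⟨bottomRight, topRight, topLeft, bottomLeft, true⟩
  | false => ⟨bottomLeft, bottomRight, topRight, topLeft, false⟩

/-- The diagram of the closure of the braid `w`: strands not involved in the `l`-th crossing pass
straight by it, and the top end of the braid in each position is joined to the bottom end in
the same position. -/
def closure : LinkDiagram where
  Edge := Fin (m + 1) × Fin (w.length + 1)
  finiteEdge := inferInstance
  numCrossings := w.length
  crossing := w.crossingAt
  Join e f :=
    (∃ l : Fin w.length, ∃ k : Fin (m + 1), k ≠ (w.get l).1.castSucc ∧ k ≠ (w.get l).1.succ ∧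
      e = (k, l.castSucc) ∧ f = (k, l.succ)) ∨
    (∃ k : Fin (m + 1), e = (k, Fin.last w.length) ∧ f = (k, 0))

end BraidWord

/-- The word `σ₁^{a₁} σ₂^{a₂} ⋯ σ₁^{a_{2t-1}} σ₂^{a_{2t}}` on three strands. The exponents are
numbered from `0` here, so that even indices belong to `σ₁` and odd indices to `σ₂`. -/
def threeBraidWord {t : ℕ} (a : Fin (2 * t) → ℤ) : BraidWord 2 :=
  (List.ofFn fun i : Fin (2 * t) =>
    List.replicate (a i).natAbs
      ((⟨i.val % 2, Nat.mod_lt _ two_pos⟩ : Fin 2), decide (0 < a i))).flatten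

/-- The exponent `a i` is cyclically surrounded by positive exponents: the next and the previous
exponent in the cyclic order are positive. -/
def CyclicallySurrounded {n : ℕ} (a : Fin n → ℤ) (i : Fin n) : Prop :=
  0 < a (finRotate n i) ∧ 0 < a ((finRotate n).symm i)

instance {n : ℕ} (a : Fin n → ℤ) : DecidablePred (CyclicallySurrounded a) :=
  fun _ => inferInstanceAs (Decidable (_ ∧ _))

/-! The torsion comes from the positive twist regions, much as for the torus links T(2,n). Suppose
first that no exponent is negative. Fix an even number κᵢ ≥ 2 for each block and let c be the sum,
with all coefficients 1, of the enhanced states without negative circles that have exactly κᵢ labels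
B in the i-th block. In a positive block B is the horizontal smoothing, so consecutive labels B
enclose small circles. One further label B splits a circle, and the boundary makes one of the two
halves negative. A state with κᵢ + 1 labels B in the i-th block is reached once from each of these
labels. Modulo 2 the circles below and above the labels telescope along the block, and both ends of
the block lie on one long circle, so dc has even coefficients. Write dc = 2z. Chain groups are
torsion-free, so z is a cycle, and twice its class is zero (`EvenFamily`, `exists_half`). Only
parities matter, so no signs have to be chosen in c, and d² = 0 is needed only on states without
negative circles (`sum_incidence_mul_incidence_plus`).

A negative block is horizontal where it is labelled A, and the basic states have this label at its
first crossing only. Changing it to B makes the block vertical, fuses the two neighbouring positive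
blocks into one stretch, and leaves an odd boundary term. This is repaired by adding states in which
negative blocks are entirely B and the labels of the positive blocks are redistributed, with no
surplus of labels B accumulated up to such a block. `Family` encodes this by a running `excess`. The
contributions of all the blocks then form a single telescoping sum around the closed braid
(`sum_block`, `evenFamily`).

To see that z is not a boundary, it is paired with a cocycle modulo 2 that counts enhanced states
with one negative circle on the states of `Detects`. Splits produce such enhanced states in pairs.
Merges come in pairs because the position of the label A in a negative block is left free
(`coevenFamily`). On dc only one Kauffman state counts, that of `Pinned`, with one κ_J raised by
one. It gives twice a sum of κ_J + 1 signs, hence twice an odd number. Since all κᵢ are even, the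
cocycle of one choice vanishes on the cycles of the other choices (`Detects.pinned`).

A choice is usable as soon as one κ_J can be raised inside its block. Letting κ vary over the
surrounded positive blocks, at most one choice is lost, which explains the -1. Throughout, a change
of label must merge or split circles; for closed braids this is `planar_closure`. -/

namespace LinkDiagram

/-! ### Circles of a smoothed diagram when one label changes. -/

section Circles

variable {D : LinkDiagram}

/-- The edges `e` and `f` lie on the same circle of `sD`. -/
def Conn (s : D.State) (e f : D.Edge) : Prop := D.circleOf s e = D.circleOf s f

theorem Conn.refl (s : D.State) (e : D.Edge) : Conn s e e := rfl

theorem Conn.symm {s : D.State} {e f : D.Edge} (h : Conn s e f) : Conn s f e := Eq.symm h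

theorem Conn.trans {s : D.State} {e f g : D.Edge} (h : Conn s e f) (h' : Conn s f g) :
    Conn s e g := Eq.trans h h'

theorem Conn.of_follows {s : D.State} {e f : D.Edge} (h : D.Follows s e f) : Conn s e f :=
  Quot.sound h

/-- A function that is constant along the smoothed diagram is constant on its circles. -/
theorem Conn.lift_eq {s : D.State} {α : Sort*} (g : D.Edge → α)
    (hg : ∀ e f, D.Follows s e f → g e = g f) {e f : D.Edge} (h : Conn s e f) : g e = g f :=
  congrArg (Quot.lift g hg) h

theorem conn_ab {s : D.State} {x : Fin D.numCrossings} (h : s x = false) :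
    Conn s (D.crossing x).a (D.crossing x).b :=
  .of_follows (.inr ⟨x, by rw [h]; exact .inl ⟨rfl, rfl⟩⟩)

theorem conn_cd {s : D.State} {x : Fin D.numCrossings} (h : s x = false) :
    Conn s (D.crossing x).c (D.crossing x).d :=
  .of_follows (.inr ⟨x, by rw [h]; exact .inr ⟨rfl, rfl⟩⟩)

theorem conn_ad {s : D.State} {x : Fin D.numCrossings} (h : s x = true) :
    Conn s (D.crossing x).a (D.crossing x).d :=
  .of_follows (.inr ⟨x, by rw [h]; exact .inl ⟨rfl, rfl⟩⟩)

theorem conn_bc {s : D.State} {x : Fin D.numCrossings} (h : s x = true) :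
    Conn s (D.crossing x).b (D.crossing x).c :=
  .of_follows (.inr ⟨x, by rw [h]; exact .inr ⟨rfl, rfl⟩⟩)

/-- The circle of `e` passes by the crossing `x`. -/
def Passes (s : D.State) (x : Fin D.numCrossings) (e : D.Edge) : Prop :=
  Conn s e (D.crossing x).a ∨ Conn s e (D.crossing x).c

theorem Passes.of_conn {s : D.State} {x : Fin D.numCrossings} {e f : D.Edge} (h : Conn s e f)
    (hf : Passes s x f) : Passes s x e :=
  hf.imp h.trans h.trans

theorem passes_of_touches {s : D.State} {x : Fin D.numCrossings} {e : D.Edge}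
    (h : (D.crossing x).Touches e) : Passes s x e := by
  rcases hs : s x with _ | _
  · rcases h with rfl | rfl | rfl | rfl
    · exact .inl rfl
    · exact .inl (conn_ab hs).symm
    · exact .inr rfl
    · exact .inr (conn_cd hs).symm
  · rcases h with rfl | rfl | rfl | rfl
    · exact .inl rfl
    · exact .inr (conn_bc hs)
    · exact .inr rfl
    · exact .inl (conn_ad hs).symm

theorem passes_iff_touches {s : D.State} {x : Fin D.numCrossings} {e : D.Edge} :
    Passes s x e ↔ ∃ f, (D.crossing x).Touches f ∧ Conn s e f := by
  constructor
  · rintro (h | h)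
    · exact ⟨_, .inl rfl, h⟩
    · exact ⟨_, .inr (.inr (.inl rfl)), h⟩
  · rintro ⟨f, hf, h⟩
    exact (passes_of_touches hf).of_conn h

open Classical in
/-- The circle of an edge in `sD`, with the circles passing by `x` collapsed. -/
noncomputable def collapse (s : D.State) (x : Fin D.numCrossings) (e : D.Edge) :
    Option (D.Circle s) :=
  if Passes s x e then none else some (D.circleOf s e)

theorem collapse_eq_iff {s : D.State} {x : Fin D.numCrossings} {e f : D.Edge} :
    collapse s x e = collapse s x f ↔ Conn s e f ∨ (Passes s x e ∧ Passes s x f) := by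
  unfold collapse
  split_ifs with h1 h2 h2
  · simp [h1, h2]
  · simp only [false_iff, not_or]
    exact ⟨fun h => h2 (h1.of_conn h.symm), fun h => h2 h.2⟩
  · simp only [false_iff, not_or]
    exact ⟨fun h => h1 (h2.of_conn h), fun h => h1 h.1⟩
  · simp only [Option.some.injEq, h1, false_and, or_false]; rfl

/-- Away from `x` both states make the same joins, and the joins at `x` only involve edges whose
circles pass by `x`. After these circles are collapsed to a point, the label at `x` no longer
matters. -/
theorem conn_or_passes {s s' : D.State} {x : Fin D.numCrossings} (hss : ∀ y, y ≠ x → s y = s' y)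
    {e f : D.Edge} (h : Conn s e f) : Conn s' e f ∨ (Passes s' x e ∧ Passes s' x f) := by
  rw [← collapse_eq_iff]
  refine h.lift_eq (collapse s' x) ?_
  rintro e f (h | ⟨y, hy⟩)
  · exact collapse_eq_iff.2 (.inl (.of_follows (.inl h)))
  · by_cases hyx : y = x
    · subst hyx
      refine collapse_eq_iff.2 (.inr ⟨passes_of_touches ?_, passes_of_touches ?_⟩) <;>
      · revert hy
        cases s y <;> simp only [LinkCrossing.Smoothing, LinkCrossing.Touches] <;> tauto
    · rw [hss y hyx] at hy
      exact collapse_eq_iff.2 (.inl (.of_follows (.inr ⟨y, hy⟩)))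

theorem passes_a (s : D.State) (x : Fin D.numCrossings) : Passes s x (D.crossing x).a := .inl rfl

theorem passes_c (s : D.State) (x : Fin D.numCrossings) : Passes s x (D.crossing x).c := .inr rfl

theorem Passes.transfer {s s' : D.State} {x : Fin D.numCrossings}
    (hss : ∀ y, y ≠ x → s y = s' y) {e : D.Edge} (h : Passes s x e) : Passes s' x e := by
  rcases h with h | h
  · rcases conn_or_passes hss h with h | h
    · exact .inl h
    · exact h.1
  · rcases conn_or_passes hss h with h | h
    · exact .inr h
    · exact h.1

theorem Conn.of_join {s s' : D.State} {x : Fin D.numCrossings} (hss : ∀ y, y ≠ x → s y = s' y)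
    (hac : Conn s' (D.crossing x).a (D.crossing x).c) {e f : D.Edge} (h : Conn s e f) :
    Conn s' e f := by
  have key : ∀ {g}, Passes s' x g → Conn s' g (D.crossing x).a := by
    rintro g (h | h)
    · exact h
    · exact h.trans hac.symm
  rcases conn_or_passes hss h with h | ⟨h1, h2⟩
  · exact h
  · exact (key h1).trans (key h2).symm

/-- If two states differ only at `x`, and the two circles at `x` agree in the second but not in the
first, then the first has one more circle. -/
theorem card_circle_of_join {s s' : D.State} {x : Fin D.numCrossings}
    (hss : ∀ y, y ≠ x → s y = s' y) (hac : Conn s' (D.crossing x).a (D.crossing x).c)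
    (hac' : ¬ Conn s (D.crossing x).a (D.crossing x).c) :
    Fintype.card (D.Circle s) = Fintype.card (D.Circle s') + 1 := by
  classical
  let π : D.Circle s → D.Circle s' := Quot.lift (D.circleOf s')
    fun e f h => Conn.of_join hss hac (Conn.of_follows h)
  have hπ : ∀ e, π (D.circleOf s e) = D.circleOf s' e := fun _ => rfl
  -- The circles at `a` and `c` become one, so one of them is left out to make the projection a
  -- bijection.
  let p : D.Circle s → Prop := fun C => C ≠ D.circleOf s (D.crossing x).c
  have hbij : Function.Bijective (fun C : {C // p C} => π C.1) := by
    constructor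
    · rintro ⟨⟨e⟩, he⟩ ⟨⟨f⟩, hf⟩ h
      have h : Conn s' e f := h
      have he : ¬ Conn s e (D.crossing x).c := he
      have hf : ¬ Conn s f (D.crossing x).c := hf
      refine Subtype.ext ?_
      rcases conn_or_passes (fun y hy => (hss y hy).symm) h with h | ⟨h1, h2⟩
      · exact h
      · exact (h1.resolve_right he).trans (h2.resolve_right hf).symm
    · rintro ⟨e⟩
      by_cases he : Conn s e (D.crossing x).c
      · exact ⟨⟨D.circleOf s (D.crossing x).a, hac'⟩,
          hac.trans (Conn.of_join hss hac he).symm⟩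
      · exact ⟨⟨D.circleOf s e, he⟩, rfl⟩
  have h1 := Fintype.card_of_bijective hbij
  have h2 := Fintype.card_subtype_compl (fun C => C = D.circleOf s (D.crossing x).c)
  have h3 : 0 < Fintype.card (D.Circle s) := Fintype.card_pos_iff.2 ⟨D.circleOf s (D.crossing x).c⟩
  have h4 : Fintype.card {C // p C} =
    Fintype.card {C // ¬ C = D.circleOf s (D.crossing x).c} := rfl
  rw [Fintype.card_subtype_eq] at h2
  omega

end Circles

end LinkDiagram

/-! ### Enhanced states and the merging and splitting rules. -/

namespace LinkDiagram

section Enhanced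

variable {D : LinkDiagram}

noncomputable instance : Fintype D.EnhancedState := Fintype.ofFinite _

/-- The state obtained from `s` by relabelling the crossing `x` with `B`. -/
def addB (s : D.State) (x : Fin D.numCrossings) : D.State := Function.update s x true

@[simp] theorem addB_self (s : D.State) (x : Fin D.numCrossings) : addB s x x = true := by
  simp [addB]

theorem addB_of_ne {s : D.State} {x y : Fin D.numCrossings} (h : y ≠ x) : addB s x y = s y := by
  simp [addB, h]

theorem addB_comm (s : D.State) (x y : Fin D.numCrossings) :
    addB (addB s x) y = addB (addB s y) x := by
  funext z
  by_cases h1 : z = x <;> by_cases h2 : z = y <;> simp [addB, Function.update_apply, h1, h2]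

theorem eq_addB_iff {s t : D.State} {x : Fin D.numCrossings} :
    t = addB s x ↔ t x = true ∧ ∀ y, y ≠ x → t y = s y := by
  constructor
  · rintro rfl
    exact ⟨addB_self s x, fun y hy => addB_of_ne hy⟩
  · rintro ⟨h, h'⟩
    funext y
    by_cases hy : y = x
    · subst hy; simp [h]
    · rw [addB_of_ne hy, h' y hy]

theorem card_addB {s : D.State} {x : Fin D.numCrossings} (h : s x = false) :
    (Finset.univ.filter fun y => addB s x y = true).card =
      (Finset.univ.filter fun y => s y = true).card + 1 := by
  have : (Finset.univ.filter fun y => addB s x y = true) =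
      insert x (Finset.univ.filter fun y => s y = true) := by
    ext y
    by_cases hy : y = x
    · subst hy; simp
    · simp [addB_of_ne hy, hy]
  rw [this, Finset.card_insert_of_notMem (by simp [h])]

open Classical in
/-- The number of negative circles. -/
noncomputable def EnhancedState.numNeg (S : D.EnhancedState) : ℕ :=
  (Finset.univ.filter fun C => S.sign C = -1).card

theorem EnhancedState.theta_eq (S : D.EnhancedState) :
    S.theta = Fintype.card (D.Circle S.state) - 2 * S.numNeg := by
  classical
  have h : ∀ C, ((S.sign C : ℤˣ) : ℤ) = 1 - 2 * (if S.sign C = -1 then 1 else 0) := by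
    intro C
    rcases Int.units_eq_one_or (S.sign C) with h | h <;> rw [h] <;> simp
  unfold EnhancedState.theta EnhancedState.numNeg
  simp_rw [h]
  rw [Finset.sum_sub_distrib, ← Finset.mul_sum]
  simp

/-- The signs agree on the circles that do not pass by `x`. -/
def AgreeOff (x : Fin D.numCrossings) (S T : D.EnhancedState) : Prop :=
  ∀ e, ¬ Passes S.state x e → T.sign (D.circleOf T.state e) = S.sign (D.circleOf S.state e)

/-- The change of label already raises `i` by one, so equality of `j` amounts to a drop of `θ` by
one. -/
theorem adjacentAt_iff {x : Fin D.numCrossings} {S T : D.EnhancedState} :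
    AdjacentAt x S T ↔ S.state x = false ∧ T.state = addB S.state x ∧
      T.theta + 1 = S.theta ∧ AgreeOff x S T := by
  have hoff : (∀ e : D.Edge,
      (∀ f, (D.crossing x).Touches f → D.circleOf S.state e ≠ D.circleOf S.state f) →
      T.sign (D.circleOf T.state e) = S.sign (D.circleOf S.state e)) ↔ AgreeOff x S T := by
    refine forall_congr' fun e => ?_
    rw [passes_iff_touches]
    simp only [not_exists, not_and]
    rfl
  unfold AdjacentAt
  rw [hoff, eq_addB_iff]
  constructor
  · rintro ⟨h1, h2, h3, h4, h5, h6⟩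
    refine ⟨h3, ⟨h4, h5⟩, ?_, h6⟩
    unfold EnhancedState.j at h2
    omega
  · rintro ⟨h3, h45, h2, h6⟩
    have h1 : T.i = S.i + 1 := by
      have := eq_addB_iff.2 h45
      unfold EnhancedState.i
      rw [this, card_addB h3]
      simp
    refine ⟨h1, ?_, h3, h45.1, h45.2, h6⟩
    unfold EnhancedState.j
    omega

theorem addB_agree {s : D.State} {x : Fin D.numCrossings} : ∀ y, y ≠ x → s y = addB s x y :=
  fun _ hy => (addB_of_ne hy).symm

theorem addB_agree' {s : D.State} {x : Fin D.numCrossings} : ∀ y, y ≠ x → addB s x y = s y :=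
  fun _ hy => addB_of_ne hy

/-- The two edges `a`, `c` of the crossing `x` lie on the same circle. -/
abbrev Loop (s : D.State) (x : Fin D.numCrossings) : Prop :=
  Conn s (D.crossing x).a (D.crossing x).c

variable (D) in
/-- Changing the label of a crossing merges two circles or splits one circle, as it is the case for
diagrams drawn in the plane. -/
def Planar : Prop := ∀ (s : D.State) (x : Fin D.numCrossings), s x = false →
  (Loop s x ↔ ¬ Loop (addB s x) x)

/-- By `theta_eq`, `θ` is the number of circles minus twice the number of negative ones. A merge
loses a circle, which accounts for the whole drop of `θ`. A split gains a circle, so one more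
negative circle is needed. -/
theorem adjacentAt_iff_of_merge {x : Fin D.numCrossings} {S T : D.EnhancedState}
    (hx : S.state x = false) (hT : T.state = addB S.state x)
    (h0 : ¬ Loop S.state x) (h1 : Loop T.state x) :
    AdjacentAt x S T ↔ T.numNeg = S.numNeg ∧ AgreeOff x S T := by
  have := card_circle_of_join (s := S.state) (s' := T.state) (hT ▸ addB_agree) h1 h0
  rw [adjacentAt_iff, T.theta_eq, S.theta_eq]
  constructor
  · rintro ⟨_, _, h, h'⟩; exact ⟨by omega, h'⟩
  · rintro ⟨h, h'⟩; exact ⟨hx, hT, by omega, h'⟩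

theorem adjacentAt_iff_of_split {x : Fin D.numCrossings} {S T : D.EnhancedState}
    (hx : S.state x = false) (hT : T.state = addB S.state x)
    (h0 : Loop S.state x) (h1 : ¬ Loop T.state x) :
    AdjacentAt x S T ↔ T.numNeg = S.numNeg + 1 ∧ AgreeOff x S T := by
  have := card_circle_of_join (s := T.state) (s' := S.state) (hT ▸ addB_agree') h0 h1
  rw [adjacentAt_iff, T.theta_eq, S.theta_eq]
  constructor
  · rintro ⟨_, _, h, h'⟩; exact ⟨by omega, h'⟩
  · rintro ⟨h, h'⟩; exact ⟨hx, hT, by omega, h'⟩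

open Classical in
/-- The enhanced state on `s` whose negative circles are those in `M`. -/
noncomputable def ofNeg (s : D.State) (M : Finset (D.Circle s)) : D.EnhancedState :=
  ⟨s, fun C => if C ∈ M then -1 else 1⟩

@[simp] theorem ofNeg_state (s : D.State) (M : Finset (D.Circle s)) : (ofNeg s M).state = s := rfl

theorem ofNeg_sign_eq_neg {s : D.State} {M : Finset (D.Circle s)} {C : D.Circle s} :
    (ofNeg s M).sign C = -1 ↔ C ∈ M := by
  unfold ofNeg
  dsimp only
  split_ifs with h <;> simp [h]

theorem numNeg_ofNeg (s : D.State) (M : Finset (D.Circle s)) : (ofNeg s M).numNeg = M.card := by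
  classical
  unfold EnhancedState.numNeg
  simp only [ofNeg_sign_eq_neg, ofNeg_state]
  congr 1
  ext C
  simp only [Finset.mem_filter]
  exact ⟨And.right, fun h => ⟨Finset.mem_univ _, h⟩⟩

theorem exists_eq_ofNeg (S : D.EnhancedState) : ∃ M, S = ofNeg S.state M := by
  classical
  obtain ⟨s, σ⟩ := S
  refine ⟨Finset.univ.filter fun C => σ C = -1, ?_⟩
  unfold ofNeg
  congr 1
  funext C
  rcases Int.units_eq_one_or (σ C) with h | h <;> simp [h]

theorem ofNeg_injective {s : D.State} {M M' : Finset (D.Circle s)} :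
    ofNeg s M = ofNeg s M' ↔ M = M' := by
  refine ⟨fun h => ?_, fun h => h ▸ rfl⟩
  ext C
  rw [← ofNeg_sign_eq_neg, ← ofNeg_sign_eq_neg]
  unfold ofNeg at h ⊢
  injection h with _ h
  have := congrFun h C
  dsimp only at this ⊢
  rw [this]

theorem agreeOff_ofNeg {s t : D.State} {x : Fin D.numCrossings} {M : Finset (D.Circle s)}
    {M' : Finset (D.Circle t)} :
    AgreeOff x (ofNeg s M) (ofNeg t M') ↔
      ∀ e, ¬ Passes s x e → (D.circleOf t e ∈ M' ↔ D.circleOf s e ∈ M) := by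
  refine forall_congr' fun e => imp_congr_right fun _ => ?_
  rw [← ofNeg_sign_eq_neg, ← ofNeg_sign_eq_neg]
  have : ∀ u v : ℤˣ, u = v ↔ (u = -1 ↔ v = -1) := by decide
  exact this _ _

/-- All circles are positive. -/
noncomputable def plus (s : D.State) : D.EnhancedState := ofNeg s ∅

/-- Only the circle of `e` is negative. -/
noncomputable def one (s : D.State) (e : D.Edge) : D.EnhancedState := ofNeg s {D.circleOf s e}

open Classical in
/-- Only the circles of `e` and `f` are negative. -/
noncomputable def two (s : D.State) (e f : D.Edge) : D.EnhancedState :=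
  ofNeg s {D.circleOf s e, D.circleOf s f}

theorem one_eq_one_iff {s : D.State} {e f : D.Edge} : one s e = one s f ↔ Conn s e f := by
  unfold one
  rw [ofNeg_injective, Finset.singleton_inj]
  rfl

theorem two_comm (s : D.State) (e f : D.Edge) : two s e f = two s f e := by
  classical
  unfold two
  rw [Finset.pair_comm]

theorem Planar.merge (hD : D.Planar) {s : D.State} {x : Fin D.numCrossings} (hx : s x = false)
    (h : ¬ Loop s x) : Loop (addB s x) x := by
  by_contra h'
  exact h ((hD s x hx).2 h')

theorem Planar.split (hD : D.Planar) {s : D.State} {x : Fin D.numCrossings} (hx : s x = false)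
    (h : Loop s x) : ¬ Loop (addB s x) x := (hD s x hx).1 h

variable {s : D.State} {x : Fin D.numCrossings}

theorem adjacentAt_plus_of_merge (hx : s x = false) (h0 : ¬ Loop s x) (h1 : Loop (addB s x) x)
    (T : D.EnhancedState) : AdjacentAt x (plus s) T ↔ T = plus (addB s x) := by
  by_cases hT : T.state = addB s x
  · obtain ⟨M, hM⟩ := exists_eq_ofNeg T
    generalize T.state = t at *
    subst hT hM
    rw [plus, plus, adjacentAt_iff_of_merge hx rfl h0 h1, numNeg_ofNeg, numNeg_ofNeg,
      ofNeg_injective, agreeOff_ofNeg]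
    simp only [Finset.card_empty, Finset.card_eq_zero]
    constructor
    · exact And.left
    · rintro rfl; simp
  · constructor
    · intro h; exact absurd (adjacentAt_iff.1 h).2.1 hT
    · rintro rfl; exact absurd rfl hT

theorem adjacentAt_plus_of_split (hx : s x = false) (h0 : Loop s x) (h1 : ¬ Loop (addB s x) x)
    (T : D.EnhancedState) : AdjacentAt x (plus s) T ↔
      T = one (addB s x) (D.crossing x).a ∨ T = one (addB s x) (D.crossing x).c := by
  by_cases hT : T.state = addB s x
  · obtain ⟨M, hM⟩ := exists_eq_ofNeg T
    generalize T.state = t at *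
    subst hT hM
    rw [plus, one, one, adjacentAt_iff_of_split hx rfl h0 h1, numNeg_ofNeg, numNeg_ofNeg,
      ofNeg_injective, ofNeg_injective, agreeOff_ofNeg]
    simp only [Finset.card_empty, zero_add, Finset.notMem_empty, iff_false]
    constructor
    · rintro ⟨hc, h⟩
      obtain ⟨⟨e⟩, rfl⟩ := Finset.card_eq_one.1 hc
      have he : Passes s x e := by
        by_contra he
        exact h e he (Finset.mem_singleton_self _)
      rcases he.transfer (addB_agree (s := s) (x := x)) with he | he
      · exact .inl (congrArg _ he)
      · exact .inr (congrArg _ he)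
    · rintro (rfl | rfl)
      all_goals
        refine ⟨Finset.card_singleton _, fun e he hm => he ?_⟩
        rw [Finset.mem_singleton] at hm
        refine Passes.transfer (addB_agree' (s := s) (x := x)) ?_
      · exact .inl hm
      · exact .inr hm
  · constructor
    · intro h; exact absurd (adjacentAt_iff.1 h).2.1 hT
    · rintro (rfl | rfl) <;> exact absurd rfl hT

theorem adjacentAt_one_of_merge (hx : s x = false) (h0 : ¬ Loop s x) (h1 : Loop (addB s x) x)
    (e : D.Edge) (T : D.EnhancedState) :
    AdjacentAt x (one s e) T ↔ T = one (addB s x) e := by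
  by_cases hT : T.state = addB s x
  · obtain ⟨M, hM⟩ := exists_eq_ofNeg T
    generalize T.state = t at *
    subst hT hM
    rw [one, one, adjacentAt_iff_of_merge hx rfl h0 h1, numNeg_ofNeg, numNeg_ofNeg,
      ofNeg_injective, agreeOff_ofNeg]
    simp only [Finset.card_singleton, Finset.mem_singleton]
    constructor
    · rintro ⟨hc, h⟩
      obtain ⟨⟨f⟩, rfl⟩ := Finset.card_eq_one.1 hc
      change ∀ e', ¬ Passes s x e' → (D.circleOf (addB s x) e' ∈ {D.circleOf (addB s x) f} ↔ _) at h
      refine congrArg _ (show D.circleOf (addB s x) f = _ from ?_)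
      simp only [Finset.mem_singleton] at h
      by_cases he : Passes s x e
      · have hf : Passes s x f := by
          by_contra hf
          exact hf (he.of_conn ((h f hf).1 rfl))
        rcases hf.transfer (addB_agree (s := s) (x := x)) with hf' | hf' <;>
        rcases he.transfer (addB_agree (s := s) (x := x)) with he' | he'
        · exact hf'.trans he'.symm
        · exact (hf'.trans h1).trans he'.symm
        · exact (hf'.trans h1.symm).trans he'.symm
        · exact hf'.trans he'.symm
      · exact ((h e he).2 rfl).symm
    · rintro rfl
      refine ⟨Finset.card_singleton _, fun f hf => ?_⟩
      rw [Finset.mem_singleton]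
      constructor
      · intro h
        exact (conn_or_passes (addB_agree' (s := s) (x := x)) h).resolve_right fun h => hf h.1
      · intro h
        exact Conn.of_join (addB_agree (s := s) (x := x)) h1 h
  · constructor
    · intro h; exact absurd (adjacentAt_iff.1 h).2.1 hT
    · rintro rfl; exact absurd rfl hT

/-- If the negative circle does not pass by `x`, either half of the split circle may become
negative, and both alternatives occur. If the negative circle is the one that splits, both halves
become negative. Then `e` lies on one of them, and the inequality conditions leave exactly one
alternative. -/
theorem adjacentAt_one_of_split (hx : s x = false) (h0 : Loop s x) (h1 : ¬ Loop (addB s x) x)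
    (e : D.Edge) (T : D.EnhancedState) : AdjacentAt x (one s e) T ↔
      (¬ Conn (addB s x) e (D.crossing x).a ∧ T = two (addB s x) e (D.crossing x).a) ∨
      (¬ Conn (addB s x) e (D.crossing x).c ∧ T = two (addB s x) e (D.crossing x).c) := by
  classical
  by_cases hT : T.state = addB s x
  · obtain ⟨M, hM⟩ := exists_eq_ofNeg T
    generalize T.state = t at *
    subst hT hM
    rw [one, two, two, adjacentAt_iff_of_split hx rfl h0 h1, numNeg_ofNeg, numNeg_ofNeg,
      ofNeg_injective, ofNeg_injective, agreeOff_ofNeg]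
    simp only [Finset.card_singleton, Finset.mem_singleton]
    have down : ∀ {f g}, Conn (addB s x) f g → Conn s f g := fun h =>
      Conn.of_join (addB_agree' (s := s) (x := x)) h0 h
    have up : ∀ {f g}, ¬ Passes s x g → Conn s f g → Conn (addB s x) f g := fun hg h =>
      (conn_or_passes (addB_agree (s := s) (x := x)) h).resolve_right fun h =>
        hg (h.2.transfer (addB_agree' (s := s) (x := x)))
    constructor
    · rintro ⟨hc, h⟩
      obtain ⟨⟨f⟩, ⟨g⟩, hfg, rfl⟩ := Finset.card_eq_two.1 hc
      change ∀ e', ¬ Passes s x e' → (D.circleOf (addB s x) e' ∈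
        ({D.circleOf (addB s x) f, D.circleOf (addB s x) g} : Finset _) ↔ _) at h
      change ¬ Conn (addB s x) f g at hfg
      change _ ∧ ({D.circleOf (addB s x) f, D.circleOf (addB s x) g} : Finset _) = _ ∨
        _ ∧ ({D.circleOf (addB s x) f, D.circleOf (addB s x) g} : Finset _) = _
      simp only [Finset.mem_insert, Finset.mem_singleton] at h
      have hor : ∀ {f}, Passes s x f → Conn (addB s x) f (D.crossing x).a ∨
          Conn (addB s x) f (D.crossing x).c := fun hf =>
        hf.transfer (addB_agree (s := s) (x := x))
      by_cases he : Passes s x e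
      · have hf : Passes s x f := by
          by_contra hf
          exact hf (he.of_conn ((h f hf).1 (.inl rfl)))
        have hg : Passes s x g := by
          by_contra hg
          exact hg (he.of_conn ((h g hg).1 (.inr rfl)))
        have hM : ({D.circleOf (addB s x) f, D.circleOf (addB s x) g} : Finset _) =
            {D.circleOf (addB s x) (D.crossing x).a, D.circleOf (addB s x) (D.crossing x).c} := by
          rcases hor hf with hf | hf <;> rcases hor hg with hg | hg
          · exact absurd (hf.trans hg.symm) hfg
          · rw [show D.circleOf (addB s x) f = _ from hf, show D.circleOf (addB s x) g = _ from hg]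
          · rw [show D.circleOf (addB s x) f = _ from hf, show D.circleOf (addB s x) g = _ from hg,
              Finset.pair_comm]
          · exact absurd (hf.trans hg.symm) hfg
        rcases hor he with he | he
        · refine .inr ⟨fun h => h1 (he.symm.trans h), ?_⟩
          rw [hM, show D.circleOf (addB s x) e = _ from he]
        · refine .inl ⟨fun h => h1 (h.symm.trans he), ?_⟩
          rw [hM, show D.circleOf (addB s x) e = _ from he, Finset.pair_comm]
      · have hne : ∀ {f}, Passes s x f → ¬ Conn (addB s x) e f := fun hf h =>
          he (hf.of_conn (down h))
        have key : ∀ {f g}, (∀ e', ¬ Passes s x e' → (D.circleOf (addB s x) e' =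
            D.circleOf (addB s x) f ∨ D.circleOf (addB s x) e' = D.circleOf (addB s x) g ↔
            D.circleOf s e' = D.circleOf s e)) → Conn (addB s x) e f →
            ¬ Conn (addB s x) f g → 
            (¬ Conn (addB s x) e (D.crossing x).a ∧
              ({D.circleOf (addB s x) f, D.circleOf (addB s x) g} : Finset _) =
              {D.circleOf (addB s x) e, D.circleOf (addB s x) (D.crossing x).a}) ∨
            (¬ Conn (addB s x) e (D.crossing x).c ∧
              ({D.circleOf (addB s x) f, D.circleOf (addB s x) g} : Finset _) =
              {D.circleOf (addB s x) e, D.circleOf (addB s x) (D.crossing x).c}) := by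
          intro f g h hef hfg
          have hg : Passes s x g := by
            by_contra hg
            exact hfg (hef.symm.trans (up he ((h g hg).1 (.inr rfl))).symm)
          rcases hor hg with hg | hg
          · refine .inl ⟨hne (passes_a s x), ?_⟩
            rw [show D.circleOf (addB s x) g = _ from hg, show D.circleOf (addB s x) e = _ from hef]
          · refine .inr ⟨hne (passes_c s x), ?_⟩
            rw [show D.circleOf (addB s x) g = _ from hg, show D.circleOf (addB s x) e = _ from hef]
        rcases (h e he).2 rfl with hef | heg
        · exact key h hef hfg
        · rw [Finset.pair_comm]
          exact key (fun e' he' => (or_comm.trans (h e' he'))) heg fun h => hfg h.symm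
    · have key : ∀ g, Passes s x g → ¬ Conn (addB s x) e g →
          ({D.circleOf (addB s x) e, D.circleOf (addB s x) g} : Finset _).card = 1 + 1 ∧
          ∀ e', ¬ Passes s x e' → (D.circleOf (addB s x) e' ∈
            ({D.circleOf (addB s x) e, D.circleOf (addB s x) g} : Finset _) ↔
            D.circleOf s e' = D.circleOf s e) := by
        intro g hg heg
        refine ⟨Finset.card_pair heg, fun f hf => ?_⟩
        rw [Finset.mem_insert, Finset.mem_singleton]
        constructor
        · rintro (h | h)
          · exact down h
          · exact absurd (hg.of_conn (down h)) hf
        · intro h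
          exact .inl (up hf (Conn.symm h)).symm
      rintro (⟨h, rfl⟩ | ⟨h, rfl⟩)
      · exact key _ (passes_a s x) h
      · exact key _ (passes_c s x) h
  · constructor
    · intro h; exact absurd (adjacentAt_iff.1 h).2.1 hT
    · rintro (⟨_, rfl⟩ | ⟨_, rfl⟩) <;> exact absurd rfl hT

end Enhanced

end LinkDiagram

/-! ### The differential vanishes twice on states without negative circles. -/

namespace LinkDiagram

section Differential

variable {D : LinkDiagram}

/-- The sign of the change of the crossing `x` in the state `s`. -/
def edgeSign (s : D.State) (x : Fin D.numCrossings) : ℤ :=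
  (-1) ^ (Finset.univ.filter fun y => y < x ∧ s y = true).card

theorem edgeSign_addB_of_lt {s : D.State} {x y : Fin D.numCrossings} (hx : s x = false)
    (h : x < y) : edgeSign (addB s x) y = - edgeSign s y := by
  have : (Finset.univ.filter fun z => z < y ∧ addB s x z = true) =
      insert x (Finset.univ.filter fun z => z < y ∧ s z = true) := by
    ext z
    by_cases hz : z = x
    · subst hz; simp [h]
    · simp [addB_of_ne hz, hz]
  unfold edgeSign
  rw [this, Finset.card_insert_of_notMem (by simp [hx]), pow_succ]
  ring

theorem edgeSign_addB_of_gt {s : D.State} {x y : Fin D.numCrossings} (h : y < x) :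
    edgeSign (addB s x) y = edgeSign s y := by
  have : (Finset.univ.filter fun z => z < y ∧ addB s x z = true) =
      (Finset.univ.filter fun z => z < y ∧ s z = true) := by
    ext z
    by_cases hz : z = x
    · subst hz; simp [h.not_gt]
    · simp [addB_of_ne hz]
  unfold edgeSign
  rw [this]

/-- Only the later of the two crossings sees the label of the earlier one, so exactly one of the
signs flips. -/
theorem edgeSign_anticomm {s : D.State} {x y : Fin D.numCrossings} (hx : s x = false)
    (hy : s y = false) (hxy : x ≠ y) :
    edgeSign s x * edgeSign (addB s x) y = - (edgeSign s y * edgeSign (addB s y) x) := by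
  rcases lt_or_gt_of_ne hxy with h | h
  · rw [edgeSign_addB_of_lt hx h, edgeSign_addB_of_gt h]; ring
  · rw [edgeSign_addB_of_gt h, edgeSign_addB_of_lt hy h]; ring

theorem odd_edgeSign (s : D.State) (x : Fin D.numCrossings) : Odd (edgeSign s x) :=
  Odd.pow (by decide)

open Classical in
theorem incidence_eq (S T : D.EnhancedState) :
    incidence S T = ∑ x, if AdjacentAt x S T then edgeSign S.state x else 0 := rfl

open Classical in
theorem sum_adjacentAt_plus_merge {s : D.State} {x : Fin D.numCrossings} (hD : D.Planar)
    (hx : s x = false) (h : ¬ Loop s x) (g : D.EnhancedState → ℤ) :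
    (∑ T, if AdjacentAt x (plus s) T then g T else 0) = g (plus (addB s x)) := by
  simp_rw [adjacentAt_plus_of_merge hx h (hD.merge hx h)]
  simp

open Classical in
theorem sum_adjacentAt_plus_split {s : D.State} {x : Fin D.numCrossings} (hD : D.Planar)
    (hx : s x = false) (h : Loop s x) (g : D.EnhancedState → ℤ) :
    (∑ T, if AdjacentAt x (plus s) T then g T else 0) =
      g (one (addB s x) (D.crossing x).a) + g (one (addB s x) (D.crossing x).c) := by
  have hne : one (addB s x) (D.crossing x).a ≠ one (addB s x) (D.crossing x).c := fun h' =>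
    hD.split hx h (one_eq_one_iff.1 h')
  simp_rw [adjacentAt_plus_of_split hx h (hD.split hx h)]
  rw [← Finset.sum_filter, Finset.filter_or, Finset.sum_union]
  · rw [Finset.sum_filter, Finset.sum_filter]
    simp
  · rw [Finset.disjoint_filter]
    rintro T - rfl
    exact hne

/-- The number of ways from `S` to `U` that change first `x` and then `y`. -/
noncomputable def paths (S U : D.EnhancedState) (x y : Fin D.numCrossings) : ℤ :=
  open Classical in ∑ T, if AdjacentAt x S T then if AdjacentAt y T U then 1 else 0 else 0

theorem paths_eq_zero {S U : D.EnhancedState} {x y : Fin D.numCrossings}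
    (h : x = y ∨ S.state x = true ∨ S.state y = true) : paths S U x y = 0 := by
  classical
  refine Finset.sum_eq_zero fun T _ => ?_
  split_ifs with h1 h2 <;> try rfl
  exfalso
  obtain ⟨hx, hT, -⟩ := adjacentAt_iff.1 h1
  obtain ⟨hy, -⟩ := adjacentAt_iff.1 h2
  rw [hT] at hy
  by_cases hxy : y = x
  · subst hxy; simp at hy
  · rw [addB_of_ne hxy] at hy
    rcases h with h | h | h
    · exact hxy h.symm
    · simp [hx] at h
    · simp [hy] at h

open Classical in
theorem adjacentAt_one_of_split_indicator {s : D.State} {x : Fin D.numCrossings} (hD : D.Planar)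
    (hx : s x = false) (h : Loop s x) (e : D.Edge) (T : D.EnhancedState) :
    (if AdjacentAt x (one s e) T then 1 else 0 : ℤ) =
      (if ¬ Conn (addB s x) e (D.crossing x).a ∧ T = two (addB s x) e (D.crossing x).a
        then 1 else 0) +
      (if ¬ Conn (addB s x) e (D.crossing x).c ∧ T = two (addB s x) e (D.crossing x).c
        then 1 else 0) := by
  rw [if_congr (adjacentAt_one_of_split hx h (hD.split hx h) e T) rfl rfl]
  by_cases h1 : ¬ Conn (addB s x) e (D.crossing x).a ∧ T = two (addB s x) e (D.crossing x).a
  · rw [if_pos (.inl h1), if_pos h1, if_neg]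
    · rfl
    · rintro ⟨h2, h3⟩
      rw [h1.2, two, two, ofNeg_injective] at h3
      have : D.circleOf (addB s x) (D.crossing x).a ∈
          ({D.circleOf (addB s x) e, D.circleOf (addB s x) (D.crossing x).c} : Finset _) := by
        rw [← h3]; simp
      rw [Finset.mem_insert, Finset.mem_singleton] at this
      rcases this with h' | h'
      · exact h1.1 h'.symm
      · exact hD.split hx h h'
  · rw [if_neg h1, zero_add]
    exact if_congr (or_iff_right h1) rfl rfl

theorem card_addB_eq (hD : D.Planar) {s : D.State} {x : Fin D.numCrossings} (hx : s x = false) :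
    (Fintype.card (D.Circle (addB s x)) = Fintype.card (D.Circle s) + 1 ∧ Loop s x) ∨
    (Fintype.card (D.Circle (addB s x)) + 1 = Fintype.card (D.Circle s) ∧ ¬ Loop s x) := by
  by_cases h : Loop s x
  · exact .inl ⟨card_circle_of_join addB_agree' h (hD.split hx h), h⟩
  · exact .inr ⟨(card_circle_of_join addB_agree (hD.merge hx h) h).symm, h⟩

theorem ite_add_ite_eq {p q : Prop} [Decidable p] [Decidable q] (h : p → ¬ q) :
    ((if p then 1 else 0) + (if q then 1 else 0) : ℤ) = if p ∨ q then 1 else 0 := by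
  by_cases hp : p <;> by_cases hq : q <;> simp_all

section Paths

variable {s : D.State} {x y : Fin D.numCrossings} (hD : D.Planar) (hx : s x = false)
  (hy : s y = false) (hxy : x ≠ y) (U : D.EnhancedState)
include hD hx hy hxy

open Classical in
theorem paths_merge_merge (h1 : ¬ Loop s x) (h2 : ¬ Loop (addB s x) y) :
    paths (plus s) U x y = if U = plus (addB (addB s x) y) then 1 else 0 := by
  have hy' : addB s x y = false := by rw [addB_of_ne hxy.symm, hy]
  rw [paths, sum_adjacentAt_plus_merge hD hx h1]
  exact if_congr (adjacentAt_plus_of_merge hy' h2 (hD.merge hy' h2) U) rfl rfl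

open Classical in
theorem paths_merge_split (h1 : ¬ Loop s x) (h2 : Loop (addB s x) y) :
    paths (plus s) U x y = if U = one (addB (addB s x) y) (D.crossing y).a ∨
      U = one (addB (addB s x) y) (D.crossing y).c then 1 else 0 := by
  have hy' : addB s x y = false := by rw [addB_of_ne hxy.symm, hy]
  rw [paths, sum_adjacentAt_plus_merge hD hx h1]
  exact if_congr (adjacentAt_plus_of_split hy' h2 (hD.split hy' h2) U) rfl rfl

open Classical in
theorem paths_split_merge (h1 : Loop s x) (h2 : ¬ Loop (addB s x) y) :
    paths (plus s) U x y = (if U = one (addB (addB s x) y) (D.crossing x).a then 1 else 0) +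
      (if U = one (addB (addB s x) y) (D.crossing x).c then 1 else 0) := by
  have hy' : addB s x y = false := by rw [addB_of_ne hxy.symm, hy]
  rw [paths, sum_adjacentAt_plus_split hD hx h1,
    if_congr (adjacentAt_one_of_merge hy' h2 (hD.merge hy' h2) _ U) rfl rfl,
    if_congr (adjacentAt_one_of_merge hy' h2 (hD.merge hy' h2) _ U) rfl rfl]

open Classical in
theorem paths_split_split (h1 : Loop s x) (h2 : Loop (addB s x) y) :
    paths (plus s) U x y =
      (if ¬ Conn (addB (addB s x) y) (D.crossing x).a (D.crossing y).a ∧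
        U = two (addB (addB s x) y) (D.crossing x).a (D.crossing y).a then 1 else 0) +
      (if ¬ Conn (addB (addB s x) y) (D.crossing x).a (D.crossing y).c ∧
        U = two (addB (addB s x) y) (D.crossing x).a (D.crossing y).c then 1 else 0) +
      ((if ¬ Conn (addB (addB s x) y) (D.crossing x).c (D.crossing y).a ∧
        U = two (addB (addB s x) y) (D.crossing x).c (D.crossing y).a then 1 else 0) +
      (if ¬ Conn (addB (addB s x) y) (D.crossing x).c (D.crossing y).c ∧
        U = two (addB (addB s x) y) (D.crossing x).c (D.crossing y).c then 1 else 0)) := by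
  have hy' : addB s x y = false := by rw [addB_of_ne hxy.symm, hy]
  rw [paths, sum_adjacentAt_plus_split hD hx h1, adjacentAt_one_of_split_indicator hD hy' h2,
    adjacentAt_one_of_split_indicator hD hy' h2]

theorem paths_comm : paths (plus s) U x y = paths (plus s) U y x := by
  classical
  have hy' : addB s x y = false := by rw [addB_of_ne hxy.symm, hy]
  have hx' : addB s y x = false := by rw [addB_of_ne hxy, hx]
  have c1 := card_addB_eq hD hx
  have c2 := card_addB_eq hD hy'
  have c3 := card_addB_eq hD hy
  have c4 := card_addB_eq hD hx'
  have hc := addB_comm s x y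
  rw [← hc] at c4
  -- Both orders end in the same Kauffman state, so the changes in the number of circles agree. This
  -- leaves six of the sixteen combinations of merges and splits.
  rcases c1 with ⟨c1, h1⟩ | ⟨c1, h1⟩ <;> rcases c2 with ⟨c2, h2⟩ | ⟨c2, h2⟩ <;>
    rcases c3 with ⟨c3, h3⟩ | ⟨c3, h3⟩ <;> rcases c4 with ⟨c4, h4⟩ | ⟨c4, h4⟩ <;>
    try (exfalso; omega)
  · rw [paths_split_split hD hx hy hxy U h1 h2, paths_split_split hD hy hx hxy.symm U h3 h4, ← hc]
    have ht : ∀ e f, (if ¬ Conn (addB (addB s x) y) e f ∧ U = two (addB (addB s x) y) e f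
        then 1 else 0 : ℤ) =
        if ¬ Conn (addB (addB s x) y) f e ∧ U = two (addB (addB s x) y) f e then 1 else 0 :=
      fun e f => if_congr (by rw [two_comm, show Conn (addB (addB s x) y) e f ↔ _ from
        ⟨Conn.symm, Conn.symm⟩]) rfl rfl
    rw [ht (D.crossing x).a (D.crossing y).a, ht (D.crossing x).a (D.crossing y).c,
      ht (D.crossing x).c (D.crossing y).a, ht (D.crossing x).c (D.crossing y).c]
    ring
  · rw [paths_split_merge hD hx hy hxy U h1 h2, paths_split_merge hD hy hx hxy.symm U h3 h4, ← hc]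
    have hlx : Loop (addB (addB s x) y) x := hc ▸ hD.merge hx' h4
    have hly : Loop (addB (addB s x) y) y := hD.merge hy' h2
    -- In the final state the edges of both crossings lie on one circle, so either order reaches the
    -- same enhanced state twice.
    have hp : Passes (addB (addB s x) y) y (D.crossing x).a :=
      (((conn_or_passes addB_agree' hlx).resolve_left (hD.split hx h1)).1).transfer addB_agree
    rw [one_eq_one_iff.2 hlx, one_eq_one_iff.2 hly]
    rcases hp with hp | hp
    · rw [← one_eq_one_iff.2 hlx, one_eq_one_iff.2 hp, one_eq_one_iff.2 hly]
    · rw [← one_eq_one_iff.2 hlx, one_eq_one_iff.2 hp]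
  · rw [paths_split_merge hD hx hy hxy U h1 h2, paths_merge_split hD hy hx hxy.symm U h3 h4, ← hc]
    have hl : ¬ Loop (addB (addB s x) y) x := hc ▸ hD.split hx' h4
    exact ite_add_ite_eq (fun h h' => hl (one_eq_one_iff.1 (h.symm.trans h')))
  · rw [paths_merge_split hD hx hy hxy U h1 h2, paths_split_merge hD hy hx hxy.symm U h3 h4, ← hc]
    have hl : ¬ Loop (addB (addB s x) y) y := hD.split hy' h2
    exact (ite_add_ite_eq (fun h h' => hl (one_eq_one_iff.1 (h.symm.trans h')))).symm
  · rw [paths_merge_split hD hx hy hxy U h1 h2, paths_merge_split hD hy hx hxy.symm U h3 h4, ← hc]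
    have hly : ¬ Loop (addB (addB s x) y) y := hD.split hy' h2
    have hlx : ¬ Loop (addB (addB s x) y) x := hc ▸ hD.split hx' h4
    -- In the final state the two circles at `x` are the two circles at `y`, possibly in the other
    -- order.
    obtain ⟨hp1, hp2⟩ := (conn_or_passes addB_agree (hD.merge hx h1)).resolve_left hlx
    refine if_congr ?_ rfl rfl
    rcases hp1 with hp1 | hp1 <;> rcases hp2 with hp2 | hp2
    · exact absurd (hp1.trans hp2.symm) hlx
    · rw [one_eq_one_iff.2 hp1, one_eq_one_iff.2 hp2]
    · rw [one_eq_one_iff.2 hp1, one_eq_one_iff.2 hp2, or_comm]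
    · exact absurd (hp1.trans hp2.symm) hlx
  · rw [paths_merge_merge hD hx hy hxy U h1 h2, paths_merge_merge hD hy hx hxy.symm U h3 h4, ← hc]

end Paths

/-- The differential vanishes twice on the enhanced states without negative circles. -/
theorem sum_incidence_mul_incidence_plus (hD : D.Planar) (s : D.State) (U : D.EnhancedState) :
    ∑ T, incidence (plus s) T * incidence T U = 0 := by
  classical
  let g : Fin D.numCrossings → Fin D.numCrossings → ℤ := fun x y =>
    edgeSign s x * edgeSign (addB s x) y * paths (plus s) U x y
  have h1 : ∀ T, incidence (plus s) T * incidence T U = ∑ x, ∑ y,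
      edgeSign s x * edgeSign (addB s x) y *
        (if AdjacentAt x (plus s) T then if AdjacentAt y T U then 1 else 0 else 0) := by
    intro T
    rw [incidence_eq, incidence_eq, Finset.sum_mul_sum]
    refine Finset.sum_congr rfl fun x _ => Finset.sum_congr rfl fun y _ => ?_
    by_cases hx : AdjacentAt x (plus s) T
    · have hT : T.state = addB s x := (adjacentAt_iff.1 hx).2.1
      rw [if_pos hx, if_pos hx, hT]
      split_ifs <;> simp [plus]
    · simp [hx]
  have h2 : ∑ T, incidence (plus s) T * incidence T U = ∑ x, ∑ y, g x y := by
    simp_rw [h1]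
    rw [Finset.sum_comm]
    refine Finset.sum_congr rfl fun x _ => ?_
    rw [Finset.sum_comm]
    refine Finset.sum_congr rfl fun y _ => ?_
    rw [← Finset.mul_sum]
    rfl
  have h3 : ∀ x y, g x y = - g y x := by
    intro x y
    by_cases h : x = y ∨ s x = true ∨ s y = true
    · simp only [g]
      rw [paths_eq_zero h, paths_eq_zero (S := plus s) (x := y) (y := x)
        (h.imp Eq.symm Or.symm)]
      simp
    · simp only [not_or, Bool.not_eq_true] at h
      simp only [g]
      rw [paths_comm hD h.2.1 h.2.2 h.1 U, edgeSign_anticomm h.2.1 h.2.2 h.1]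
      ring
  -- The double sum is its own negative by antisymmetry, hence zero in `ℤ`.
  have h4 : ∑ x, ∑ y, g x y = - ∑ x, ∑ y, g x y := by
    conv_lhs => rw [Finset.sum_comm]
    rw [← Finset.sum_neg_distrib]
    refine Finset.sum_congr rfl fun x _ => ?_
    rw [← Finset.sum_neg_distrib]
    exact Finset.sum_congr rfl fun y _ => h3 y x
  rw [h2]
  omega

end Differential

end LinkDiagram

/-! ### Torsion classes from halved boundaries, and cocycles modulo two. -/

namespace LinkDiagram

section Torsion

variable {D : LinkDiagram}

theorem incidence_ne_zero {S T : D.EnhancedState} (h : incidence S T ≠ 0) :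
    ∃ x, AdjacentAt x S T := by
  by_contra! h'
  exact h (by rw [incidence_eq]; exact Finset.sum_eq_zero fun x _ => if_neg (h' x))

theorem incidence_degree {S T : D.EnhancedState} (h : incidence S T ≠ 0) :
    T.i = S.i + 1 ∧ T.j = S.j := by
  obtain ⟨x, hx⟩ := incidence_ne_zero h
  exact ⟨hx.1, hx.2.1⟩

theorem sum_generator {i j : ℤ} (F : D.EnhancedState → ℤ)
    (hF : ∀ T, F T ≠ 0 → T.i = i ∧ T.j = j) :
    ∑ T : D.Generator i j, F T.1 = ∑ T, F T := by
  refine Fintype.sum_of_injective (fun T : D.Generator i j => T.1) Subtype.val_injective _ _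
    (fun T hT => ?_) fun _ => rfl
  by_contra h
  exact hT ⟨⟨T, hF T h⟩, rfl⟩

theorem differential_apply (i i' j : ℤ) (c : D.Chain i j) (T : D.Generator i' j) :
    D.differential i i' j c T = ∑ S : D.Generator i j, incidence S.1 T.1 * c S := rfl

/-- The functional on chains given by a weight on the enhanced states. -/
noncomputable def pair (φ : D.EnhancedState → ℤ) (i j : ℤ) : D.Chain i j →ₗ[ℤ] ℤ :=
  ∑ T : D.Generator i j, φ T.1 • LinearMap.proj T

theorem pair_apply (φ : D.EnhancedState → ℤ) (i j : ℤ) (c : D.Chain i j) :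
    pair φ i j c = ∑ T : D.Generator i j, φ T.1 * c T := by
  simp [pair, LinearMap.sum_apply]

/-- A weight is a cocycle modulo two. -/
def EvenWeight (φ : D.EnhancedState → ℤ) : Prop :=
  ∀ S, (2 : ℤ) ∣ ∑ T, φ T * incidence S T

theorem EvenWeight.dvd_pair {φ : D.EnhancedState → ℤ} (hφ : EvenWeight φ) (i j : ℤ)
    (c : D.Chain (i - 1) j) : (2 : ℤ) ∣ pair φ i j (D.differential (i - 1) i j c) := by
  simp_rw [pair_apply, differential_apply, Finset.mul_sum]
  rw [Finset.sum_comm]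
  refine Finset.dvd_sum fun S _ => ?_
  have : ∑ T : D.Generator i j, φ T.1 * (incidence S.1 T.1 * c S) =
      (∑ T, φ T * incidence S.1 T) * c S := by
    rw [← sum_generator (i := i) (j := j), Finset.sum_mul]
    · exact Finset.sum_congr rfl fun T _ => by ring
    · intro T hT
      have := incidence_degree (right_ne_zero_of_mul hT)
      rw [S.2.1, S.2.2] at this
      exact ⟨by omega, this.2⟩
  rw [this]
  exact (hφ S.1).mul_right _

/-- The functional on homology with values modulo two given by a cocycle modulo two. -/
noncomputable def homologyPair (φ : D.EnhancedState → ℤ) (hφ : EvenWeight φ) (i j : ℤ) :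
    D.DiagramHomology i j →ₗ[ℤ] ZMod 2 :=
  Submodule.liftQ _
    ((Int.castAddHom (ZMod 2)).toIntLinearMap ∘ₗ pair φ i j ∘ₗ Submodule.subtype _) (by
      rintro ⟨z, hz⟩ hz'
      obtain ⟨c, rfl⟩ : ∃ c, D.differential (i - 1) i j c = z := hz'
      exact (ZMod.intCast_zmod_eq_zero_iff_dvd _ 2).2 (hφ.dvd_pair i j c))

open Classical in
/-- The sum of the enhanced states without negative circles on the states of a family. -/
noncomputable def plusChain (F : D.State → Prop) (i j : ℤ) : D.Chain i j := fun S =>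
  if F S.1.state ∧ S.1 = plus S.1.state then 1 else 0

-- The chain is cut off outside the degrees `i`, `j`. A function supported in these degrees does not
-- notice, so families of states need not be shown to be homogeneous.
open Classical in
theorem sum_plusChain (F : D.State → Prop) (i j : ℤ) (g : D.EnhancedState → ℤ)
    (hg : ∀ S, g S ≠ 0 → S.i = i ∧ S.j = j) :
    ∑ S : D.Generator i j, g S.1 * plusChain F i j S =
      ∑ s : D.State, if F s then g (plus s) else 0 := by
  have h1 := sum_generator (i := i) (j := j)
    (fun S => g S * if F S.state ∧ S = plus S.state then 1 else 0)
    fun S hS => hg S (left_ne_zero_of_mul hS)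
  refine h1.trans ?_
  symm
  refine Fintype.sum_of_injective (fun s => plus s) ?_ _ _ ?_ ?_
  · intro s t h
    exact congrArg EnhancedState.state h
  · intro S hS
    rw [if_neg, mul_zero]
    rintro ⟨-, h⟩
    exact hS ⟨_, h.symm⟩
  · intro s
    by_cases hs : F s
    · rw [if_pos hs, if_pos ⟨hs, rfl⟩, mul_one]
    · rw [if_neg hs, if_neg fun h => hs h.1, mul_zero]

open Classical in
theorem differential_plusChain (F : D.State → Prop) (i j : ℤ) (T : D.Generator i j) :
    D.differential (i - 1) i j (plusChain F (i - 1) j) T =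
      ∑ s : D.State, if F s then incidence (plus s) T.1 else 0 := by
  rw [differential_apply]
  refine sum_plusChain F (i - 1) j (fun S => incidence S T.1) fun S hS => ?_
  have := incidence_degree hS
  rw [T.2.1, T.2.2] at this
  exact ⟨by omega, this.2.symm⟩

theorem differential_differential_plusChain (hD : D.Planar) (F : D.State → Prop) (i j : ℤ) :
    D.differential i (i + 1) j (D.differential (i - 1) i j (plusChain F (i - 1) j)) = 0 := by
  classical
  funext U
  simp_rw [differential_apply i, differential_plusChain, Finset.mul_sum]
  rw [Finset.sum_comm]
  refine Finset.sum_eq_zero fun s _ => ?_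
  by_cases hs : F s
  · simp only [hs, if_true]
    rw [sum_generator (fun T => incidence T U.1 * incidence (plus s) T),
      ← sum_incidence_mul_incidence_plus hD s U.1]
    · exact Finset.sum_congr rfl fun T _ => mul_comm _ _
    · intro T hT
      have := incidence_degree (left_ne_zero_of_mul hT)
      rw [U.2.1, U.2.2] at this
      exact ⟨by omega, this.2.symm⟩
  · simp [hs]

/-- If twice a chain is the boundary of a chain of positive enhanced states, its class is killed
by two, and the functionals on it are half of those on the boundary. -/
theorem exists_half (hD : D.Planar) (F : D.State → Prop) (i j : ℤ)
    (heven : ∀ T, (2 : ℤ) ∣ D.differential (i - 1) i j (plusChain F (i - 1) j) T) :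
    ∃ x : D.DiagramHomology i j, 2 • x = 0 ∧ ∀ (φ : D.EnhancedState → ℤ) (hφ : EvenWeight φ)
      (m : ℤ), pair φ i j (D.differential (i - 1) i j (plusChain F (i - 1) j)) = 2 * m →
        homologyPair φ hφ i j x = m := by
  choose z hz using heven
  have hz' : D.differential (i - 1) i j (plusChain F (i - 1) j) = (2 : ℤ) • (z : D.Chain i j) := by
    funext T
    exact hz T
  -- The boundary of twice `z` vanishes, and the chain group has no torsion.
  have hker : (z : D.Chain i j) ∈ LinearMap.ker (D.differential i (i + 1) j) := by
    have := differential_differential_plusChain hD F i j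
    rw [hz', map_smul] at this
    exact (smul_eq_zero.1 this).resolve_left two_ne_zero
  refine ⟨Submodule.Quotient.mk ⟨z, hker⟩, ?_, fun φ hφ m hm => ?_⟩
  · rw [← Submodule.Quotient.mk_smul, Submodule.Quotient.mk_eq_zero]
    refine ⟨plusChain F (i - 1) j, ?_⟩
    rw [hz']
    exact (natCast_zsmul z 2)
  · rw [hz', map_smul, smul_eq_mul] at hm
    have : pair φ i j z = m := by omega
    rw [← this]
    rfl

end Torsion

/-! ### Parity conditions on families of Kauffman states. -/

section Families

variable {D : LinkDiagram}

/-- The state obtained from `s` by relabelling the crossing `x` with `A`. -/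
def delB (s : D.State) (x : Fin D.numCrossings) : D.State := Function.update s x false

@[simp] theorem delB_self (s : D.State) (x : Fin D.numCrossings) : delB s x x = false := by
  simp [delB]

theorem delB_of_ne {s : D.State} {x y : Fin D.numCrossings} (h : y ≠ x) : delB s x y = s y := by
  simp [delB, h]

theorem addB_delB {s : D.State} {x : Fin D.numCrossings} (h : s x = true) :
    addB (delB s x) x = s := by
  simp [addB, delB, ← h]

theorem delB_addB {s : D.State} {x : Fin D.numCrossings} (h : s x = false) :
    delB (addB s x) x = s := by
  simp [addB, delB, ← h]

/-- The sum of the positive enhanced states on the states of the family is a cycle modulo two, in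
terms of the circles of the states. -/
structure EvenFamily (F : D.State → Prop) : Prop where
  not_loop : ∀ s x, s x = true → F (delB s x) → ¬ Loop s x
  sum_eq_zero : ∀ s (f : D.Edge → ZMod 2), (∀ e e', Conn s e e' → f e = f e') →
    (∑ x, open Classical in if s x = true ∧ F (delB s x)
      then f (D.crossing x).a + f (D.crossing x).c else 0) = 0

/-- The weight that counts the enhanced states with one negative circle on the states of the family
is a cocycle modulo two, in terms of the circles of the states. -/
def CoevenFamily (F : D.State → Prop) : Prop := ∀ s,
  (∀ x, s x = false → F (addB s x) → ¬ Loop (addB s x) x) ∨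
  ((∀ x, s x = false → F (addB s x) → Loop (addB s x) x) ∧
    open Classical in Even (Finset.univ.filter fun x => s x = false ∧ F (addB s x)).card)

open Classical in
/-- The weight of the enhanced states with one negative circle on the states of a family. -/
noncomputable def oneWeight (F : D.State → Prop) (T : D.EnhancedState) : ℤ :=
  if F T.state ∧ T.numNeg = 1 then 1 else 0

theorem sum_oneWeight_mul_incidence (F : D.State → Prop) (S : D.EnhancedState) :
    ∑ T, oneWeight F T * incidence S T =
      ∑ x, edgeSign S.state x * ∑ T, open Classical in
        if AdjacentAt x S T then oneWeight F T else 0 := by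
  classical
  simp_rw [incidence_eq, Finset.mul_sum]
  rw [Finset.sum_comm]
  refine Finset.sum_congr rfl fun x _ => Finset.sum_congr rfl fun T _ => ?_
  split_ifs <;> ring

theorem numNeg_one (s : D.State) (e : D.Edge) : (one s e).numNeg = 1 := by
  simp [one, numNeg_ofNeg]

theorem eq_plus_of_numNeg {S : D.EnhancedState} (h : S.numNeg = 0) : S = plus S.state := by
  obtain ⟨M, hM⟩ := exists_eq_ofNeg S
  rw [hM, numNeg_ofNeg, Finset.card_eq_zero] at h
  rw [h] at hM
  exact hM

theorem exists_eq_one_of_numNeg {S : D.EnhancedState} (h : S.numNeg = 1) :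
    ∃ e, S = one S.state e := by
  obtain ⟨M, hM⟩ := exists_eq_ofNeg S
  rw [hM, numNeg_ofNeg, Finset.card_eq_one] at h
  obtain ⟨⟨e⟩, rfl⟩ := h
  exact ⟨e, hM⟩

/-- A split creates a negative circle, so it reaches states with exactly one only from states with
none, and then it reaches two of them. A merge keeps the number of negative circles, so it
contributes one odd term if there is one negative circle and nothing otherwise. The number of such
merges is even by hypothesis. -/
theorem CoevenFamily.evenWeight (hD : D.Planar) {F : D.State → Prop} (hF : CoevenFamily F) :
    EvenWeight (oneWeight F) := by
  classical
  intro S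
  rw [sum_oneWeight_mul_incidence]
  have hzero : ∀ x, ¬ (S.state x = false ∧ F (addB S.state x)) →
      (∑ T, if AdjacentAt x S T then oneWeight F T else 0) = 0 := by
    intro x hx
    refine Finset.sum_eq_zero fun T _ => ?_
    split_ifs with h
    · refine if_neg fun h' => hx ?_
      obtain ⟨h1, h2, -⟩ := adjacentAt_iff.1 h
      exact ⟨h1, h2 ▸ h'.1⟩
    · rfl
  rcases hF S.state with h | ⟨h, heven⟩
  · refine Finset.dvd_sum fun x _ => Dvd.dvd.mul_left ?_ _
    by_cases hx : S.state x = false ∧ F (addB S.state x)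
    · have h1 := h x hx.1 hx.2
      have h0 := (hD _ x hx.1).2 h1
      by_cases hS : S.numNeg = 0
      · rw [eq_plus_of_numNeg hS]
        rw [sum_adjacentAt_plus_split hD hx.1 h0]
        simp only [oneWeight, numNeg_one, and_true]
        exact ⟨_, (two_mul _).symm⟩
      · rw [Finset.sum_eq_zero]
        · exact dvd_zero 2
        · intro T _
          split_ifs with hT
          · have hst := (adjacentAt_iff.1 hT).2.1
            have := ((adjacentAt_iff_of_split hx.1 hst h0 (hst ▸ h1)).1 hT).1
            exact if_neg fun h' => hS (by omega)
          · rfl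
    · rw [hzero x hx]
      exact dvd_zero 2
  · by_cases hS : S.numNeg = 1
    · obtain ⟨e, he⟩ := exists_eq_one_of_numNeg hS
      have hone : ∀ x, S.state x = false ∧ F (addB S.state x) →
          (∑ T, if AdjacentAt x S T then oneWeight F T else 0) = 1 := by
        intro x hx
        have h1 := h x hx.1 hx.2
        have h0 : ¬ Loop S.state x := fun h0 => (hD _ x hx.1).1 h0 h1
        rw [he]
        simp_rw [adjacentAt_one_of_merge hx.1 h0 h1]
        simp only [Finset.sum_ite_eq', Finset.mem_univ, if_true]
        exact if_pos ⟨hx.2, numNeg_one _ _⟩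
      rw [← even_iff_two_dvd, ← ZMod.intCast_eq_zero_iff_even]
      push_cast
      have : ∀ x, ((edgeSign S.state x : ℤ) : ZMod 2) *
          ((∑ T, if AdjacentAt x S T then oneWeight F T else 0 : ℤ) : ZMod 2) =
          if S.state x = false ∧ F (addB S.state x) then 1 else 0 := by
        intro x
        split_ifs with hx
        · rw [hone x hx, ZMod.intCast_eq_one_iff_odd.2 (odd_edgeSign _ _)]
          simp
        · rw [hzero x hx]; simp
      push_cast at this
      simp_rw [this]
      rw [Finset.sum_boole]
      exact (ZMod.natCast_eq_zero_iff_even).2 heven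
    · rw [Finset.sum_eq_zero]
      · exact dvd_zero 2
      · intro x _
        by_cases hx : S.state x = false ∧ F (addB S.state x)
        · have h1 := h x hx.1 hx.2
          have h0 : ¬ Loop S.state x := fun h0 => (hD _ x hx.1).1 h0 h1
          rw [Finset.sum_eq_zero, mul_zero]
          intro T _
          split_ifs with hT
          · have hst := (adjacentAt_iff.1 hT).2.1
            have := ((adjacentAt_iff_of_merge hx.1 hst h0 (hst ▸ h1)).1 hT).1
            exact if_neg fun h' => hS (by omega)
          · rfl
        · rw [hzero x hx, mul_zero]

open Classical in
/-- The boundary of the sum of the positive enhanced states on the states of an even family. -/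
theorem EvenFamily.sum_incidence (hD : D.Planar) {F : D.State → Prop} (hF : EvenFamily F)
    (T : D.EnhancedState) :
    (∑ s : D.State, if F s then incidence (plus s) T else 0) =
      ∑ x, if T.state x = true ∧ F (delB T.state x) then
        edgeSign (delB T.state x) x * ((if T = one T.state (D.crossing x).a then 1 else 0) +
          (if T = one T.state (D.crossing x).c then 1 else 0)) else 0 := by
  have h1 : ∀ s, (if F s then incidence (plus s) T else 0) =
      ∑ x, if F s ∧ AdjacentAt x (plus s) T then edgeSign s x else 0 := by
    intro s
    split_ifs with hs
    · rw [incidence_eq]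
      simp only [hs, true_and]
      rfl
    · simp [hs]
  simp_rw [h1]
  rw [Finset.sum_comm]
  refine Finset.sum_congr rfl fun x _ => ?_
  rw [Finset.sum_eq_single (delB T.state x)]
  · by_cases hx : T.state x = true ∧ F (delB T.state x)
    · have hl := hF.not_loop T.state x hx.1 hx.2
      have hx0 : delB T.state x x = false := delB_self _ _
      have h0 : Loop (delB T.state x) x := (hD _ x hx0).2 (by rwa [addB_delB hx.1])
      have hadj := adjacentAt_plus_of_split hx0 h0 (hD.split hx0 h0) T
      rw [addB_delB hx.1] at hadj
      rw [if_pos hx, ite_add_ite_eq, mul_ite, mul_one, mul_zero]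
      · refine if_congr ?_ rfl rfl
        rw [hadj]
        simp [hx.2]
      · intro h h'
        exact hl (one_eq_one_iff.1 (h.symm.trans h'))
    · rw [if_neg hx, if_neg]
      rintro ⟨h, h'⟩
      refine hx ⟨?_, h⟩
      rw [(adjacentAt_iff.1 h').2.1]
      exact addB_self _ _
  · intro s _ hs
    rw [if_neg]
    rintro ⟨h, h'⟩
    obtain ⟨h1, h2, -⟩ := adjacentAt_iff.1 h'
    rw [h2] at hs
    exact hs (delB_addB h1).symm
  · simp

theorem EvenFamily.dvd (hD : D.Planar) {F : D.State → Prop} (hF : EvenFamily F) (i j : ℤ)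
    (T : D.Generator i j) :
    (2 : ℤ) ∣ D.differential (i - 1) i j (plusChain F (i - 1) j) T := by
  classical
  rw [differential_plusChain, hF.sum_incidence hD, ← even_iff_two_dvd,
    ← ZMod.intCast_eq_zero_iff_even, Int.cast_sum]
  -- The test function is the indicator of the negative circle of `T`; it is zero if `T` does not
  -- have exactly one.
  rw [← hF.sum_eq_zero T.1.state (fun e => if T.1 = one T.1.state e then 1 else 0)]
  · refine Finset.sum_congr rfl fun x _ => ?_
    split_ifs <;>
    simp [ZMod.intCast_eq_one_iff_odd.2 (odd_edgeSign _ _)]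
    rfl
  · intro e e' h
    rw [one_eq_one_iff.2 h]

theorem i_one (s : D.State) (e e' : D.Edge) : (one s e).i = (one s e').i := rfl

theorem j_one (s : D.State) (e e' : D.Edge) : (one s e).j = (one s e').j := by
  unfold EnhancedState.j
  rw [i_one s e e', EnhancedState.theta_eq, EnhancedState.theta_eq, numNeg_one, numNeg_one]
  rfl

/-- The weight sees only coefficients on states of `G`, and the boundary has none there when no
state of `F` lies one step below. -/
theorem pair_eq_zero {F G : D.State → Prop} (hD : D.Planar) (hF : EvenFamily F)
    (h : ∀ s x, G s → s x = true → ¬ F (delB s x)) (i j : ℤ) :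
    pair (oneWeight G) i j (D.differential (i - 1) i j (plusChain F (i - 1) j)) = 0 := by
  classical
  rw [pair_apply]
  refine Finset.sum_eq_zero fun T _ => ?_
  by_cases hT : G T.1.state
  · rw [differential_plusChain, hF.sum_incidence hD, Finset.sum_eq_zero, mul_zero]
    intro x _
    exact if_neg fun hx => h _ x hT hx.1 hx.2
  · rw [oneWeight, if_neg fun h => hT h.1, zero_mul]

/-- Each way down from `s₀` to the family contributes its sign twice, once for each half of the
split circle. Half of the pairing is thus a sum of an odd number of signs. -/
theorem exists_pair_eq_two_mul_odd {F G : D.State → Prop} (hD : D.Planar) (hF : EvenFamily F)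
    {s₀ : D.State} (hG : G s₀) (h : ∀ s x, G s → s x = true → F (delB s x) → s = s₀)
    (hodd : open Classical in
      Odd (Finset.univ.filter fun x => s₀ x = true ∧ F (delB s₀ x)).card) :
    ∃ i j m : ℤ, Odd m ∧
      pair (oneWeight G) i j (D.differential (i - 1) i j (plusChain F (i - 1) j)) = 2 * m := by
  classical
  obtain ⟨x₀, hx₀⟩ := Finset.card_pos.1 hodd.pos
  let e₀ := (D.crossing x₀).a
  -- The degrees of a state over `s₀` with one negative circle do not depend on which circle is
  -- negative, so any edge can serve to name them.
  refine ⟨(one s₀ e₀).i, (one s₀ e₀).j,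
    ∑ x, if s₀ x = true ∧ F (delB s₀ x) then edgeSign (delB s₀ x) x else 0, ?_, ?_⟩
  · rw [← ZMod.intCast_eq_one_iff_odd, Int.cast_sum]
    have : ∀ x, ((if s₀ x = true ∧ F (delB s₀ x) then edgeSign (delB s₀ x) x else 0 : ℤ) : ZMod 2) =
        if s₀ x = true ∧ F (delB s₀ x) then 1 else 0 := by
      intro x
      split_ifs
      · rw [ZMod.intCast_eq_one_iff_odd.2 (odd_edgeSign _ _)]
      · simp
    simp_rw [this]
    rw [Finset.sum_boole]
    exact ZMod.natCast_eq_one_iff_odd.2 hodd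
  · rw [pair_apply]
    simp_rw [differential_plusChain]
    rw [sum_generator (fun T => oneWeight G T *
      ∑ s : D.State, if F s then incidence (plus s) T else 0)]
    · have key : ∀ T : D.EnhancedState, (oneWeight G T *
          ∑ s : D.State, if F s then incidence (plus s) T else 0) =
          ∑ x, if s₀ x = true ∧ F (delB s₀ x) then edgeSign (delB s₀ x) x *
            ((if T = one s₀ (D.crossing x).a then 1 else 0) +
            (if T = one s₀ (D.crossing x).c then 1 else 0)) else 0 := by
        intro T
        rw [hF.sum_incidence hD]
        by_cases hT : T.state = s₀
        · rw [hT]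
          by_cases hn : T.numNeg = 1
          · rw [oneWeight, if_pos ⟨hT ▸ hG, hn⟩, one_mul]
          · rw [oneWeight, if_neg fun h => hn h.2, zero_mul]
            symm
            refine Finset.sum_eq_zero fun x _ => ?_
            rw [if_neg (c := T = one s₀ (D.crossing x).a),
              if_neg (c := T = one s₀ (D.crossing x).c)]
            · simp
            · intro h'; exact hn (h' ▸ numNeg_one _ _)
            · intro h'; exact hn (h' ▸ numNeg_one _ _)
        · have hz : ∀ e, T ≠ one s₀ e := fun e he => hT (he ▸ rfl)
          simp only [hz, if_false, add_zero, mul_zero, ite_self, Finset.sum_const_zero]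
          by_cases hGT : G T.state
          · rw [Finset.sum_eq_zero, mul_zero]
            intro x _
            exact if_neg fun hx => hT (h _ x hGT hx.1 hx.2)
          · rw [oneWeight, if_neg fun h => hGT h.1, zero_mul]
      simp_rw [key]
      rw [Finset.sum_comm, Finset.mul_sum]
      refine Finset.sum_congr rfl fun x _ => ?_
      split_ifs with hx
      · rw [← Finset.mul_sum, Finset.sum_add_distrib]
        simp
        ring
      · simp
    · intro T hT
      have hn : G T.state ∧ T.numNeg = 1 := by
        by_contra hn
        exact left_ne_zero_of_mul hT (if_neg hn)
      have hs : T.state = s₀ := by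
        by_contra hs
        refine right_ne_zero_of_mul hT ?_
        rw [hF.sum_incidence hD]
        exact Finset.sum_eq_zero fun x _ => if_neg fun hx => hs (h _ x hn.1 hx.1 hx.2)
      obtain ⟨e, he⟩ := exists_eq_one_of_numNeg hn.2
      rw [he, hs]
      exact ⟨rfl, j_one _ _ _⟩

/-- A collection of even families that are separated by coeven families yields different torsion
elements of order two. -/
theorem card_le_encard_torsion {ι : Type*} [Fintype ι] (hD : D.Planar) (F G : ι → D.State → Prop)
    (s₀ : ι → D.State) (hF : ∀ k, EvenFamily (F k)) (hG : ∀ k, CoevenFamily (G k))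
    (hs₀ : ∀ k, G k (s₀ k))
    (huniq : ∀ k s x, G k s → s x = true → F k (delB s x) → s = s₀ k)
    (hodd : ∀ k, open Classical in
      Odd (Finset.univ.filter fun x => s₀ k x = true ∧ F k (delB (s₀ k) x)).card)
    (hsep : ∀ k l s x, k ≠ l → G k s → s x = true → ¬ F l (delB s x)) :
    (Fintype.card ι : ℕ∞) ≤
      Set.encard {x : Σ hq : ℤ × ℤ, D.Kh hq.1 hq.2 | addOrderOf x.2 = 2} := by
  classical
  let Ψ : ι → (Σ hq : ℤ × ℤ, D.Kh hq.1 hq.2) → ZMod 2 := fun k x =>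
    homologyPair (oneWeight (G k)) ((hG k).evenWeight hD) _ _ x.2
  have hex : ∀ k, ∃ x : Σ hq : ℤ × ℤ, D.Kh hq.1 hq.2, 2 • x.2 = 0 ∧ Ψ k x = 1 ∧
      ∀ l, l ≠ k → Ψ l x = 0 := by
    intro k
    obtain ⟨i, j, m, hm, hp⟩ := exists_pair_eq_two_mul_odd hD (hF k) (hs₀ k) (huniq k) (hodd k)
    -- The degrees are those of the diagram; they are translated back to the normalised bidegree of
    -- the link.
    obtain ⟨h, rfl⟩ : ∃ h : ℤ, h + D.numNegative = i := ⟨i - D.numNegative, by ring⟩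
    obtain ⟨q, rfl⟩ : ∃ q : ℤ, q - D.numPositive + 2 * D.numNegative = j :=
      ⟨j + D.numPositive - 2 * D.numNegative, by ring⟩
    obtain ⟨x, hx, hx'⟩ := exists_half hD (F k) _ _ ((hF k).dvd hD _ _)
    refine ⟨⟨(h, q), x⟩, hx, ?_, fun l hl => ?_⟩
    · refine (hx' (oneWeight (G k)) ((hG k).evenWeight hD) m hp).trans ?_
      exact ZMod.intCast_eq_one_iff_odd.2 hm
    · refine (hx' (oneWeight (G l)) ((hG l).evenWeight hD) 0 ?_).trans (by simp)
      rw [pair_eq_zero hD (hF k) fun s x => hsep l k s x hl]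
      rfl
  choose X hX2 hX1 hX0 using hex
  have hinj : Function.Injective X := by
    intro k l hkl
    by_contra hne
    have := hX0 l k hne
    rw [← hkl, hX1 k] at this
    exact one_ne_zero this
  have hsub : Set.range X ⊆ {x : Σ hq : ℤ × ℤ, D.Kh hq.1 hq.2 | addOrderOf x.2 = 2} := by
    rintro _ ⟨k, rfl⟩
    refine addOrderOf_eq_prime (hX2 k) fun h => ?_
    have := hX1 k
    simp only [Ψ, h, map_zero] at this
    exact zero_ne_one this
  rw [← ENat.card_eq_coe_fintype_card]
  exact hinj.encard_range.trans (Set.encard_le_encard hsub)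

end Families

end LinkDiagram

/-! ### Cycles of a permutation multiplied by a transposition. -/

section SwapCycles

variable {α : Type*} [Finite α] [DecidableEq α]

open Equiv.Perm in
-- The new permutation sends `u` to `σ v` and then follows the `σ`-cycle of `v`. This cycle avoids
-- `u`, so it is followed undisturbed until it closes at `v`.
theorem Equiv.Perm.sameCycle_mul_swap_of_not {σ : Equiv.Perm α} {u v : α}
    (h : ¬ σ.SameCycle u v) : (σ * Equiv.swap u v).SameCycle u v := by
  set τ := σ * Equiv.swap u v
  have key : ∀ n : ℕ, τ.SameCycle u ((σ ^ (n + 1)) v) := by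
    intro n
    induction n with
    | zero =>
      refine ⟨1, ?_⟩
      simp [τ]
    | succ n ih =>
      by_cases hv : (σ ^ (n + 1)) v = v
      · rw [pow_succ', Equiv.Perm.mul_apply, hv]
        refine ⟨1, ?_⟩
        simp [τ]
      · have hu : (σ ^ (n + 1)) v ≠ u := fun hu => h (SameCycle.symm ⟨(n + 1 : ℕ), by
          rw [zpow_natCast]; exact hu⟩)
        rw [pow_succ', Equiv.Perm.mul_apply]
        have : σ ((σ ^ (n + 1)) v) = τ ((σ ^ (n + 1)) v) := by
          simp [τ, Equiv.swap_apply_of_ne_of_ne hu hv]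
        rw [this]
        exact sameCycle_apply_right.2 ih
  have hpos : 0 < orderOf σ := orderOf_pos σ
  have := key (orderOf σ - 1)
  rwa [Nat.sub_add_cancel hpos, pow_orderOf_eq_one] at this

open Equiv.Perm in
-- The arc of the `σ`-cycle after `u` up to `v` is closed under the new permutation, because `v` is
-- now sent to `σ u`. The arc contains `v` but not `u`.
theorem Equiv.Perm.not_sameCycle_mul_swap {σ : Equiv.Perm α} {u v : α} (huv : u ≠ v)
    (h : σ.SameCycle u v) : ¬ (σ * Equiv.swap u v).SameCycle u v := by
  classical
  set τ := σ * Equiv.swap u v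
  have hex : ∃ n : ℕ, (σ ^ (n + 1)) u = v := by
    obtain ⟨n, hn⟩ := h.exists_nat_pow_eq
    cases n with
    | zero => exact absurd hn huv
    | succ n => exact ⟨n, hn⟩
  have hmin := fun m => Nat.find_min hex (m := m)
  have hn := Nat.find_spec hex
  set n := Nat.find hex
  -- the points strictly after `u`, up to `v`
  let A : Set α := {z | ∃ m ≤ n, z = (σ ^ (m + 1)) u}
  have huA : u ∉ A := by
    rintro ⟨m, hm, hu⟩
    rcases hm.lt_or_eq with hm | rfl
    · refine hmin (n - (m + 1)) (by omega) ?_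
      have : n - (m + 1) + 1 + (m + 1) = n + 1 := by omega
      rw [← this, pow_add, Equiv.Perm.mul_apply, ← hu] at hn
      exact hn
    · exact huv (hu.trans hn)
  have hstep : ∀ z ∈ A, τ z ∈ A := by
    rintro z ⟨m, hm, rfl⟩
    rcases hm.lt_or_eq with hm | rfl
    · refine ⟨m + 1, hm, ?_⟩
      have h1 : (σ ^ (m + 1)) u ≠ v := hmin m hm
      have h2 : (σ ^ (m + 1)) u ≠ u := fun h => huA ⟨m, hm.le, h.symm⟩
      rw [pow_succ' σ (m + 1)]
      simp [τ, Equiv.swap_apply_of_ne_of_ne h2 h1]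
    · rw [hn]
      exact ⟨0, Nat.zero_le _, by simp [τ]⟩
  have hall : ∀ k : ℕ, (τ ^ k) v ∈ A := by
    intro k
    induction k with
    | zero => exact ⟨n, le_rfl, hn.symm⟩
    | succ k ih => rw [pow_succ', Equiv.Perm.mul_apply]; exact hstep _ ih
  intro hτ
  obtain ⟨k, hk⟩ := hτ.symm.exists_nat_pow_eq
  exact huA (hk ▸ hall k)

end SwapCycles

/-! ### Planarity of closed braids: circles as cycles of a permutation. -/

namespace BraidWord

open LinkDiagram

variable {m : ℕ} (w : BraidWord m)

/-- The smoothing of the `c`-th crossing is horizontal. -/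
def Horiz (s : w.closure.State) (c : Fin w.length) : Prop := s c = (w.get c).2

variable {w}

theorem Conn.horiz_low {s : w.closure.State} {c : Fin w.length} (h : w.Horiz s c) :
    Conn (D := w.closure) s ((w.get c).1.castSucc, c.castSucc) ((w.get c).1.succ, c.castSucc) := by
  unfold Horiz at h
  have h0 : w.closure.crossing c = w.crossingAt c := rfl
  unfold crossingAt at h0
  rcases hc : (w.get c).2 with _ | _ <;> rw [hc] at h h0
  · have := (conn_ab (D := w.closure) (x := c) h); rwa [h0] at this
  · have := (conn_ad (D := w.closure) (x := c) h).symm; rwa [h0] at this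

theorem Conn.horiz_up {s : w.closure.State} {c : Fin w.length} (h : w.Horiz s c) :
    Conn (D := w.closure) s ((w.get c).1.castSucc, c.succ) ((w.get c).1.succ, c.succ) := by
  unfold Horiz at h
  have h0 : w.closure.crossing c = w.crossingAt c := rfl
  unfold crossingAt at h0
  rcases hc : (w.get c).2 with _ | _ <;> rw [hc] at h h0
  · have := (conn_cd (D := w.closure) (x := c) h).symm; rwa [h0] at this
  · have := (conn_bc (D := w.closure) (x := c) h).symm; rwa [h0] at this

theorem Conn.vert {s : w.closure.State} {c : Fin w.length} {k : Fin (m + 1)}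
    (h : w.Horiz s c → k ≠ (w.get c).1.castSucc ∧ k ≠ (w.get c).1.succ) :
    Conn (D := w.closure) s (k, c.castSucc) (k, c.succ) := by
  by_cases hk : k ≠ (w.get c).1.castSucc ∧ k ≠ (w.get c).1.succ
  · exact .of_follows (.inl (.inl ⟨c, k, hk.1, hk.2, rfl, rfl⟩))
  · have h' : ¬ w.Horiz s c := fun h' => hk (h h')
    unfold Horiz at h'
    have h0 : w.closure.crossing c = w.crossingAt c := rfl
    unfold crossingAt at h0
    rw [not_and_or, not_not, not_not] at hk
    rcases hc : (w.get c).2 with _ | _ <;> rw [hc] at h' h0 <;> simp at h'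
    · rcases hk with rfl | rfl
      · have := (conn_ad (D := w.closure) (x := c) h'); rwa [h0] at this
      · have := (conn_bc (D := w.closure) (x := c) h'); rwa [h0] at this
    · rcases hk with rfl | rfl
      · have := (conn_cd (D := w.closure) (x := c) h').symm; rwa [h0] at this
      · have := (conn_ab (D := w.closure) (x := c) h'); rwa [h0] at this

theorem Conn.last (s : w.closure.State) (k : Fin (m + 1)) :
    Conn (D := w.closure) s (k, Fin.last w.length) (k, 0) :=
  .of_follows (.inl (.inr ⟨k, rfl, rfl⟩))

/-- A function of the edges that respects the smoothings of all crossings is constant on the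
circles. -/
theorem Conn.lift {s : w.closure.State} {α : Sort*} (g : Fin (m + 1) × Fin (w.length + 1) → α)
    (hlast : ∀ k, g (k, Fin.last w.length) = g (k, 0))
    (hvert : ∀ c k, (w.Horiz s c → k ≠ (w.get c).1.castSucc ∧ k ≠ (w.get c).1.succ) →
      g (k, c.castSucc) = g (k, c.succ))
    (hlow : ∀ c, w.Horiz s c →
      g ((w.get c).1.castSucc, c.castSucc) = g ((w.get c).1.succ, c.castSucc))
    (hup : ∀ c, w.Horiz s c →
      g ((w.get c).1.castSucc, c.succ) = g ((w.get c).1.succ, c.succ))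
    {e f : Fin (m + 1) × Fin (w.length + 1)} (h : Conn (D := w.closure) s e f) : g e = g f := by
  refine h.lift_eq g ?_
  rintro e f ((⟨c, k, h1, h2, rfl, rfl⟩ | ⟨k, rfl, rfl⟩) | ⟨c, hc⟩)
  · exact hvert c k fun _ => ⟨h1, h2⟩
  · exact hlast k
  · have h0 : w.closure.crossing c = w.crossingAt c := rfl
    unfold crossingAt at h0
    rw [h0] at hc
    have hor := hlow c
    have hor' := hup c
    have ver := hvert c
    unfold Horiz at hor hor' ver
    rcases hw : (w.get c).2 with _ | _ <;> rcases hs : s c with _ | _ <;>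
      rw [hs, hw] at hor hor' ver <;> rw [hw, hs] at hc <;>
      simp only [LinkCrossing.Smoothing, forall_true_left] at hc hor hor' ver
    · rcases hc with ⟨rfl, rfl⟩ | ⟨rfl, rfl⟩
      · exact hor
      · exact hor'.symm
    · rcases hc with ⟨rfl, rfl⟩ | ⟨rfl, rfl⟩
      · exact ver _ (by simp)
      · exact ver _ (by simp)
    · rcases hc with ⟨rfl, rfl⟩ | ⟨rfl, rfl⟩
      · exact ver _ (by simp)
      · exact (ver _ (by simp)).symm
    · rcases hc with ⟨rfl, rfl⟩ | ⟨rfl, rfl⟩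
      · exact hor.symm
      · exact hor'.symm

/-- The even one of the two strand positions at the `c`-th crossing. -/
def evenPos (w : BraidWord m) (c : Fin w.length) : Fin (m + 1) :=
  if Even (w.get c).1.val then (w.get c).1.castSucc else (w.get c).1.succ

/-- The odd one of the two strand positions at the `c`-th crossing. -/
def oddPos (w : BraidWord m) (c : Fin w.length) : Fin (m + 1) :=
  if Even (w.get c).1.val then (w.get c).1.succ else (w.get c).1.castSucc

theorem even_evenPos (c : Fin w.length) : Even (evenPos w c).val := by
  unfold evenPos
  split_ifs with h
  · exact h
  · simpa [Nat.even_add_one] using h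

theorem not_even_oddPos (c : Fin w.length) : ¬ Even (oddPos w c).val := by
  unfold oddPos
  split_ifs with h
  · simpa [Nat.even_add_one] using h
  · exact h

theorem pos_cases (c : Fin w.length) :
    (w.get c).1.castSucc = evenPos w c ∧ (w.get c).1.succ = oddPos w c ∨
    (w.get c).1.castSucc = oddPos w c ∧ (w.get c).1.succ = evenPos w c := by
  unfold evenPos oddPos
  split_ifs <;> simp

/-- When the strands in even positions run upwards and those in odd positions downwards, all
smoothings are compatible with the orientation; this edge enters the `c`-th crossing from below. -/
def enterUp (w : BraidWord m) (c : Fin w.length) : Fin (m + 1) × Fin (w.length + 1) :=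
  (evenPos w c, c.castSucc)

/-- The edge that enters the `c`-th crossing from above. -/
def enterDown (w : BraidWord m) (c : Fin w.length) : Fin (m + 1) × Fin (w.length + 1) :=
  (oddPos w c, c.succ)

theorem enterUp_inj {c c' : Fin w.length} (h : enterUp w c = enterUp w c') : c = c' :=
  Fin.castSucc_injective _ (congrArg Prod.snd h)

theorem enterDown_inj {c c' : Fin w.length} (h : enterDown w c = enterDown w c') : c = c' :=
  Fin.succ_injective _ (congrArg Prod.snd h)

theorem enterUp_ne_enterDown (c c' : Fin w.length) : enterUp w c ≠ enterDown w c' := fun h => by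
  have := congrArg (fun e => Even e.1.val) h
  simp only [enterUp, enterDown, eq_iff_iff] at this
  exact not_even_oddPos c' (this.1 (even_evenPos c))

open Classical in
/-- The involution that swaps the edges entering each of the horizontal crossings. -/
noncomputable def turn (s : w.closure.State) (e : Fin (m + 1) × Fin (w.length + 1)) :
    Fin (m + 1) × Fin (w.length + 1) :=
  if h : ∃ c, w.Horiz s c ∧ enterUp w c = e then enterDown w h.choose
  else if h : ∃ c, w.Horiz s c ∧ enterDown w c = e then enterUp w h.choose else e

open Classical in
theorem turn_enterUp (s : w.closure.State) (c : Fin w.length) :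
    turn s (enterUp w c) = if w.Horiz s c then enterDown w c else enterUp w c := by
  unfold turn
  split_ifs with h1 h2 h2 h3 h3
  · rw [enterUp_inj h1.choose_spec.2]
  · exact absurd (enterUp_inj h1.choose_spec.2 ▸ h1.choose_spec.1) h2
  · exact absurd h2.choose_spec.2.symm (enterUp_ne_enterDown _ _)
  · exact absurd h2.choose_spec.2.symm (enterUp_ne_enterDown _ _)
  · exact absurd ⟨c, h3, rfl⟩ h1
  · rfl

open Classical in
theorem turn_enterDown (s : w.closure.State) (c : Fin w.length) :
    turn s (enterDown w c) = if w.Horiz s c then enterUp w c else enterDown w c := by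
  unfold turn
  split_ifs with h1 h2 h2 h3 h3
  · exact absurd h1.choose_spec.2 (enterUp_ne_enterDown _ _)
  · exact absurd h1.choose_spec.2 (enterUp_ne_enterDown _ _)
  · rw [enterDown_inj h2.choose_spec.2]
  · exact absurd (enterDown_inj h2.choose_spec.2 ▸ h2.choose_spec.1) h3
  · exact absurd ⟨c, h3, rfl⟩ h2
  · rfl

theorem turn_of_forall (s : w.closure.State) {e : Fin (m + 1) × Fin (w.length + 1)}
    (h1 : ∀ c, enterUp w c ≠ e) (h2 : ∀ c, enterDown w c ≠ e) : turn s e = e := by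
  unfold turn
  rw [dif_neg fun h => h1 _ h.choose_spec.2, dif_neg fun h => h2 _ h.choose_spec.2]

theorem enter_cases (e : Fin (m + 1) × Fin (w.length + 1)) :
    (∃ c, e = enterUp w c) ∨ (∃ c, e = enterDown w c) ∨
      ((∀ c, enterUp w c ≠ e) ∧ ∀ c, enterDown w c ≠ e) := by
  by_cases h1 : ∃ c, e = enterUp w c
  · exact .inl h1
  · by_cases h2 : ∃ c, e = enterDown w c
    · exact .inr (.inl h2)
    · push Not at h1 h2
      exact .inr (.inr ⟨fun c => (h1 c).symm, fun c => (h2 c).symm⟩)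

theorem turn_involutive (s : w.closure.State) : Function.Involutive (turn s) := by
  classical
  intro e
  rcases enter_cases e with ⟨c, rfl⟩ | ⟨c, rfl⟩ | ⟨h1, h2⟩
  · rw [turn_enterUp]
    split_ifs with h
    · rw [turn_enterDown, if_pos h]
    · rw [turn_enterUp, if_neg h]
  · rw [turn_enterDown]
    split_ifs with h
    · rw [turn_enterUp, if_pos h]
    · rw [turn_enterDown, if_neg h]
  · rw [turn_of_forall s h1 h2, turn_of_forall s h1 h2]

/-- Moving along the vertical strands. -/
def straight (m L : ℕ) : Equiv.Perm (Fin (m + 1) × Fin (L + 1)) :=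
  Equiv.prodShear (Equiv.refl _) fun k =>
    if Even k.val then finRotate (L + 1) else (finRotate (L + 1)).symm

/-- Moving along the circles of the smoothed diagram. -/
noncomputable def along (s : w.closure.State) : Equiv.Perm (Fin (m + 1) × Fin (w.length + 1)) :=
  straight m w.length * (turn_involutive s).toPerm

theorem along_apply (s : w.closure.State) (e) : along s e = straight m w.length (turn s e) := rfl

theorem finRotate_castSucc {L : ℕ} (c : Fin L) : finRotate (L + 1) c.castSucc = c.succ := by
  rw [finRotate_apply, Fin.coeSucc_eq_succ]

theorem straight_even {L : ℕ} {k : Fin (m + 1)} (hk : Even k.val) (l : Fin (L + 1)) :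
    straight m L (k, l) = (k, finRotate (L + 1) l) := by
  simp [straight, hk]

theorem straight_odd {L : ℕ} {k : Fin (m + 1)} (hk : ¬ Even k.val) (l : Fin (L + 1)) :
    straight m L (k, l) = (k, (finRotate (L + 1)).symm l) := by
  simp [straight, hk]

theorem straight_up {L : ℕ} {k : Fin (m + 1)} (hk : Even k.val) (c : Fin L) :
    straight m L (k, c.castSucc) = (k, c.succ) := by
  rw [straight_even hk, finRotate_castSucc]

theorem straight_down {L : ℕ} {k : Fin (m + 1)} (hk : ¬ Even k.val) (c : Fin L) :
    straight m L (k, c.succ) = (k, c.castSucc) := by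
  rw [straight_odd hk, ← finRotate_castSucc, Equiv.symm_apply_apply]

theorem straight_last {L : ℕ} {k : Fin (m + 1)} (hk : Even k.val) :
    straight m L (k, Fin.last L) = (k, 0) := by
  rw [straight_even hk, finRotate_last]

theorem straight_zero {L : ℕ} {k : Fin (m + 1)} (hk : ¬ Even k.val) :
    straight m L (k, 0) = (k, Fin.last L) := by
  rw [straight_odd hk, ← finRotate_last (n := L), Equiv.symm_apply_apply]

theorem pos_ne {c : Fin w.length} {k : Fin (m + 1)} :
    (k ≠ (w.get c).1.castSucc ∧ k ≠ (w.get c).1.succ) ↔ k ≠ evenPos w c ∧ k ≠ oddPos w c := by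
  rcases pos_cases c with ⟨h1, h2⟩ | ⟨h1, h2⟩ <;> rw [h1, h2]
  exact and_comm

theorem conn_pos_low {s : w.closure.State} {c : Fin w.length} (h : w.Horiz s c) :
    Conn (D := w.closure) s (evenPos w c, c.castSucc) (oddPos w c, c.castSucc) := by
  have := Conn.horiz_low h
  rcases pos_cases c with ⟨h1, h2⟩ | ⟨h1, h2⟩ <;> rw [h1, h2] at this
  · exact this
  · exact this.symm

theorem conn_pos_up {s : w.closure.State} {c : Fin w.length} (h : w.Horiz s c) :
    Conn (D := w.closure) s (evenPos w c, c.succ) (oddPos w c, c.succ) := by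
  have := Conn.horiz_up h
  rcases pos_cases c with ⟨h1, h2⟩ | ⟨h1, h2⟩ <;> rw [h1, h2] at this
  · exact this
  · exact this.symm

theorem along_enterUp_horiz {s : w.closure.State} {c : Fin w.length} (h : w.Horiz s c) :
    along s (enterUp w c) = (oddPos w c, c.castSucc) := by
  classical
  rw [along_apply, turn_enterUp, if_pos h, enterDown, straight_down (not_even_oddPos c)]

theorem along_enterDown_horiz {s : w.closure.State} {c : Fin w.length} (h : w.Horiz s c) :
    along s (enterDown w c) = (evenPos w c, c.succ) := by
  classical
  rw [along_apply, turn_enterDown, if_pos h, enterUp, straight_up (even_evenPos c)]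

theorem along_up {s : w.closure.State} {c : Fin w.length} {k : Fin (m + 1)} (hk : Even k.val)
    (h : w.Horiz s c → k ≠ evenPos w c) : along s (k, c.castSucc) = (k, c.succ) := by
  classical
  have hd : ∀ c', enterDown w c' ≠ (k, c.castSucc) := fun c' h' => by
    have := congrArg Prod.fst h'
    dsimp only [enterDown] at this
    exact not_even_oddPos c' (this ▸ hk)
  rw [along_apply]
  by_cases he : k = evenPos w c
  · have : (k, c.castSucc) = enterUp w c := by rw [he]; rfl
    rw [this, turn_enterUp, if_neg fun h' => h h' he, ← this, straight_up hk]
  · rw [turn_of_forall s _ hd, straight_up hk]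
    intro c' h'
    obtain rfl : c' = c := Fin.castSucc_injective _ (congrArg Prod.snd h')
    exact he (congrArg Prod.fst h').symm

theorem along_down {s : w.closure.State} {c : Fin w.length} {k : Fin (m + 1)} (hk : ¬ Even k.val)
    (h : w.Horiz s c → k ≠ oddPos w c) : along s (k, c.succ) = (k, c.castSucc) := by
  classical
  have hd : ∀ c', enterUp w c' ≠ (k, c.succ) := fun c' h' => by
    have := congrArg Prod.fst h'
    dsimp only [enterUp] at this
    exact hk (this ▸ even_evenPos c')
  rw [along_apply]
  by_cases he : k = oddPos w c
  · have : (k, c.succ) = enterDown w c := by rw [he]; rfl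
    rw [this, turn_enterDown, if_neg fun h' => h h' he, ← this, straight_down hk]
  · rw [turn_of_forall s hd, straight_down hk]
    intro c' h'
    obtain rfl : c' = c := Fin.succ_injective _ (congrArg Prod.snd h')
    exact he (congrArg Prod.fst h').symm

theorem along_last (s : w.closure.State) {k : Fin (m + 1)} (hk : Even k.val) :
    along s (k, Fin.last w.length) = (k, 0) := by
  rw [along_apply, turn_of_forall, straight_last hk]
  · intro c h
    exact (Fin.castSucc_lt_last c).ne (congrArg Prod.snd h)
  · intro c h
    have := congrArg Prod.fst h
    dsimp only [enterDown] at this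
    exact not_even_oddPos c (this ▸ hk)

theorem along_zero (s : w.closure.State) {k : Fin (m + 1)} (hk : ¬ Even k.val) :
    along s (k, 0) = (k, Fin.last w.length) := by
  rw [along_apply, turn_of_forall, straight_zero hk]
  · intro c h
    have := congrArg Prod.fst h
    dsimp only [enterUp] at this
    exact hk (this ▸ even_evenPos c)
  · intro c h
    exact Fin.succ_ne_zero c (congrArg Prod.snd h)

theorem conn_along (s : w.closure.State) (e : Fin (m + 1) × Fin (w.length + 1)) :
    Conn (D := w.closure) s e (along s e) := by
  obtain ⟨k, l⟩ := e
  by_cases hk : Even k.val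
  · rcases l.eq_castSucc_or_eq_last with ⟨c, rfl⟩ | rfl
    · by_cases h : w.Horiz s c ∧ k = evenPos w c
      · obtain ⟨h, rfl⟩ := h
        exact (conn_pos_low h).trans (congrArg _ (along_enterUp_horiz h).symm)
      · rw [along_up hk fun h1 h2 => h ⟨h1, h2⟩]
        refine Conn.vert fun h' => pos_ne.2 ⟨fun h2 => h ⟨h', h2⟩, ?_⟩
        rintro rfl
        exact not_even_oddPos c hk
    · rw [along_last s hk]
      exact Conn.last s k
  · rcases l.eq_zero_or_eq_succ with rfl | ⟨c, rfl⟩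
    · rw [along_zero s hk]
      exact (Conn.last s k).symm
    · by_cases h : w.Horiz s c ∧ k = oddPos w c
      · obtain ⟨h, rfl⟩ := h
        exact (conn_pos_up h).symm.trans (congrArg _ (along_enterDown_horiz h).symm)
      · rw [along_down hk fun h1 h2 => h ⟨h1, h2⟩]
        refine (Conn.vert fun h' => pos_ne.2 ⟨?_, fun h2 => h ⟨h', h2⟩⟩).symm
        rintro rfl
        exact hk (even_evenPos c)

/-- Every elementary join of the smoothed diagram is one step of `along`, forwards or backwards, and
conversely every step stays on its circle. -/
theorem conn_iff_sameCycle (s : w.closure.State) (e f : Fin (m + 1) × Fin (w.length + 1)) :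
    Conn (D := w.closure) s e f ↔ (along s).SameCycle e f := by
  constructor
  · intro h
    have hrel : ∀ {e f}, along s e = f → (Quotient.mk (Equiv.Perm.SameCycle.setoid (along s)) e) =
        Quotient.mk (Equiv.Perm.SameCycle.setoid (along s)) f := fun {e f} h =>
      Quotient.sound ⟨1, by simpa using h⟩
    refine Quotient.exact (Conn.lift (Quotient.mk (Equiv.Perm.SameCycle.setoid (along s)))
      ?_ ?_ ?_ ?_ h)
    · intro k
      by_cases hk : Even k.val
      · exact hrel (along_last s hk)
      · exact (hrel (along_zero s hk)).symm
    · intro c k h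
      by_cases hk : Even k.val
      · exact hrel (along_up hk fun h' => (pos_ne.1 (h h')).1)
      · exact (hrel (along_down hk fun h' => (pos_ne.1 (h h')).2)).symm
    · intro c hc
      have := hrel (along_enterUp_horiz hc)
      rcases pos_cases c with ⟨h1, h2⟩ | ⟨h1, h2⟩ <;> rw [h1, h2]
      · exact this
      · exact this.symm
    · intro c hc
      have := hrel (along_enterDown_horiz hc)
      rcases pos_cases c with ⟨h1, h2⟩ | ⟨h1, h2⟩ <;> rw [h1, h2]
      · exact this.symm
      · exact this
  · intro h
    obtain ⟨n, rfl⟩ := h.exists_nat_pow_eq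
    clear h
    induction n with
    | zero => exact .refl _ _
    | succ n ih =>
      rw [pow_succ', Equiv.Perm.mul_apply]
      exact ih.trans (conn_along s _)

/-- The two entering edges are diagonally opposite at the crossing, so they are `a`, `c` or `b`,
`d`. Either smoothing pairs the one diagonal with the other, so both give the same condition. -/
theorem loop_iff (s : w.closure.State) (c : Fin w.length) :
    Loop (D := w.closure) s c ↔ Conn (D := w.closure) s (enterUp w c) (enterDown w c) := by
  have h0 : w.closure.crossing c = w.crossingAt c := rfl
  have hbd : Loop (D := w.closure) s c ↔
      Conn s (w.closure.crossing c).b (w.closure.crossing c).d := by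
    rcases hs : s c with _ | _
    · have h1 := conn_ab (D := w.closure) (x := c) hs
      have h2 := conn_cd (D := w.closure) (x := c) hs
      exact ⟨fun h => (h1.symm.trans h).trans h2, fun h => (h1.trans h).trans h2.symm⟩
    · have h1 := conn_ad (D := w.closure) (x := c) hs
      have h2 := conn_bc (D := w.closure) (x := c) hs
      exact ⟨fun h => ((h2.trans h.symm).trans h1), fun h => ((h1.trans h.symm).trans h2)⟩
  unfold crossingAt at h0
  unfold enterUp enterDown
  rcases hc : (w.get c).2 with _ | _ <;> rw [hc] at h0 <;>
    rcases pos_cases c with ⟨h1, h2⟩ | ⟨h1, h2⟩ <;> rw [← h1, ← h2]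
  · unfold Loop; rw [h0]
  · rw [hbd, h0]
  · rw [hbd, h0]; exact ⟨Conn.symm, Conn.symm⟩
  · unfold Loop; rw [h0]

/-- With alternating orientations of the positions both smoothings respect the directions, and they
differ only in which exit follows which of the two entering edges. -/
theorem along_eq_mul_swap {s t : w.closure.State} {c : Fin w.length}
    (hst : ∀ c', c' ≠ c → s c' = t c') (hs : ¬ w.Horiz s c) (ht : w.Horiz t c) :
    along t = along s * Equiv.swap (enterUp w c) (enterDown w c) := by
  classical
  have hiff : ∀ c', c' ≠ c → (w.Horiz s c' ↔ w.Horiz t c') := fun c' hc => by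
    unfold Horiz; rw [hst c' hc]
  ext1 e
  rw [Equiv.Perm.mul_apply, along_apply, along_apply]
  congr 1
  by_cases h1 : e = enterUp w c
  · rw [h1, Equiv.swap_apply_left, turn_enterUp, turn_enterDown, if_pos ht, if_neg hs]
  by_cases h2 : e = enterDown w c
  · rw [h2, Equiv.swap_apply_right, turn_enterDown, turn_enterUp, if_pos ht, if_neg hs]
  rw [Equiv.swap_apply_of_ne_of_ne h1 h2]
  rcases enter_cases e with ⟨c', rfl⟩ | ⟨c', rfl⟩ | ⟨h1, h2⟩
  · have hc : c' ≠ c := fun h => h1 (h ▸ rfl)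
    rw [turn_enterUp, turn_enterUp, if_congr (hiff c' hc) rfl rfl]
  · have hc : c' ≠ c := fun h => h2 (h ▸ rfl)
    rw [turn_enterDown, turn_enterDown, if_congr (hiff c' hc) rfl rfl]
  · rw [turn_of_forall _ h1 h2, turn_of_forall _ h1 h2]

theorem loop_iff_not_of_horiz {s t : w.closure.State} {c : Fin w.length}
    (hst : ∀ c', c' ≠ c → s c' = t c') (hs : ¬ w.Horiz s c) (ht : w.Horiz t c) :
    Loop (D := w.closure) s c ↔ ¬ Loop (D := w.closure) t c := by
  rw [loop_iff, loop_iff, conn_iff_sameCycle, conn_iff_sameCycle, along_eq_mul_swap hst hs ht]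
  constructor
  · exact Equiv.Perm.not_sameCycle_mul_swap (enterUp_ne_enterDown c c)
  · intro h
    by_contra h'
    exact h (Equiv.Perm.sameCycle_mul_swap_of_not h')

/-- Changing a smoothing multiplies `along` by the transposition of the two entering edges, which
toggles whether they lie on a common cycle. This excludes a change that keeps the number of circles.
-/
theorem planar_closure (w : BraidWord m) : w.closure.Planar := by
  intro s c hc
  have hadd : addB (D := w.closure) s c c = true := addB_self (D := w.closure) s c
  rcases hw : (w.get c).2 with _ | _
  · have := loop_iff_not_of_horiz (s := addB (D := w.closure) s c) (t := s) (c := c)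
      (addB_agree' (D := w.closure) (s := s) (x := c)) (by unfold Horiz; rw [hw, hadd]; simp) (by unfold Horiz; rw [hw, hc])
    tauto
  · exact loop_iff_not_of_horiz (c := c) (addB_agree (D := w.closure) (s := s) (x := c)) (by unfold Horiz; rw [hw, hc]; simp)
      (by unfold Horiz; rw [hw, hadd])

end BraidWord

/-! ### Circles in smoothings of a closed braid on three strands. -/

namespace BraidWord

open LinkDiagram

section ThreeStrands

variable {w : BraidWord 2}

/-- The crossing at the level `n`, where the levels repeat periodically around the closed braid. -/
def crossingAtLevel (w : BraidWord 2) (hw : 0 < w.length) (n : ℕ) : Fin w.length :=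
  ⟨n % w.length, Nat.mod_lt _ hw⟩

/-- The edge in position `k` just below the crossing at the level `n`. -/
def edgeAt (w : BraidWord 2) (hw : 0 < w.length) (k : Fin 3) (n : ℕ) :
    Fin 3 × Fin (w.length + 1) :=
  (k, (crossingAtLevel w hw n).castSucc)

/-- The position of the strand that a crossing of type `τ` joins to the strand in the middle. -/
def side (τ : Fin 2) : Fin 3 := if τ = 0 then 0 else 2

theorem side_ne_one (τ : Fin 2) : side τ ≠ 1 := by revert τ; decide

theorem side_inj {τ τ' : Fin 2} (h : side τ = side τ') : τ = τ' := by revert τ τ'; decide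

theorem side_cases (τ : Fin 2) : (τ.castSucc = 1 ∧ τ.succ = side τ) ∨
    (τ.castSucc = side τ ∧ τ.succ = 1) := by revert τ; decide

theorem ne_pos_iff {τ : Fin 2} {k : Fin 3} :
    (k ≠ τ.castSucc ∧ k ≠ τ.succ) ↔ (k ≠ 1 ∧ k ≠ side τ) := by revert k τ; decide

theorem pos_eq_of_ne {τ τ' : Fin 2} (h : τ ≠ τ') (k : Fin 3) :
    k = 1 ∨ k = side τ ∨ k = side τ' := by revert k τ τ'; decide

/-- The type of the crossing at the level `n`. -/
def typeAt (w : BraidWord 2) (hw : 0 < w.length) (n : ℕ) : Fin 2 :=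
  (w.get (crossingAtLevel w hw n)).1

/-- The crossing at the level `n` is smoothed horizontally. -/
def HorizAt (hw : 0 < w.length) (s : w.closure.State) (n : ℕ) : Prop :=
  w.Horiz s (crossingAtLevel w hw n)

variable (hw : 0 < w.length) {s : w.closure.State} {n : ℕ}

theorem conn_succ (s : w.closure.State) (k : Fin 3) (n : ℕ) :
    Conn (D := w.closure) s (k, (crossingAtLevel w hw n).succ) (edgeAt w hw k (n + 1)) := by
  unfold edgeAt crossingAtLevel
  have hlt := Nat.mod_lt n hw
  have hmod : (n + 1) % w.length = (n % w.length + 1) % w.length := (Nat.mod_add_mod _ _ _).symm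
  by_cases h : n % w.length + 1 = w.length
  · have h1 : (⟨n % w.length, hlt⟩ : Fin w.length).succ = Fin.last w.length := by
      ext; simpa using h
    have h2 : (⟨(n + 1) % w.length, Nat.mod_lt _ hw⟩ : Fin w.length).castSucc = 0 := by
      ext
      simp only [Fin.val_castSucc, Fin.val_zero]
      rw [hmod, h, Nat.mod_self]
    rw [h1, h2]
    exact Conn.last s k
  · have : (⟨n % w.length, hlt⟩ : Fin w.length).succ =
        (⟨(n + 1) % w.length, Nat.mod_lt _ hw⟩ : Fin w.length).castSucc := by
      ext
      simp only [Fin.val_castSucc, Fin.val_succ]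
      rw [hmod, Nat.mod_eq_of_lt (a := n % w.length + 1) (by omega)]
    rw [this]
    exact .refl _ _

theorem conn_vertAt {k : Fin 3} (h : HorizAt hw s n → k ≠ 1 ∧ k ≠ side (typeAt w hw n)) :
    Conn (D := w.closure) s (edgeAt w hw k n) (edgeAt w hw k (n + 1)) :=
  (Conn.vert fun h' => ne_pos_iff.2 (h h')).trans (conn_succ hw s k n)

theorem conn_lowAt (h : HorizAt hw s n) :
    Conn (D := w.closure) s (edgeAt w hw 1 n) (edgeAt w hw (side (typeAt w hw n)) n) := by
  have := Conn.horiz_low h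
  rcases side_cases (typeAt w hw n) with ⟨h1, h2⟩ | ⟨h1, h2⟩ <;>
    unfold typeAt at h1 h2 <;> rw [h1, h2] at this
  · exact this
  · exact this.symm

theorem conn_upAt (h : HorizAt hw s n) : Conn (D := w.closure) s (edgeAt w hw 1 (n + 1))
    (edgeAt w hw (side (typeAt w hw n)) (n + 1)) := by
  have := ((conn_succ hw s _ n).symm.trans (Conn.horiz_up h)).trans (conn_succ hw s _ n)
  rcases side_cases (typeAt w hw n) with ⟨h1, h2⟩ | ⟨h1, h2⟩ <;>
    unfold typeAt at h1 h2 <;> rw [h1, h2] at this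
  · exact this
  · exact this.symm

/-- The two circles at a horizontal smoothing. -/
theorem conn_ends_of_horizAt (h : HorizAt hw s n) :
    (Conn (D := w.closure) s (w.closure.crossing (crossingAtLevel w hw n)).a (edgeAt w hw 1 n) ∧
      Conn (D := w.closure) s (w.closure.crossing (crossingAtLevel w hw n)).c
        (edgeAt w hw 1 (n + 1))) := by
  have h0 : w.closure.crossing (crossingAtLevel w hw n) =
    w.crossingAt (crossingAtLevel w hw n) := rfl
  have hl := Conn.horiz_low h
  have hu := Conn.horiz_up h
  unfold crossingAt at h0
  have hS := conn_succ hw s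
  rcases hc : (w.get (crossingAtLevel w hw n)).2 with _ | _ <;> rw [hc] at h0 <;>
    rcases side_cases (typeAt w hw n) with ⟨h1, h2⟩ | ⟨h1, h2⟩ <;>
    unfold typeAt at h1 h2 <;> rw [h0] <;> dsimp only <;> rw [h1, h2] at hl hu ⊢
  · exact ⟨.refl _ _, hu.symm.trans (hS _ n)⟩
  · exact ⟨hl, hS _ n⟩
  · exact ⟨hl.symm, hS _ n⟩
  · exact ⟨.refl _ _, hu.trans (hS _ n)⟩

/-- The two circles at a vertical smoothing. -/
theorem conn_ends_of_not_horizAt (h : ¬ HorizAt hw s n) :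
    (Conn (D := w.closure) s (w.closure.crossing (crossingAtLevel w hw n)).a (edgeAt w hw 1 n) ∧
      Conn (D := w.closure) s (w.closure.crossing (crossingAtLevel w hw n)).c
        (edgeAt w hw (side (typeAt w hw n)) n)) ∨
    (Conn (D := w.closure) s (w.closure.crossing (crossingAtLevel w hw n)).c (edgeAt w hw 1 n) ∧
      Conn (D := w.closure) s (w.closure.crossing (crossingAtLevel w hw n)).a
        (edgeAt w hw (side (typeAt w hw n)) n)) := by
  have h0 : w.closure.crossing (crossingAtLevel w hw n) =
    w.crossingAt (crossingAtLevel w hw n) := rfl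
  have hv : ∀ k, Conn (D := w.closure) s (k, (crossingAtLevel w hw n).succ) (edgeAt w hw k n) :=
    fun k => (Conn.vert fun h' => absurd h' h).symm
  unfold crossingAt at h0
  rcases hc : (w.get (crossingAtLevel w hw n)).2 with _ | _ <;> rw [hc] at h0 <;>
    rcases side_cases (typeAt w hw n) with ⟨h1, h2⟩ | ⟨h1, h2⟩ <;>
    rw [h0] <;> dsimp only <;> rw [← h1, ← h2]
  · exact .inl ⟨.refl _ _, hv _⟩
  · exact .inr ⟨hv _, .refl _ _⟩
  · exact .inr ⟨hv _, .refl _ _⟩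
  · exact .inl ⟨.refl _ _, hv _⟩

theorem eq_of_mod_eq {L b x y : ℕ} (hx : b ≤ x) (hx' : x < b + L) (hy : b ≤ y) (hy' : y < b + L)
    (h : x % L = y % L) : x = y := by
  have key : ∀ {x y : ℕ}, x ≤ y → y - x < L → x % L = y % L → x = y := by
    intro x y hxy hlt h
    have := Nat.eq_zero_of_dvd_of_lt ((Nat.modEq_iff_dvd' hxy).1 h) hlt
    omega
  rcases le_total x y with hxy | hxy
  · exact key hxy (by omega) h
  · exact (key hxy (by omega) h.symm).symm

theorem exists_level {L : ℕ} (hL : 0 < L) (b l : ℕ) : ∃ n, b ≤ n ∧ n < b + L ∧ n % L = l % L := by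
  -- This is `b` plus the residue of `l - b`, written without subtraction below zero.
  refine ⟨b + (l + (L - b % L)) % L, by omega, by have := Nat.mod_lt (l + (L - b % L)) hL; omega, ?_⟩
  have hb := Nat.mod_lt b hL
  rw [Nat.add_mod_mod]
  have : b + (l + (L - b % L)) = l + L * (b / L + 1) := by
    have := Nat.div_add_mod b L
    rw [Nat.mul_add, Nat.mul_one]
    omega
  rw [this, Nat.add_mul_mod_self_left]

/-- A function of the levels in one turn around the closed braid that respects the smoothings is
constant on the circles. -/
theorem Conn.window_lift {α : Sort*} (b : ℕ) (g : Fin 3 → ℕ → α)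
    (hwrap : ∀ k, g k (b + w.length) = g k b)
    (hvert : ∀ n k, b ≤ n → n < b + w.length →
      (HorizAt hw s n → k ≠ 1 ∧ k ≠ side (typeAt w hw n)) → g k n = g k (n + 1))
    (hlow : ∀ n, b ≤ n → n < b + w.length → HorizAt hw s n →
      g 1 n = g (side (typeAt w hw n)) n)
    (hup : ∀ n, b ≤ n → n < b + w.length → HorizAt hw s n →
      g 1 (n + 1) = g (side (typeAt w hw n)) (n + 1))
    {k k' : Fin 3} {n n' : ℕ} (hn : b ≤ n) (hn' : n ≤ b + w.length) (hn1 : b ≤ n')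
    (hn1' : n' ≤ b + w.length)
    (h : Conn (D := w.closure) s (edgeAt w hw k n) (edgeAt w hw k' n')) : g k n = g k' n' := by
  -- `ν` picks the representative of a level in the window from `b`. The top level of the window is
  -- represented by `b`, which `hwrap` makes harmless.
  choose ν hν1 hν2 hν3 using exists_level hw b
  have hν : ∀ n k, b ≤ n → n ≤ b + w.length → ∀ l, l % w.length = n % w.length →
      g k (ν l) = g k n := by
    intro n k h1 h2 l hl
    rcases h2.lt_or_eq with h2 | rfl
    · rw [eq_of_mod_eq (hν1 l) (hν2 l) h1 h2 ((hν3 l).trans hl)]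
    · rw [hwrap, eq_of_mod_eq (hν1 l) (hν2 l) le_rfl (by omega)
        ((hν3 l).trans (hl.trans (Nat.add_mod_right _ _)))]
  let G : Fin 3 × Fin (w.length + 1) → α := fun e => g e.1 (ν e.2)
  have hG : ∀ n k, b ≤ n → n ≤ b + w.length → G (edgeAt w hw k n) = g k n := by
    intro n k h1 h2
    exact hν n k h1 h2 _ (Nat.mod_mod _ _)
  have hc : ∀ c : Fin w.length, ∃ n, b ≤ n ∧ n < b + w.length ∧ crossingAtLevel w hw n = c ∧
      (∀ k, G (k, c.castSucc) = g k n) ∧ ∀ k, G (k, c.succ) = g k (n + 1) := by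
    intro c
    refine ⟨ν c, hν1 c, hν2 c, ?_, fun k => rfl, fun k => ?_⟩
    · ext
      exact (hν3 c).trans (Nat.mod_eq_of_lt c.2)
    · refine hν (ν c + 1) k (Nat.le_succ_of_le (hν1 c)) (hν2 c) _ ?_
      rw [Fin.val_succ]
      exact Nat.ModEq.add_right 1 (hν3 c).symm
  have key := Conn.lift (s := s) G ?_ ?_ ?_ ?_ h
  · rwa [hG n k hn hn', hG n' k' hn1 hn1'] at key
  · intro k
    refine congrArg (g k) (eq_of_mod_eq (hν1 _) (hν2 _) (hν1 _) (hν2 _) ?_)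
    rw [hν3, hν3]
    simp
  · intro c k h
    obtain ⟨n, h1, h2, rfl, h3, h4⟩ := hc c
    rw [h3, h4]
    exact hvert n k h1 h2 fun h' => ne_pos_iff.1 (h h')
  · intro c h
    obtain ⟨n, h1, h2, rfl, h3, h4⟩ := hc c
    have := hlow n h1 h2 h
    rcases side_cases (typeAt w hw n) with ⟨e1, e2⟩ | ⟨e1, e2⟩ <;> unfold typeAt at e1 e2 <;>
      rw [h3, h3, e1, e2]
    · exact this
    · exact this.symm
  · intro c h
    obtain ⟨n, h1, h2, rfl, h3, h4⟩ := hc c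
    have := hup n h1 h2 h
    rcases side_cases (typeAt w hw n) with ⟨e1, e2⟩ | ⟨e1, e2⟩ <;> unfold typeAt at e1 e2 <;>
      rw [h4, h4, e1, e2]
    · exact this
    · exact this.symm

/-- Two consecutive horizontal smoothings of the same type bound a circle. -/
theorem not_conn_of_bubble {b n₁ n₂ : ℕ} {τ : Fin 2} (hb : b ≤ n₁) (h12 : n₁ < n₂)
    (hb' : n₂ < b + w.length) (h1 : HorizAt hw s n₁) (h2 : HorizAt hw s n₂)
    (ht1 : typeAt w hw n₁ = τ) (ht2 : typeAt w hw n₂ = τ)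
    (hbetween : ∀ n, n₁ < n → n < n₂ → ¬ HorizAt hw s n)
    {k k' : Fin 3} {n n' : ℕ} (hk : k = 1 ∨ k = side τ) (hn : n₁ < n) (hn' : n ≤ n₂)
    (hn1 : b ≤ n') (hn1' : n' ≤ b + w.length)
    (hout : ¬ ((k' = 1 ∨ k' = side τ) ∧ n₁ < n' ∧ n' ≤ n₂)) :
    ¬ Conn (D := w.closure) s (edgeAt w hw k n) (edgeAt w hw k' n') := by
  intro h
  -- The invariant is membership in the bubble: the middle strand and the side strand of type `τ`,
  -- between the two levels.
  have := Conn.window_lift hw (s := s) b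
    (fun k n => (k = 1 ∨ k = side τ) ∧ n₁ < n ∧ n ≤ n₂) ?_ ?_ ?_ ?_ (by omega) (by omega) hn1 hn1' h
  · exact hout (this ▸ ⟨hk, hn, hn'⟩)
  · intro k
    refine propext (and_congr_right fun _ => ?_)
    omega
  · intro m k hm hm' hh
    refine propext (and_congr_right fun hk => ?_)
    have hm1 : m ≠ n₁ := by
      rintro rfl
      rw [ht1] at hh
      rcases hk with hk | hk
      · exact (hh h1).1 hk
      · exact (hh h1).2 hk
    have hm2 : m ≠ n₂ := by
      rintro rfl
      rw [ht2] at hh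
      rcases hk with hk | hk
      · exact (hh h2).1 hk
      · exact (hh h2).2 hk
    omega
  · intro m hm hm' hh
    refine propext ?_
    by_cases hin : n₁ < m ∧ m ≤ n₂
    · have : m = n₂ := by
        by_contra hne
        exact hbetween m hin.1 (by omega) hh
      rw [this, ht2]
      simp
    · simp only [hin, and_false]
  · intro m hm hm' hh
    refine propext ?_
    by_cases hin : n₁ < m + 1 ∧ m + 1 ≤ n₂
    · have : m = n₁ := by
        by_contra hne
        exact hbetween m (by omega) (by omega) hh
      rw [this, ht1]
      simp
    · simp only [hin, and_false]

theorem exists_next {p : ℕ → Prop} {n n' : ℕ} (hn : n < n') (hp : p n') :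
    ∃ m, n < m ∧ m ≤ n' ∧ p m ∧ ∀ i, n < i → i < m → ¬ p i := by
  classical
  have hex : ∃ m, n < m ∧ p m := ⟨n', hn, hp⟩
  refine ⟨Nat.find hex, (Nat.find_spec hex).1, Nat.find_min' hex ⟨hn, hp⟩, (Nat.find_spec hex).2,
    fun i h1 h2 h3 => Nat.find_min hex h2 ⟨h1, h3⟩⟩

theorem exists_prev {p : ℕ → Prop} {n n' : ℕ} (hn : n' < n) (hp : p n') :
    ∃ m, n' ≤ m ∧ m < n ∧ p m ∧ ∀ i, m < i → i < n → ¬ p i := by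
  induction n with
  | zero => omega
  | succ n ih =>
    by_cases h : p n
    · exact ⟨n, by omega, by omega, h, fun i _ _ => by omega⟩
    · have hlt : n' < n := by
        by_contra hlt
        have : n' = n := by omega
        exact h (this ▸ hp)
      obtain ⟨m, h1, h2, h3, h4⟩ := ih hlt
      refine ⟨m, h1, by omega, h3, fun i hi hi' => ?_⟩
      by_cases hin : i = n
      · exact hin ▸ h
      · exact h4 i hi (by omega)

theorem loop_iff_of_horizAt (h : HorizAt hw s n) :
    Loop (D := w.closure) s (crossingAtLevel w hw n) ↔
      Conn (D := w.closure) s (edgeAt w hw 1 n) (edgeAt w hw 1 (n + 1)) := by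
  obtain ⟨h1, h2⟩ := conn_ends_of_horizAt hw h
  exact ⟨fun h => (h1.symm.trans h).trans h2, fun h => (h1.trans h).trans h2.symm⟩

theorem loop_iff_of_not_horizAt (h : ¬ HorizAt hw s n) :
    Loop (D := w.closure) s (crossingAtLevel w hw n) ↔
      Conn (D := w.closure) s (edgeAt w hw 1 n) (edgeAt w hw (side (typeAt w hw n)) n) := by
  rcases conn_ends_of_not_horizAt hw h with ⟨h1, h2⟩ | ⟨h1, h2⟩
  · exact ⟨fun h => (h1.symm.trans h).trans h2, fun h => (h1.trans h).trans h2.symm⟩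
  · exact ⟨fun h => (h1.symm.trans h.symm).trans h2, fun h => ((h1.trans h).trans h2.symm).symm⟩

/-- A horizontal smoothing with another one of the same type next to it joins different circles. -/
theorem not_loop_of_horizAt {b n' : ℕ} (hb : b ≤ n) (hb' : n < b + w.length) (hb1 : b ≤ n')
    (hb1' : n' < b + w.length) (hne : n ≠ n') (h : HorizAt hw s n) (h' : HorizAt hw s n')
    (hty : ∀ m, min n n' ≤ m → m ≤ max n n' → HorizAt hw s m →
      typeAt w hw m = typeAt w hw n) :
    ¬ Loop (D := w.closure) s (crossingAtLevel w hw n) := by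
  rw [loop_iff_of_horizAt hw h]
  rcases lt_or_gt_of_ne hne with hlt | hlt
  · obtain ⟨m, h1, h2, h3, h4⟩ := exists_next (p := HorizAt hw s) hlt h'
    intro hc
    exact not_conn_of_bubble hw hb h1 (by omega) h h3 rfl (hty m (by omega) (by omega) h3) h4
      (.inl rfl) (Nat.lt_succ_self n) h1 hb hb'.le (by omega) hc.symm
  · obtain ⟨m, h1, h2, h3, h4⟩ := exists_prev (p := HorizAt hw s) hlt h'
    exact not_conn_of_bubble hw (by omega) h2 hb' h3 h (hty m (by omega) (by omega) h3) rfl h4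
      (.inl rfl) h2 le_rfl (by omega) (by omega) (by omega)

/-- A vertical smoothing between two horizontal ones of the other type joins different circles. -/
theorem not_loop_of_not_horizAt {b n₁ n₂ : ℕ} {τ : Fin 2} (hb : b ≤ n₁) (h1 : n₁ < n) (h2 : n < n₂)
    (hb' : n₂ < b + w.length) (h : ¬ HorizAt hw s n) (hh1 : HorizAt hw s n₁)
    (hh2 : HorizAt hw s n₂) (hne : typeAt w hw n ≠ τ)
    (hty : ∀ m, n₁ ≤ m → m ≤ n₂ → HorizAt hw s m → typeAt w hw m = τ) :
    ¬ Loop (D := w.closure) s (crossingAtLevel w hw n) := by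
  rw [loop_iff_of_not_horizAt hw h]
  obtain ⟨m, a1, a2, a3, a4⟩ := exists_next (p := HorizAt hw s) h2 hh2
  obtain ⟨m', b1, b2, b3, b4⟩ := exists_prev (p := HorizAt hw s) h1 hh1
  refine not_conn_of_bubble hw (τ := τ) (by omega) (show m' < m by omega) (by omega) b3 a3
    (hty _ b1 (by omega) b3) (hty _ (by omega) a2 a3) ?_ (.inl rfl) b2 a1.le (by omega) (by omega) ?_
  · intro i hi hi' hi''
    rcases lt_trichotomy i n with hlt | rfl | hlt
    · exact b4 i hi hlt hi''
    · exact h hi''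
    · exact a4 i hlt hi' hi''
  · rintro ⟨h | h, -⟩
    · exact side_ne_one _ h
    · exact hne (side_inj h)

end ThreeStrands

end BraidWord

/-! ### Alternating blocks of crossings and the strands through them. -/

namespace BraidWord

open LinkDiagram

/-- The level at which the `i`-th block of crossings starts. -/
def low (A : ℕ → ℤ) (i : ℕ) : ℕ := ∑ j ∈ Finset.range i, (A j).natAbs

theorem low_succ (A : ℕ → ℤ) (i : ℕ) : low A (i + 1) = low A i + (A i).natAbs :=
  Finset.sum_range_succ _ _

theorem low_mono (A : ℕ → ℤ) : Monotone (low A) :=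
  monotone_nat_of_le_succ fun i => by rw [low_succ]; omega

/-- The type of the crossings in the `i`-th block. -/
def blockType (i : ℕ) : Fin 2 := ⟨i % 2, Nat.mod_lt _ two_pos⟩

theorem blockType_succ_ne (i : ℕ) : blockType (i + 1) ≠ blockType i := by
  unfold blockType
  intro h
  have := congrArg Fin.val h
  dsimp only at this
  omega

theorem blockType_eq_iff {i j : ℕ} : blockType i = blockType j ↔ i % 2 = j % 2 := by
  unfold blockType
  exact Fin.mk.injEq _ _ _ _ ▸ Iff.rfl

/-- The braid word consists of alternating blocks with the exponents `A i`, repeated periodically;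
one turn around the closed braid consists of the blocks from `o` to `o + N`. -/
structure IsBlockWord (w : BraidWord 2) (hw : 0 < w.length) (A : ℕ → ℤ) (N o : ℕ) : Prop where
  letter : ∀ i n, low A i ≤ n → n < low A (i + 1) →
    w.get (crossingAtLevel w hw n) = (blockType i, decide (0 < A i))
  length : low A (o + N) = low A o + w.length
  even : Even N
  pos : 0 < N
  ne_zero : ∀ i, A i ≠ 0
  next_of_neg : ∀ i, A i < 0 → 0 < A (i + 1)
  prev_of_neg : ∀ i, A (i + 1) < 0 → 0 < A i
  first_pos : 0 < A o
  last_pos : 0 < A (o + N - 1)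
  wrap_pos : 0 < A (o + N)

section Geometry

variable {w : BraidWord 2} {hw : 0 < w.length} {A : ℕ → ℤ} {N o : ℕ}
  (hB : IsBlockWord w hw A N o) {s : w.closure.State}
include hB

theorem IsBlockWord.typeAt {i n : ℕ} (h1 : low A i ≤ n) (h2 : n < low A (i + 1)) :
    typeAt w hw n = blockType i := by
  unfold BraidWord.typeAt
  rw [hB.letter i n h1 h2]

theorem IsBlockWord.horizAt_pos {i n : ℕ} (h1 : low A i ≤ n) (h2 : n < low A (i + 1))
    (hA : 0 < A i) : HorizAt hw s n ↔ s (crossingAtLevel w hw n) = true := by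
  unfold HorizAt Horiz
  rw [hB.letter i n h1 h2]
  simp [hA]

theorem IsBlockWord.horizAt_neg {i n : ℕ} (h1 : low A i ≤ n) (h2 : n < low A (i + 1))
    (hA : A i < 0) : HorizAt hw s n ↔ s (crossingAtLevel w hw n) = false := by
  unfold HorizAt Horiz
  rw [hB.letter i n h1 h2]
  rw [decide_eq_false hA.not_gt]

theorem IsBlockWord.low_lt {i : ℕ} : low A i < low A (i + 1) := by
  have := hB.ne_zero i
  rw [low_succ]
  omega

omit hB in
/-- Every level from `low A i` to `low A j` lies in one of the blocks. -/
theorem exists_block {i j n : ℕ} (h1 : low A i ≤ n) (h2 : n < low A j) :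
    ∃ r, i ≤ r ∧ r < j ∧ low A r ≤ n ∧ n < low A (r + 1) := by
  induction j with
  | zero => have := low_mono A (Nat.zero_le i); omega
  | succ j ih =>
    by_cases h : n < low A j
    · obtain ⟨r, h3, h4, h5⟩ := ih h
      exact ⟨r, h3, by omega, h5⟩
    · refine ⟨j, ?_, by omega, by omega, h2⟩
      by_contra hlt
      have := low_mono A (show j + 1 ≤ i by omega)
      omega

omit hB in
theorem block_unique {i j n : ℕ} (h1 : low A i ≤ n) (h2 : n < low A (i + 1)) (h3 : low A j ≤ n)
    (h4 : n < low A (j + 1)) : i = j := by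
  by_contra hne
  rcases lt_or_gt_of_ne hne with h | h
  · have := low_mono A (show i + 1 ≤ j by omega); omega
  · have := low_mono A (show j + 1 ≤ i by omega); omega

omit hB in
theorem conn_pass {k : Fin 3} {n n' : ℕ} (h : n ≤ n')
    (hv : ∀ m, n ≤ m → m < n' → HorizAt hw s m → k ≠ 1 ∧ k ≠ side (BraidWord.typeAt w hw m)) :
    Conn (D := w.closure) s (edgeAt w hw k n) (edgeAt w hw k n') := by
  induction n', h using Nat.le_induction with
  | base => exact .refl _ _
  | succ m hm ih =>
    exact (ih fun i h1 h2 => hv i h1 (by omega)).trans (conn_vertAt hw (hv m hm (by omega)))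

-- Up to the first horizontal smoothing above, both strands run vertically, and that smoothing joins
-- them. `conn_of_prev` is the same looking downwards.
omit hB in
theorem conn_of_next {τ : Fin 2} {n m : ℕ} (h : n ≤ m) (hm : HorizAt hw s m)
    (hty : ∀ i, n ≤ i → i ≤ m → HorizAt hw s i → BraidWord.typeAt w hw i = τ) :
    Conn (D := w.closure) s (edgeAt w hw 1 n) (edgeAt w hw (side τ) n) := by
  obtain ⟨m', h1, h2, h3⟩ : ∃ m', n ≤ m' ∧ m' ≤ m ∧ HorizAt hw s m' ∧
      ∀ i, n ≤ i → i < m' → ¬ HorizAt hw s i := by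
    by_cases hn : HorizAt hw s n
    · exact ⟨n, le_rfl, h, hn, fun i _ _ => by omega⟩
    · have hlt : n < m := lt_of_le_of_ne h (by rintro rfl; exact hn hm)
      obtain ⟨m', h1, h2, h3, h4⟩ := exists_next (p := HorizAt hw s) hlt hm
      refine ⟨m', h1.le, h2, h3, fun i hi hi' => ?_⟩
      rcases hi.lt_or_eq with hi | rfl
      · exact h4 i hi hi'
      · exact hn
  have pass : ∀ k, Conn (D := w.closure) s (edgeAt w hw k n) (edgeAt w hw k m') := fun k =>
    conn_pass h1 fun i hi hi' hh => absurd hh (h3.2 i hi hi')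
  have := conn_lowAt hw h3.1
  rw [hty m' h1 h2 h3.1] at this
  exact ((pass 1).trans this).trans (pass _).symm

omit hB in
theorem conn_of_prev {τ : Fin 2} {n m : ℕ} (h : m < n) (hm : HorizAt hw s m)
    (hty : ∀ i, m ≤ i → i < n → HorizAt hw s i → BraidWord.typeAt w hw i = τ) :
    Conn (D := w.closure) s (edgeAt w hw 1 n) (edgeAt w hw (side τ) n) := by
  obtain ⟨m', h1, h2, h3, h4⟩ := exists_prev (p := HorizAt hw s) h hm
  have pass : ∀ k, Conn (D := w.closure) s (edgeAt w hw k (m' + 1)) (edgeAt w hw k n) := fun k =>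
    conn_pass h2 fun i hi hi' hh => absurd hh (h4 i hi hi')
  have := conn_upAt hw h3
  rw [hty m' h1 h2 h3] at this
  exact ((pass 1).symm.trans this).trans (pass _)

omit hB in
theorem edgeAt_add_length (k : Fin 3) (n : ℕ) :
    edgeAt w hw k (n + w.length) = edgeAt w hw k n := by
  unfold edgeAt crossingAtLevel
  simp

/-- All the crossings of the block `i` are labelled `B`. -/
def AllB (hw : 0 < w.length) (A : ℕ → ℤ) (s : w.closure.State) (i : ℕ) : Prop :=
  ∀ n, low A i ≤ n → n < low A (i + 1) → s (crossingAtLevel w hw n) = true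

/-- The blocks from `r` to `r'` are positive blocks of the same type, separated by negative blocks
whose crossings are all labelled `B`; the last of them has a crossing labelled `B`. -/
def Reaches (hw : 0 < w.length) (A : ℕ → ℤ) (s : w.closure.State) (r r' : ℕ) : Prop :=
  r ≤ r' ∧ (∀ i, r ≤ i → i ≤ r' → (0 < A i ∧ blockType i = blockType r) ∨
    (A i < 0 ∧ AllB hw A s i)) ∧ ∃ n, low A r' ≤ n ∧ n < low A (r' + 1) ∧ HorizAt hw s n

/-- A negative block that is entirely B is vertical, so horizontal smoothings occur only in the
positive blocks of the stretch. -/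
theorem IsBlockWord.type_of_stretch {r r' : ℕ} {τ : Fin 2}
    (h : ∀ i, r ≤ i → i ≤ r' → (0 < A i ∧ blockType i = τ) ∨ (A i < 0 ∧ AllB hw A s i))
    {n : ℕ} (h1 : low A r ≤ n) (h2 : n < low A (r' + 1)) (hn : HorizAt hw s n) :
    BraidWord.typeAt w hw n = τ := by
  obtain ⟨i, h3, h4, h5, h6⟩ := exists_block h1 h2
  rcases h i h3 (by omega) with ⟨_, h7⟩ | ⟨h7, h8⟩
  · rw [hB.typeAt h5 h6, h7]
  · rw [hB.horizAt_neg h5 h6 h7, h8 n h5 h6] at hn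
    simp at hn

theorem IsBlockWord.conn_of_reaches {r r' : ℕ} (h : Reaches hw A s r r') :
    Conn (D := w.closure) s (edgeAt w hw 1 (low A r))
      (edgeAt w hw (side (blockType r)) (low A r)) := by
  obtain ⟨h1, h2, n, h3, h4, h5⟩ := h
  exact conn_of_next ((low_mono A h1).trans h3) h5 fun _ hi hi' =>
    hB.type_of_stretch h2 hi (by omega)

theorem IsBlockWord.conn_of_block {r n : ℕ} (h1 : low A r ≤ n) (h2 : n < low A (r + 1))
    (hn : HorizAt hw s n) : Conn (D := w.closure) s (edgeAt w hw 1 (low A (r + 1)))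
      (edgeAt w hw (side (blockType r)) (low A (r + 1))) :=
  conn_of_prev h2 hn fun _ hi hi' _ => hB.typeAt (h1.trans hi) hi'

theorem IsBlockWord.conn_outer {r : ℕ} {τ : Fin 2} (hτ : τ ≠ blockType r) :
    Conn (D := w.closure) s (edgeAt w hw (side τ) (low A r))
      (edgeAt w hw (side τ) (low A (r + 1))) :=
  conn_pass hB.low_lt.le fun _ hi hi' _ => ⟨side_ne_one _, fun h =>
    hτ ((side_inj h).trans (hB.typeAt hi hi'))⟩

end Geometry

end BraidWord

/-! ### The states of the torsion cycle, and why they are left by splits. -/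

namespace BraidWord

open LinkDiagram

section Family

/-- The number of `B`-labels in the `i`-th block. -/
def cnt {w : BraidWord 2} (hw : 0 < w.length) (A : ℕ → ℤ) (s : w.closure.State) (i : ℕ) : ℕ :=
  ((Finset.Ico (low A i) (low A (i + 1))).filter
    fun n => s (crossingAtLevel w hw n) = true).card

/-- The number of `B`-labels in the blocks from `o` on and before `r`, compared with `κ`. -/
def excess {w : BraidWord 2} (hw : 0 < w.length) (A : ℕ → ℤ) (κ : ℕ → ℕ) (o : ℕ)
    (s : w.closure.State) (r : ℕ) : ℤ :=
  ∑ i ∈ Finset.Ico o r, ((cnt hw A s i : ℤ) - κ i)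

/-- The condition at the `r`-th block that defines the states of the torsion cycle, when `d` is the
excess of `B`-labels up to this block. -/
def BlockCond {w : BraidWord 2} (hw : 0 < w.length) (A : ℕ → ℤ) (s : w.closure.State) (r : ℕ)
    (d : ℤ) : Prop :=
  (A r < 0 ∧ (∀ n, low A r < n → n < low A (r + 1) → s (crossingAtLevel w hw n) = true) ∧
    ((s (crossingAtLevel w hw (low A r)) = false ∧ d = 0) ∨
      (s (crossingAtLevel w hw (low A r)) = true ∧ d ≤ 0))) ∨
  (0 < A r ∧ (0 < A (r + 1) → d = 0))

/-- The states of the torsion cycle. -/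
def Family {w : BraidWord 2} (hw : 0 < w.length) (A : ℕ → ℤ) (κ : ℕ → ℕ) (N o : ℕ)
    (s : w.closure.State) : Prop :=
  ∀ r, o ≤ r → r < o + N → BlockCond hw A s r (excess hw A κ o s (r + 1))

variable {w : BraidWord 2} {hw : 0 < w.length} {A : ℕ → ℤ} {N o : ℕ} {κ : ℕ → ℕ}
  {s : w.closure.State}

theorem excess_succ {r : ℕ} (h : o ≤ r) :
    excess hw A κ o s (r + 1) = excess hw A κ o s r + (cnt hw A s r - κ r) :=
  Finset.sum_Ico_succ_top h _

theorem excess_self : excess hw A κ o s o = 0 := by simp [excess]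

theorem cnt_of_first {i : ℕ} (hA : A i ≠ 0)
    (h : ∀ n, low A i < n → n < low A (i + 1) → s (crossingAtLevel w hw n) = true)
    (h0 : s (crossingAtLevel w hw (low A i)) = false) : cnt hw A s i + 1 = (A i).natAbs := by
  have hlt : low A i < low A (i + 1) := by rw [low_succ]; omega
  have : ((Finset.Ico (low A i) (low A (i + 1))).filter
      fun n => s (crossingAtLevel w hw n) = true) = Finset.Ico (low A i + 1) (low A (i + 1)) := by
    ext n
    simp only [Finset.mem_filter, Finset.mem_Ico]
    constructor
    · rintro ⟨⟨h1, h2⟩, h3⟩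
      refine ⟨lt_of_le_of_ne h1 ?_, h2⟩
      rintro rfl
      simp [h0] at h3
    · rintro ⟨h1, h2⟩
      exact ⟨⟨by omega, h2⟩, h n h1 h2⟩
  unfold cnt
  rw [this, Nat.card_Ico, low_succ]
  omega

theorem exists_of_cnt_pos {i : ℕ} (h : 0 < cnt hw A s i) :
    ∃ n, low A i ≤ n ∧ n < low A (i + 1) ∧ s (crossingAtLevel w hw n) = true := by
  obtain ⟨n, hn⟩ := Finset.card_pos.1 h
  simp only [Finset.mem_filter, Finset.mem_Ico] at hn
  exact ⟨n, hn.1.1, hn.1.2, hn.2⟩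

/-- The target numbers of `B`-labels: at least two in positive blocks, all but one in negative
blocks. -/
structure IsTarget (A : ℕ → ℤ) (κ : ℕ → ℕ) (N o : ℕ) : Prop where
  two_le : ∀ i, o ≤ i → i < o + N → 0 < A i → 2 ≤ κ i
  neg : ∀ i, o ≤ i → i < o + N → A i < 0 → κ i + 1 = (A i).natAbs

section Facts

variable (hB : IsBlockWord w hw A N o) (hκ : IsTarget A κ N o) (hs : Family hw A κ N o s)
include hB hκ hs

-- All labels but the first are B, which is exactly the target of a negative block, so the excess
-- does not change across it; behind it the excess is required to vanish.
omit hB in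
theorem Family.excess_of_first {r : ℕ} (h1 : o ≤ r) (h2 : r < o + N) (hA : A r < 0)
    (h0 : s (crossingAtLevel w hw (low A r)) = false) :
    excess hw A κ o s r = 0 ∧ excess hw A κ o s (r + 1) = 0 := by
  rcases hs r h1 h2 with ⟨_, h3, ⟨_, h4⟩ | ⟨h4, _⟩⟩ | ⟨h3, _⟩
  · have h5 := cnt_of_first hA.ne h3 h0
    have h6 := hκ.neg r h1 h2 hA
    have h7 := excess_succ (hw := hw) (A := A) (κ := κ) (s := s) h1
    omega
  · simp [h0] at h4
  · omega

omit hB hκ in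
theorem Family.excess_nonpos {r : ℕ} (h1 : o ≤ r) (h2 : r ≤ o + N) (hA : 0 < A r) :
    excess hw A κ o s r ≤ 0 := by
  rcases h1.eq_or_lt with rfl | h1
  · exact excess_self.le
  · obtain ⟨q, rfl⟩ : ∃ q, r = q + 1 := ⟨r - 1, by omega⟩
    rcases hs q (by omega) (by omega) with ⟨_, _, ⟨_, h4⟩ | ⟨_, h4⟩⟩ | ⟨_, h3⟩
    · exact h4.le
    · exact h4
    · exact (h3 hA).le

theorem Family.exists_horizAt {q : ℕ} (h1 : o ≤ q) (h2 : q < o + N) (hA : 0 < A q)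
    (h0 : excess hw A κ o s (q + 1) = 0) :
    ∃ n, low A q ≤ n ∧ n < low A (q + 1) ∧ HorizAt hw s n := by
  have h3 := hs.excess_nonpos h1 h2.le hA
  have h4 := hκ.two_le q h1 h2 hA
  have h5 := excess_succ (hw := hw) (A := A) (κ := κ) (s := s) h1
  obtain ⟨n, h6, h7, h8⟩ := exists_of_cnt_pos (hw := hw) (A := A) (s := s) (i := q) (by omega)
  exact ⟨n, h6, h7, (hB.horizAt_pos h6 h7 hA).2 h8⟩

/-- If a positive block has no label B, the excess behind it is negative. Hence the next block is
not positive, and its first label is not A, as either would require zero excess there. So the next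
block is negative and entirely B, and the search goes on two blocks later. -/
theorem Family.reaches {r : ℕ} (h1 : o ≤ r) (h2 : r < o + N) (hA : 0 < A r) :
    ∃ r', r' < o + N ∧ Reaches hw A s r r' := by
  induction hk : o + N - r using Nat.strong_induction_on generalizing r with
  | _ k ih =>
    by_cases hc : 0 < cnt hw A s r
    · obtain ⟨n, h6, h7, h8⟩ := exists_of_cnt_pos hc
      refine ⟨r, h2, le_rfl, fun i hi hi' => ?_, n, h6, h7, (hB.horizAt_pos h6 h7 hA).2 h8⟩
      obtain rfl : i = r := by omega
      exact .inl ⟨hA, rfl⟩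
    · have h3 := hs.excess_nonpos h1 h2.le hA
      have h4 := hκ.two_le r h1 h2 hA
      have h5 := excess_succ (hw := hw) (A := A) (κ := κ) (s := s) h1
      have hr : ¬ 0 < A (r + 1) := fun h => by
        rcases hs r h1 h2 with ⟨h', _⟩ | ⟨_, h'⟩
        · omega
        · have := h' h; omega
      have hr' : A (r + 1) < 0 := by have := hB.ne_zero (r + 1); omega
      have hlt : r + 1 < o + N := by
        by_contra hlt
        obtain hlt : r + 1 = o + N := by omega
        rw [hlt] at hr
        exact hr hB.wrap_pos
      -- The last block of the turn is positive, so a negative block is followed by another block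
      -- inside the turn.
      have hlt' : r + 2 < o + N := by
        by_contra hlt'
        have : r + 1 = o + N - 1 := by omega
        rw [this] at hr
        exact hr hB.last_pos
      have hall : AllB hw A s (r + 1) := by
        rcases hs (r + 1) (by omega) hlt with ⟨_, h6, ⟨h7, _⟩ | ⟨h7, _⟩⟩ | ⟨h6, _⟩
        · have := (hs.excess_of_first hκ (by omega) hlt hr' h7).1
          omega
        · intro n hn hn'
          rcases hn.eq_or_lt with rfl | hn
          · exact h7
          · exact h6 n hn hn'
        · omega
      obtain ⟨r', h6, h7, h8, h9⟩ := ih (o + N - (r + 2)) (by omega) (by omega) hlt'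
        (hB.next_of_neg _ hr') rfl
      refine ⟨r', h6, by omega, fun i hi hi' => ?_, h9⟩
      by_cases hi2 : r + 2 ≤ i
      · have := h8 i hi2 hi'
        rwa [show blockType (r + 2) = blockType r from blockType_eq_iff.2 (by omega)] at this
      · by_cases hir : i = r
        · subst hir; exact .inl ⟨hA, rfl⟩
        · obtain rfl : i = r + 1 := by omega
          exact .inr ⟨hr', hall⟩

end Facts

theorem Reaches.mono (hB : IsBlockWord w hw A N o) {t : w.closure.State} {r r' : ℕ}
    (h : Reaches hw A s r r') (hst : ∀ c, s c = true → t c = true) : Reaches hw A t r r' := by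
  obtain ⟨h1, h2, n, h3, h4, h5⟩ := h
  refine ⟨h1, fun i hi hi' => (h2 i hi hi').imp_right fun h => ⟨h.1, fun n hn hn' =>
    hst _ (h.2 n hn hn')⟩, n, h3, h4, ?_⟩
  rcases h2 r' h1 le_rfl with ⟨h6, _⟩ | ⟨h6, h7⟩
  · rw [hB.horizAt_pos h3 h4 h6] at h5 ⊢
    exact hst _ h5
  · rw [hB.horizAt_neg h3 h4 h6, h7 n h3 h4] at h5
    simp at h5

theorem delB_le {s : w.closure.State} {x c : Fin w.length}
    (h : delB (D := w.closure) s x c = true) : s c = true := by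
  by_cases hc : c = x
  · subst hc
    rw [show delB (D := w.closure) s c c = false from delB_self (D := w.closure) s c] at h
    simp at h
  · rwa [show delB (D := w.closure) s x c = s c from delB_of_ne (D := w.closure) hc] at h

theorem exists_level_block (hB : IsBlockWord w hw A N o) (x : Fin w.length) :
    ∃ n j, o ≤ j ∧ j < o + N ∧ low A j ≤ n ∧ n < low A (j + 1) ∧ crossingAtLevel w hw n = x := by
  obtain ⟨n, h1, h2, h3⟩ := exists_level hw (low A o) x
  rw [← hB.length] at h2
  obtain ⟨j, h4, h5, h6, h7⟩ := exists_block h1 h2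
  refine ⟨n, j, h4, h5, h6, h7, ?_⟩
  ext
  exact h3.trans (Nat.mod_eq_of_lt x.2)

/-- In a positive block, `x` and the label B found by `reaches` are horizontal smoothings of one
type with none of the other type between them, so a bubble starts at `x`. In a negative block, `x`
is the first crossing, and after the change it is a vertical smoothing inside a bubble formed by the
positive blocks before and after. It therefore separates the bubble from a strand outside. -/
theorem Family.not_loop (hB : IsBlockWord w hw A N o) (hκ : IsTarget A κ N o)
    {x : Fin w.length} (hx : s x = true)
    (hs : Family hw A κ N o (delB (D := w.closure) s x)) : ¬ Loop (D := w.closure) s x := by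
  obtain ⟨n, j, h1, h2, h3, h4, rfl⟩ := exists_level_block hB x
  set t : w.closure.State := delB (D := w.closure) s (crossingAtLevel w hw n) with ht
  have hmono : ∀ c, t c = true → s c = true := fun c hc => delB_le hc
  have htn : t (crossingAtLevel w hw n) = false := delB_self (D := w.closure) s _
  have hend := hB.length
  have hlo : ∀ {i}, o ≤ i → low A o ≤ low A i := fun h => low_mono A h
  have hhi : ∀ {i}, i < o + N → low A (i + 1) ≤ low A (o + N) := fun h => low_mono A h
  by_cases hA : 0 < A j
  · obtain ⟨r', h5, h6⟩ := hs.reaches hB hκ h1 h2 hA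
    have h6' := h6.mono hB hmono
    obtain ⟨h7, h8, n', h9, h10, h11⟩ := h6
    obtain ⟨-, h8', -⟩ := h6'
    have hA' : 0 < A r' := by
      rcases h8 r' h7 le_rfl with h | h
      · exact h.1
      · rw [hB.horizAt_neg h9 h10 h.1, h.2 n' h9 h10] at h11
        simp at h11
    rw [hB.horizAt_pos h9 h10 hA'] at h11
    have hne : n ≠ n' := by
      rintro rfl
      rw [htn] at h11
      simp at h11
    have hjr := low_mono A h7
    have hjr' := low_mono A (Nat.succ_le_succ h7)
    have := hlo h1
    have := hlo (h1.trans h7)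
    have := hhi h2
    have := hhi h5
    refine not_loop_of_horizAt hw (b := low A o) (n' := n') (by omega) (by omega) (by omega)
      (by omega) hne ((hB.horizAt_pos h3 h4 hA).2 hx)
      ((hB.horizAt_pos h9 h10 hA').2 (hmono _ h11)) fun m hm hm' hh => ?_
    rw [hB.typeAt h3 h4]
    refine hB.type_of_stretch (r := j) (r' := r') h8' ?_ ?_ hh
    · exact le_trans (le_min h3 (hjr.trans h9)) hm
    · refine lt_of_le_of_lt hm' (max_lt (lt_of_lt_of_le h4 ?_) h10)
      exact hjr'
  · have hA' : A j < 0 := by have := hB.ne_zero j; omega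
    have hjo : o < j := by
      refine lt_of_le_of_ne h1 ?_
      rintro rfl
      exact hA hB.first_pos
    have hjN : j + 1 < o + N := by
      refine lt_of_le_of_ne h2 fun h => hA ?_
      rw [show j = o + N - 1 by omega]
      exact hB.last_pos
    have hB1 := hs j h1 h2
    rcases hB1 with ⟨-, h5, h6⟩ | ⟨h5, -⟩
    swap
    · exact absurd h5 hA
    have hn : n = low A j := by
      by_contra hne
      rw [h5 n (by omega) h4] at htn
      simp at htn
    subst hn
    obtain ⟨q, rfl⟩ : ∃ q, j = q + 1 := ⟨j - 1, by omega⟩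
    have hq := hB.prev_of_neg q hA'
    obtain ⟨n₁, h7, h8, h9⟩ := hs.exists_horizAt hB hκ (by omega) (by omega) hq
      (hs.excess_of_first hκ h1 h2 hA' htn).1
    obtain ⟨r', h10, h11⟩ := hs.reaches hB hκ (r := q + 1 + 1) (by omega) hjN
      (hB.next_of_neg _ hA')
    have h11' := h11.mono hB hmono
    obtain ⟨h12, h13, n₂, h14, h15, h16⟩ := h11'
    have hall : AllB hw A s (q + 1) := by
      intro m hm hm'
      rcases hm.eq_or_lt with rfl | hm
      · exact hx
      · exact hmono _ (h5 m hm hm')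
    have hst : ∀ i, q ≤ i → i ≤ r' → (0 < A i ∧ blockType i = blockType q) ∨
        (A i < 0 ∧ AllB hw A s i) := by
      intro i hi hi'
      by_cases hi2 : q + 2 ≤ i
      · have := h13 i hi2 hi'
        rwa [show blockType (q + 1 + 1) = blockType q from blockType_eq_iff.2 (by omega)] at this
      · by_cases hiq : i = q
        · subst hiq; exact .inl ⟨hq, rfl⟩
        · obtain rfl : i = q + 1 := by omega
          exact .inr ⟨hA', hall⟩
    have := hlo (show o ≤ q by omega)
    have := hhi h10
    have := low_mono A h12
    have := low_mono A (show q + 1 ≤ q + 1 + 1 by omega)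
    refine not_loop_of_not_horizAt hw (b := low A o) (n₁ := n₁) (n₂ := n₂) (τ := blockType q)
      (by omega) h8 (by omega) (by omega) ?_ ?_ h16 ?_ fun m hm hm' hh =>
        hB.type_of_stretch hst (h7.trans hm) (by omega) hh
    · rw [hB.horizAt_neg h3 h4 hA', hx]
      simp
    · rw [hB.horizAt_pos h7 h8 hq] at h9 ⊢
      exact hmono _ h9
    · rw [hB.typeAt h3 h4]
      exact blockType_succ_ne q

end Family

end BraidWord

/-! ### The boundary of the cycle is even: a telescoping sum around the braid. -/

namespace BraidWord

open LinkDiagram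

section Sums

variable {w : BraidWord 2} {hw : 0 < w.length} {A : ℕ → ℤ} {N o : ℕ} {κ : ℕ → ℕ}
  {s : w.closure.State}

theorem crossingAtLevel_inj (hB : IsBlockWord w hw A N o) {i j n n' : ℕ} (hi : o ≤ i)
    (hi' : i < o + N) (hj : o ≤ j) (hj' : j < o + N) (h1 : low A i ≤ n) (h2 : n < low A (i + 1))
    (h3 : low A j ≤ n') (h4 : n' < low A (j + 1))
    (h : crossingAtLevel w hw n = crossingAtLevel w hw n') : n = n' := by
  have := hB.length
  have := low_mono A hi
  have := low_mono A hj
  have := low_mono A (show i + 1 ≤ o + N from hi')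
  have := low_mono A (show j + 1 ≤ o + N from hj')
  exact eq_of_mod_eq (b := low A o) (L := w.length) (by omega) (by omega) (by omega) (by omega)
    (congrArg Fin.val h)

section Change

variable (hB : IsBlockWord w hw A N o) {j n : ℕ} (hj : o ≤ j) (hj' : j < o + N)
  (h1 : low A j ≤ n) (h2 : n < low A (j + 1))
include hB hj hj' h1 h2

theorem delB_level {i m : ℕ} (hi : o ≤ i) (hi' : i < o + N) (h3 : low A i ≤ m)
    (h4 : m < low A (i + 1)) (hne : m ≠ n) :
    delB (D := w.closure) s (crossingAtLevel w hw n) (crossingAtLevel w hw m) =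
      s (crossingAtLevel w hw m) :=
  delB_of_ne (D := w.closure) fun h => hne (crossingAtLevel_inj hB hi hi' hj hj' h3 h4 h1 h2 h)

theorem cnt_delB (hs : s (crossingAtLevel w hw n) = true) {i : ℕ} (hi : o ≤ i) (hi' : i < o + N) :
    (cnt hw A (delB (D := w.closure) s (crossingAtLevel w hw n)) i : ℤ) =
      cnt hw A s i - if i = j then 1 else 0 := by
  have hfil : ((Finset.Ico (low A i) (low A (i + 1))).filter fun m =>
      delB (D := w.closure) s (crossingAtLevel w hw n) (crossingAtLevel w hw m) = true) =
      ((Finset.Ico (low A i) (low A (i + 1))).filter fun m =>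
        s (crossingAtLevel w hw m) = true).erase n := by
    ext m
    simp only [Finset.mem_filter, Finset.mem_Ico, Finset.mem_erase]
    by_cases hm : m = n
    · subst hm
      simp only [ne_eq, not_true_eq_false, false_and, iff_false, not_and]
      intro _
      rw [show delB (D := w.closure) s (crossingAtLevel w hw m) (crossingAtLevel w hw m) = false
        from delB_self (D := w.closure) s _]
      simp
    · constructor
      · rintro ⟨h3, h4⟩
        rw [delB_level hB hj hj' h1 h2 hi hi' h3.1 h3.2 hm] at h4
        exact ⟨hm, h3, h4⟩
      · rintro ⟨-, h3, h4⟩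
        refine ⟨h3, ?_⟩
        rwa [delB_level hB hj hj' h1 h2 hi hi' h3.1 h3.2 hm]
  unfold cnt
  rw [hfil, Finset.card_erase_eq_ite]
  have hmem : n ∈ ((Finset.Ico (low A i) (low A (i + 1))).filter fun m =>
      s (crossingAtLevel w hw m) = true) ↔ i = j := by
    simp only [Finset.mem_filter, Finset.mem_Ico, hs, and_true]
    constructor
    · rintro ⟨h3, h4⟩
      exact block_unique h3 h4 h1 h2
    · rintro rfl
      exact ⟨h1, h2⟩
  by_cases hij : i = j
  · have hm := hmem.2 hij
    rw [if_pos hm, if_pos hij]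
    have := Finset.card_pos.2 ⟨n, hm⟩
    omega
  · rw [if_neg (hmem.not.2 hij), if_neg hij, sub_zero]

theorem excess_delB (hs : s (crossingAtLevel w hw n) = true) {r : ℕ} (hr : r ≤ o + N) :
    excess hw A κ o (delB (D := w.closure) s (crossingAtLevel w hw n)) r =
      excess hw A κ o s r - if j < r then 1 else 0 := by
  unfold excess
  have h3 : ∀ i ∈ Finset.Ico o r,
      ((cnt hw A (delB (D := w.closure) s (crossingAtLevel w hw n)) i : ℤ) - κ i) =
        (cnt hw A s i - κ i) - if i = j then 1 else 0 := by
    intro i hi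
    rw [Finset.mem_Ico] at hi
    rw [cnt_delB hB hj hj' h1 h2 hs hi.1 (by omega)]
    ring
  rw [Finset.sum_congr rfl h3, Finset.sum_sub_distrib, Finset.sum_ite_eq']
  simp [hj]

theorem blockCond_delB_of_ne {i : ℕ} (hi : o ≤ i) (hi' : i < o + N) (hij : i ≠ j) (d : ℤ) :
    BlockCond hw A (delB (D := w.closure) s (crossingAtLevel w hw n)) i d ↔
      BlockCond hw A s i d := by
  have key : ∀ m, low A i ≤ m → m < low A (i + 1) →
      delB (D := w.closure) s (crossingAtLevel w hw n) (crossingAtLevel w hw m) =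
        s (crossingAtLevel w hw m) := fun m h3 h4 =>
    delB_level hB hj hj' h1 h2 hi hi' h3 h4 fun h => hij (block_unique h3 h4 (h ▸ h1) (h ▸ h2))
  have hall : (∀ m, low A i < m → m < low A (i + 1) →
      delB (D := w.closure) s (crossingAtLevel w hw n) (crossingAtLevel w hw m) = true) ↔
      ∀ m, low A i < m → m < low A (i + 1) → s (crossingAtLevel w hw m) = true :=
    forall_congr' fun m => forall_congr' fun h3 => forall_congr' fun h4 => by rw [key m h3.le h4]
  unfold BlockCond
  rw [hall, key _ le_rfl hB.low_lt]

end Change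

theorem blockCond_pos {t : w.closure.State} {i : ℕ} (hA : 0 < A i) (d : ℤ) :
    BlockCond hw A s i d ↔ BlockCond hw A t i d := by
  have : ¬ A i < 0 := by omega
  simp [BlockCond, this]

/-- The blocks before `j` satisfy the condition on the states of the torsion cycle, and those from
`j` on do so with the excess decreased by one. -/
def Mixed {w : BraidWord 2} (hw : 0 < w.length) (A : ℕ → ℤ) (κ : ℕ → ℕ) (N o : ℕ)
    (s : w.closure.State) (j : ℕ) : Prop :=
  (∀ i, o ≤ i → i < j → BlockCond hw A s i (excess hw A κ o s (i + 1))) ∧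
  (∀ i, j ≤ i → i < o + N → BlockCond hw A s i (excess hw A κ o s (i + 1) - 1))

section Change

variable (hB : IsBlockWord w hw A N o) {j n : ℕ} (hj : o ≤ j) (hj' : j < o + N)
  (h1 : low A j ≤ n) (h2 : n < low A (j + 1)) (hs : s (crossingAtLevel w hw n) = true)
include hB hj hj' h1 h2 hs

theorem family_delB_iff : Family hw A κ N o (delB (D := w.closure) s (crossingAtLevel w hw n)) ↔
    (∀ i, o ≤ i → i < j → BlockCond hw A s i (excess hw A κ o s (i + 1))) ∧
    BlockCond hw A (delB (D := w.closure) s (crossingAtLevel w hw n)) j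
      (excess hw A κ o s (j + 1) - 1) ∧
    (∀ i, j + 1 ≤ i → i < o + N → BlockCond hw A s i (excess hw A κ o s (i + 1) - 1)) := by
  have hexc : ∀ i, i < o + N →
      excess hw A κ o (delB (D := w.closure) s (crossingAtLevel w hw n)) (i + 1) =
      excess hw A κ o s (i + 1) - if j < i + 1 then 1 else 0 := fun i hi =>
    excess_delB hB hj hj' h1 h2 hs hi
  constructor
  · intro h
    refine ⟨fun i hi hij => ?_, ?_, fun i hij hi => ?_⟩
    · have := h i hi (by omega)
      rwa [hexc i (by omega), if_neg (by omega), sub_zero,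
        blockCond_delB_of_ne hB hj hj' h1 h2 hi (by omega) (by omega)] at this
    · have := h j hj hj'
      rwa [hexc j hj', if_pos (by omega)] at this
    · have := h i (by omega) hi
      rwa [hexc i hi, if_pos (by omega),
        blockCond_delB_of_ne hB hj hj' h1 h2 (by omega) hi (by omega)] at this
  · rintro ⟨h3, h4, h5⟩ i hi hi'
    rcases lt_trichotomy i j with h | rfl | h
    · rw [hexc i hi', if_neg (by omega), sub_zero,
        blockCond_delB_of_ne hB hj hj' h1 h2 hi hi' (by omega)]
      exact h3 i hi h
    · rw [hexc i hi', if_pos (by omega)]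
      exact h4
    · rw [hexc i hi', if_pos (by omega),
        blockCond_delB_of_ne hB hj hj' h1 h2 hi hi' (by omega)]
      exact h5 i h hi'

/-- At a positive block the condition does not look at the labels, only at the excess. Removing any
label B of block `j` therefore has the same effect: the excess drops by one from `j` on. -/
theorem family_delB_pos (hA : 0 < A j) :
    Family hw A κ N o (delB (D := w.closure) s (crossingAtLevel w hw n)) ↔
      Mixed hw A κ N o s j := by
  rw [family_delB_iff hB hj hj' h1 h2 hs, blockCond_pos (t := s) hA]
  refine and_congr_right fun _ => ⟨fun h i hi hi' => ?_, fun h => ⟨h j le_rfl hj', fun i hi =>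
    h i (by omega)⟩⟩
  rcases hi.eq_or_lt with rfl | hi
  · exact h.1
  · exact h.2 i hi hi'

theorem first_of_family_delB (hA : A j < 0)
    (h : Family hw A κ N o (delB (D := w.closure) s (crossingAtLevel w hw n))) :
    n = low A j ∧ AllB hw A s j := by
  have h3 := ((family_delB_iff hB hj hj' h1 h2 hs).1 h).2.1
  rcases h3 with ⟨-, h4, -⟩ | ⟨h4, -⟩
  · have hn : n = low A j := by
      by_contra hne
      have := h4 n (by omega) h2
      rw [show delB (D := w.closure) s (crossingAtLevel w hw n) (crossingAtLevel w hw n) = false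
        from delB_self (D := w.closure) s _] at this
      simp at this
    refine ⟨hn, fun m hm hm' => ?_⟩
    rcases hm.eq_or_lt with rfl | hm
    · rwa [hn] at hs
    · exact delB_le (h4 m hm hm')
  · omega

-- With `d` the excess behind the block, the three conditions at the block are `d = 1`, `d ≤ 1` and
-- `d ≤ 0`, and the first indicator is the sum of the others modulo two. This splits the odd term of
-- a negative block into two ends that fit the neighbouring blocks.
open Classical in
theorem family_delB_neg (hA : A j < 0) (hn : n = low A j) (hall : AllB hw A s j) :
    (if Family hw A κ N o (delB (D := w.closure) s (crossingAtLevel w hw n)) then 1 else 0 :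
      ZMod 2) = (if Mixed hw A κ N o s j then 1 else 0) +
        (if Mixed hw A κ N o s (j + 1) then 1 else 0) := by
  have h3 : ∀ d, BlockCond hw A s j d ↔ d ≤ 0 := by
    intro d
    have h4 := hall _ le_rfl hB.low_lt
    unfold BlockCond
    simp only [hA, h4, hA.not_gt, false_and, or_false, true_and]
    simp only [Bool.true_eq_false, false_and, false_or, and_iff_right_iff_imp]
    exact fun _ m hm hm' => hall m hm.le hm'
  have h4 : ∀ d, BlockCond hw A (delB (D := w.closure) s (crossingAtLevel w hw n)) j d ↔ d = 0 := by
    intro d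
    have h5 : delB (D := w.closure) s (crossingAtLevel w hw n) (crossingAtLevel w hw (low A j)) =
        false := by rw [hn]; exact delB_self (D := w.closure) s _
    unfold BlockCond
    simp only [hA, hA.not_gt, h5, false_and, or_false, true_and]
    simp only [Bool.false_eq_true, false_and, or_false, and_iff_right_iff_imp]
    intro _ m hm hm'
    rw [delB_level hB hj hj' h1 h2 hj hj' hm.le hm' (by omega)]
    exact hall m hm.le hm'
  have e1 : Family hw A κ N o (delB (D := w.closure) s (crossingAtLevel w hw n)) ↔
      (∀ i, o ≤ i → i < j → BlockCond hw A s i (excess hw A κ o s (i + 1))) ∧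
      (∀ i, j + 1 ≤ i → i < o + N → BlockCond hw A s i (excess hw A κ o s (i + 1) - 1)) ∧
      excess hw A κ o s (j + 1) = 1 := by
    rw [family_delB_iff hB hj hj' h1 h2 hs, h4, sub_eq_zero]
    tauto
  have e2 : Mixed hw A κ N o s j ↔
      (∀ i, o ≤ i → i < j → BlockCond hw A s i (excess hw A κ o s (i + 1))) ∧
      (∀ i, j + 1 ≤ i → i < o + N → BlockCond hw A s i (excess hw A κ o s (i + 1) - 1)) ∧
      excess hw A κ o s (j + 1) ≤ 1 := by
    refine and_congr_right fun _ => ⟨fun h => ⟨fun i hi => h i (by omega), ?_⟩,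
      fun h i hi hi' => ?_⟩
    · have := (h3 _).1 (h j le_rfl hj'); omega
    · rcases hi.eq_or_lt with rfl | hi
      · exact (h3 _).2 (by omega)
      · exact h.1 i hi hi'
  have e3 : Mixed hw A κ N o s (j + 1) ↔
      (∀ i, o ≤ i → i < j → BlockCond hw A s i (excess hw A κ o s (i + 1))) ∧
      (∀ i, j + 1 ≤ i → i < o + N → BlockCond hw A s i (excess hw A κ o s (i + 1) - 1)) ∧
      excess hw A κ o s (j + 1) ≤ 0 := by
    constructor
    · rintro ⟨h5, h6⟩
      exact ⟨fun i hi hi' => h5 i hi (by omega), h6, (h3 _).1 (h5 j hj (by omega))⟩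
    · rintro ⟨h5, h6, h7⟩
      refine ⟨fun i hi hi' => ?_, h6⟩
      by_cases hij : i = j
      · subst hij; exact (h3 _).2 h7
      · exact h5 i hi (by omega)
  rw [if_congr e1 rfl rfl, if_congr e2 rfl rfl, if_congr e3 rfl rfl]
  by_cases hx : (∀ i, o ≤ i → i < j → BlockCond hw A s i (excess hw A κ o s (i + 1))) ∧
      (∀ i, j + 1 ≤ i → i < o + N → BlockCond hw A s i (excess hw A κ o s (i + 1) - 1))
  · obtain ⟨hx1, hx2⟩ := hx
    rcases lt_trichotomy (excess hw A κ o s (j + 1)) 1 with h | h | h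
    · rw [if_neg (fun h' => by omega), if_pos ⟨hx1, hx2, by omega⟩, if_pos ⟨hx1, hx2, by omega⟩]
      rfl
    · rw [if_pos ⟨hx1, hx2, h⟩, if_pos ⟨hx1, hx2, by omega⟩, if_neg (fun h' => by omega)]; rfl
    · rw [if_neg (fun h' => by omega), if_neg (fun h' => by omega), if_neg (fun h' => by omega)]
      rfl
  · rw [if_neg (fun h => hx ⟨h.1, h.2.1⟩), if_neg (fun h => hx ⟨h.1, h.2.1⟩),
      if_neg (fun h => hx ⟨h.1, h.2.1⟩)]
    rfl

end Change

/-- The two sides differ only in the condition at block `j`, which is void for a positive block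
followed by a negative one. -/
theorem mixed_succ (hj : o ≤ j) (hj' : j < o + N) (hA : 0 < A j) (hA' : A (j + 1) < 0) :
    Mixed hw A κ N o s (j + 1) ↔ Mixed hw A κ N o s j := by
  have h : ∀ d, BlockCond hw A s j d := fun d => .inr ⟨hA, fun h => by omega⟩
  constructor
  · rintro ⟨h1, h2⟩
    refine ⟨fun i hi hi' => h1 i hi (by omega), fun i hi hi' => ?_⟩
    rcases hi.eq_or_lt with rfl | hi
    · exact h _
    · exact h2 i hi hi'
  · rintro ⟨h1, h2⟩
    refine ⟨fun i hi hi' => ?_, fun i hi hi' => h2 i (by omega) hi'⟩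
    by_cases hij : i = j
    · subst hij; exact h _
    · exact h1 i hi (by omega)

theorem sum_crossings (hw : 0 < w.length) (b : ℕ) (g : Fin w.length → ZMod 2) :
    ∑ x, g x = ∑ n ∈ Finset.Ico b (b + w.length), g (crossingAtLevel w hw n) := by
  symm
  refine Finset.sum_bij (fun n _ => crossingAtLevel w hw n) (fun _ _ => Finset.mem_univ _) ?_ ?_
    fun _ _ => rfl
  · intro n hn n' hn' h
    rw [Finset.mem_Ico] at hn hn'
    exact eq_of_mod_eq hn.1 hn.2 hn'.1 hn'.2 (congrArg Fin.val h)
  · intro x _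
    obtain ⟨n, h1, h2, h3⟩ := exists_level hw b x
    exact ⟨n, Finset.mem_Ico.2 ⟨h1, h2⟩, Fin.ext (h3.trans (Nat.mod_eq_of_lt x.2))⟩

theorem sum_blocks (g : ℕ → ZMod 2) {i j : ℕ} (h : i ≤ j) :
    ∑ n ∈ Finset.Ico (low A i) (low A j), g n =
      ∑ r ∈ Finset.Ico i j, ∑ n ∈ Finset.Ico (low A r) (low A (r + 1)), g n := by
  induction j, h using Nat.le_induction with
  | base => simp
  | succ j hj ih =>
    rw [Finset.sum_Ico_succ_top hj, ← ih,
      Finset.sum_Ico_consecutive g (low_mono A hj) (low_mono A (Nat.le_succ j))]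

theorem sum_telescope (g : ℕ → ZMod 2) {i j : ℕ} (h : i ≤ j) :
    ∑ n ∈ Finset.Ico i j, (g n + g (n + 1)) = g i + g j := by
  induction j, h using Nat.le_induction with
  | base => rw [Finset.Ico_self, Finset.sum_empty, CharTwo.add_self_eq_zero]
  | succ j hj ih =>
    rw [Finset.sum_Ico_succ_top hj, ih]
    linear_combination CharTwo.add_self_eq_zero (g j)

/-- Connectivity properties shared by the states of the torsion cycle and of its boundary. -/
structure Tight {w : BraidWord 2} (hw : 0 < w.length) (A : ℕ → ℤ) (N o : ℕ)
    (s : w.closure.State) : Prop where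
  reaches : ∀ r, o ≤ r → r < o + N → 0 < A r → ∃ r', Reaches hw A s r r'
  exists_horizAt : ∀ q, o ≤ q → q < o + N → 0 < A q →
    (A (q + 1) < 0 → q + 1 < o + N ∧ s (crossingAtLevel w hw (low A (q + 1))) = false) →
    ∃ n, low A q ≤ n ∧ n < low A (q + 1) ∧ HorizAt hw s n
  neg : ∀ r, o ≤ r → r < o + N → A r < 0 → ∀ n, low A r < n → n < low A (r + 1) →
    s (crossingAtLevel w hw n) = true

theorem Family.tight_of_le (hB : IsBlockWord w hw A N o) (hκ : IsTarget A κ N o)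
    {t : w.closure.State} (hs : Family hw A κ N o s) (hst : ∀ c, s c = true → t c = true) :
    Tight hw A N o t where
  reaches r h1 h2 hA := by
    obtain ⟨r', -, h⟩ := hs.reaches hB hκ h1 h2 hA
    exact ⟨r', h.mono hB hst⟩
  exists_horizAt q h1 h2 hA h := by
    have h0 : excess hw A κ o s (q + 1) = 0 := by
      by_cases hA' : A (q + 1) < 0
      · obtain ⟨h3, h4⟩ := h hA'
        refine (hs.excess_of_first hκ (by omega) h3 hA' ?_).1
        by_contra h5
        rw [Bool.not_eq_false] at h5
        rw [hst _ h5] at h4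
        simp at h4
      · have := hB.ne_zero (q + 1)
        rcases hs q h1 h2 with ⟨h', _⟩ | ⟨_, h'⟩
        · omega
        · exact h' (by omega)
    obtain ⟨n, h3, h4, h5⟩ := hs.exists_horizAt hB hκ h1 h2 hA h0
    rw [hB.horizAt_pos h3 h4 hA] at h5
    exact ⟨n, h3, h4, (hB.horizAt_pos h3 h4 hA).2 (hst _ h5)⟩
  neg r h1 h2 hA n h3 h4 := by
    rcases hs r h1 h2 with ⟨_, h, _⟩ | ⟨h, _⟩
    · exact hst _ (h n h3 h4)
    · omega

/-- The position of the edges at the start of the `r`-th block on the long circle. -/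
structure OnLongCircle {w : BraidWord 2} (hw : 0 < w.length) (A : ℕ → ℤ) (o : ℕ)
    (s : w.closure.State) (f : Fin 3 × Fin (w.length + 1) → ZMod 2) (v : ZMod 2) (r : ℕ) :
    Prop where
  pos : 0 < A r → f (edgeAt w hw (side (blockType (r + 1))) (low A r)) = v
  neg : A r < 0 → s (crossingAtLevel w hw (low A r)) = true →
    f (edgeAt w hw (side (blockType r)) (low A r)) = v
  neg_first : A r < 0 → s (crossingAtLevel w hw (low A r)) = false →
    ∀ k, f (edgeAt w hw k (low A r)) = v
  pos_first : 0 < A r → r = o ∨ 0 < A (r - 1) ∨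
    s (crossingAtLevel w hw (low A (r - 1))) = false → ∀ k, f (edgeAt w hw k (low A r)) = v

/-- Going up block by block, the strand that takes no part in a positive block carries the value `v`
past it, and so does the side strand of a negative block that is entirely B. Where horizontal
smoothings of both types are adjacent to a level, they join all three positions there. -/
theorem onLongCircle (hB : IsBlockWord w hw A N o) (hs : Tight hw A N o s)
    (f : Fin 3 × Fin (w.length + 1) → ZMod 2)
    (hf : ∀ e e', Conn (D := w.closure) s e e' → f e = f e') {r : ℕ} (hr : o ≤ r)
    (hr' : r < o + N) : OnLongCircle hw A o s f (f (edgeAt w hw 1 (low A o))) r := by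
  have bt2 : ∀ r, blockType (r + 1 + 1) = blockType r := fun r => blockType_eq_iff.2 (by omega)
  set v := f (edgeAt w hw 1 (low A o)) with hv
  induction r, hr using Nat.le_induction with
  | base =>
    -- The first block joins the middle strand to one side from above. The last block, of the other
    -- type because `N` is even, joins it to the other side from below.
    have hall : ∀ k, f (edgeAt w hw k (low A o)) = v := by
      obtain ⟨r', h1⟩ := hs.reaches o le_rfl hr' hB.first_pos
      have e1 := hf _ _ (hB.conn_of_reaches h1)
      obtain ⟨n, h2, h3, h4⟩ := hs.exists_horizAt (o + N - 1) (by have := hB.pos; omega)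
        (by have := hB.pos; omega) hB.last_pos
        (by rw [show o + N - 1 + 1 = o + N by have := hB.pos; omega]
            intro h; have := hB.wrap_pos; omega)
      have e2 := hf _ _ (hB.conn_of_block h2 h3 h4)
      rw [show o + N - 1 + 1 = o + N by have := hB.pos; omega, hB.length, edgeAt_add_length,
        edgeAt_add_length] at e2
      have hne : blockType (o + N - 1) ≠ blockType o := by
        intro h
        rw [blockType_eq_iff] at h
        have := hB.pos
        obtain ⟨m, hm⟩ := hB.even
        omega
      intro k
      rcases pos_eq_of_ne hne k with rfl | rfl | rfl
      · rfl
      · exact e2.symm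
      · exact e1.symm
    have := hB.first_pos
    exact ⟨fun _ => hall _, fun h => by omega, fun h => by omega, fun _ _ => hall⟩
  | succ r hr ih =>
    have ih := ih (by omega)
    have hne := blockType_succ_ne r
    have hlow := hB.low_lt (i := r)
    rcases lt_or_gt_of_ne (hB.ne_zero r) with hA | hA
    · have hA' := hB.next_of_neg r hA
      rcases hb : s (crossingAtLevel w hw (low A r)) with _ | _
      · have h0 := ih.neg_first hA hb
        have hh : HorizAt hw s (low A r) := (hB.horizAt_neg le_rfl hlow hA).2 hb
        have e1 := hf _ _ (hB.conn_of_block le_rfl hlow hh)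
        have e2 := hf _ _ (hB.conn_outer (s := s) (r := r) (τ := blockType (r + 1)) hne)
        rw [h0] at e2
        obtain ⟨r', h1⟩ := hs.reaches (r + 1) (by omega) hr' hA'
        have e3 := hf _ _ (hB.conn_of_reaches h1)
        have hall : ∀ k, f (edgeAt w hw k (low A (r + 1))) = v := by
          intro k
          rcases pos_eq_of_ne hne k with rfl | rfl | rfl
          · rw [e3, ← e2]
          · exact e2.symm
          · rw [← e1, e3, ← e2]
        exact ⟨fun _ => hall _, fun h => by omega, fun h => by omega, fun _ _ => hall⟩
      · have hall : AllB hw A s r := by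
          intro n h1 h2
          rcases h1.eq_or_lt with rfl | h1
          · exact hb
          · exact hs.neg r hr (by omega) hA n h1 h2
        have e1 : Conn (D := w.closure) s (edgeAt w hw (side (blockType r)) (low A r))
            (edgeAt w hw (side (blockType r)) (low A (r + 1))) :=
          conn_pass hlow.le fun m h1 h2 h3 => by
            rw [hB.horizAt_neg h1 h2 hA, hall m h1 h2] at h3
            simp at h3
        have e1 := hf _ _ e1
        rw [ih.neg hA hb] at e1
        refine ⟨fun _ => ?_, fun h => by omega, fun h => by omega, fun _ h => ?_⟩
        · rw [bt2]; exact e1.symm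
        · rw [Nat.add_sub_cancel, hb] at h
          rcases h with h | h | h
          · omega
          · omega
          · simp at h
    · have e1 := hf _ _ (hB.conn_outer (s := s) (r := r) (τ := blockType (r + 1)) hne)
      rw [ih.pos hA] at e1
      rcases lt_or_gt_of_ne (hB.ne_zero (r + 1)) with hA' | hA'
      · refine ⟨fun h => by omega, fun _ _ => e1.symm, fun _ hb => ?_, fun h => by omega⟩
        obtain ⟨n, h2, h3, h4⟩ := hs.exists_horizAt r hr (by omega) hA fun _ => ⟨hr', hb⟩
        have e2 := hf _ _ (hB.conn_of_block h2 h3 h4)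
        have hlow' := hB.low_lt (i := r + 1)
        have e3 := hf _ _ (conn_of_next (τ := blockType (r + 1)) le_rfl
          ((hB.horizAt_neg (s := s) le_rfl hlow' hA').2 hb)
          fun i hi hi' _ => hB.typeAt hi (by omega))
        intro k
        rcases pos_eq_of_ne hne k with rfl | rfl | rfl
        · rw [e3, ← e1]
        · exact e1.symm
        · rw [← e2, e3, ← e1]
      · obtain ⟨n, h2, h3, h4⟩ := hs.exists_horizAt r hr (by omega) hA fun h => by omega
        have e2 := hf _ _ (hB.conn_of_block h2 h3 h4)
        obtain ⟨r', h1⟩ := hs.reaches (r + 1) (by omega) hr' hA'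
        have e3 := hf _ _ (hB.conn_of_reaches h1)
        have hall : ∀ k, f (edgeAt w hw k (low A (r + 1))) = v := by
          intro k
          rcases pos_eq_of_ne hne k with rfl | rfl | rfl
          · rw [e3, ← e1]
          · exact e1.symm
          · rw [← e2, e3, ← e1]
        exact ⟨fun _ => hall _, fun h => by omega, fun h => by omega, fun _ _ => hall⟩

open Classical in
/-- The contribution of the `r`-th block to the boundary of the torsion cycle. -/
theorem sum_block (hB : IsBlockWord w hw A N o) (hs : Tight hw A N o s)
    (f : Fin 3 × Fin (w.length + 1) → ZMod 2)
    (hf : ∀ e e', Conn (D := w.closure) s e e' → f e = f e') {r : ℕ} (hr : o ≤ r)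
    (hr' : r < o + N) :
    (∑ n ∈ Finset.Ico (low A r) (low A (r + 1)),
      if s (crossingAtLevel w hw n) = true ∧
        Family hw A κ N o (delB (D := w.closure) s (crossingAtLevel w hw n))
      then f (w.closure.crossing (crossingAtLevel w hw n)).a +
        f (w.closure.crossing (crossingAtLevel w hw n)).c else 0) =
    (if Mixed hw A κ N o s r then 1 else 0) *
      (f (edgeAt w hw 1 (low A r)) + f (edgeAt w hw 1 (low A o))) +
    (if Mixed hw A κ N o s (r + 1) then 1 else 0) *
      (f (edgeAt w hw 1 (low A (r + 1))) + f (edgeAt w hw 1 (low A o))) := by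
  set v := f (edgeAt w hw 1 (low A o)) with hv
  have hlow := hB.low_lt (i := r)
  have hr1 := onLongCircle hB hs f hf hr hr'
  rw [← hv] at hr1
  -- the middle edge at the end of a block with a real boundary
  have hend : ∀ q, o ≤ q → q < o + N → (0 < A q ∧ 0 < A (q + 1)) ∨
      (0 < A q ∧ A (q + 1) < 0 ∧ s (crossingAtLevel w hw (low A (q + 1))) = false) ∨
      (A q < 0 ∧ s (crossingAtLevel w hw (low A q)) = false) →
      f (edgeAt w hw 1 (low A (q + 1))) = v := by
    intro q hq hq' h
    by_cases hlast : q + 1 = o + N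
    · rw [hlast, hB.length, edgeAt_add_length]
    · have := onLongCircle hB hs f hf (r := q + 1) (by omega) (by omega)
      rw [← hv] at this
      rcases h with ⟨h1, h2⟩ | ⟨h1, h2, h3⟩ | ⟨h1, h2⟩
      · exact this.pos_first h2 (.inr (.inl (by simpa using h1))) 1
      · exact this.neg_first h2 h3 1
      · exact this.pos_first (hB.next_of_neg _ h1) (.inr (.inr (by simpa using h2))) 1
  rcases lt_or_gt_of_ne (hB.ne_zero r) with hA | hA
  · rcases hb : s (crossingAtLevel w hw (low A r)) with _ | _
    -- Both ends lie on the long circle, so the right-hand side vanishes. On the left no state of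
    -- the family lies below, since that would need a block that is entirely B.
    · rw [hr1.neg_first hA hb 1, hend r hr hr' (.inr (.inr ⟨hA, hb⟩)), CharTwo.add_self_eq_zero,
        mul_zero, mul_zero, add_zero]
      refine Finset.sum_eq_zero fun n hn => if_neg ?_
      rw [Finset.mem_Ico] at hn
      rintro ⟨h1, h2⟩
      have := (first_of_family_delB hB hr hr' hn.1 hn.2 h1 hA h2).2 _ le_rfl hlow
      rw [hb] at this
      simp at this
    · have hall : AllB hw A s r := by
        intro n h1 h2
        rcases h1.eq_or_lt with rfl | h1
        · exact hb
        · exact hs.neg r hr hr' hA n h1 h2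
      have hnot : ∀ n, low A r ≤ n → n < low A (r + 1) → ¬ HorizAt hw s n := fun n h1 h2 h3 => by
        rw [hB.horizAt_neg h1 h2 hA, hall n h1 h2] at h3
        simp at h3
      have e1 := hf _ _ (conn_pass (hw := hw) (s := s) (k := 1) hlow.le fun m h1 h2 h3 =>
        absurd h3 (hnot m h1 h2))
      rw [← e1, ← add_mul, ← family_delB_neg hB hr hr' le_rfl hlow hb hA rfl hall,
        Finset.sum_eq_single (low A r)]
      · have e2 : f (w.closure.crossing (crossingAtLevel w hw (low A r))).a +
            f (w.closure.crossing (crossingAtLevel w hw (low A r))).c =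
            f (edgeAt w hw 1 (low A r)) + v := by
          rw [← hr1.neg hA hb, ← hB.typeAt le_rfl hlow]
          rcases conn_ends_of_not_horizAt hw (hnot _ le_rfl hlow) with ⟨h1, h2⟩ | ⟨h1, h2⟩
          · rw [hf _ _ h1, hf _ _ h2]
          · rw [hf _ _ h1, hf _ _ h2, add_comm]
        rw [e2]
        by_cases hF : Family hw A κ N o
          (delB (D := w.closure) s (crossingAtLevel w hw (low A r)))
        · rw [if_pos ⟨hb, hF⟩, if_pos hF, one_mul]
        · rw [if_neg fun h => hF h.2, if_neg hF, zero_mul]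
      · intro n hn hne
        rw [Finset.mem_Ico] at hn
        refine if_neg ?_
        rintro ⟨h1, h2⟩
        exact hne (first_of_family_delB hB hr hr' hn.1 hn.2 h1 hA h2).1
      · intro h
        exact absurd (Finset.mem_Ico.2 ⟨le_rfl, hlow⟩) h
  · have e1 : ∀ n ∈ Finset.Ico (low A r) (low A (r + 1)),
        (if s (crossingAtLevel w hw n) = true ∧
          Family hw A κ N o (delB (D := w.closure) s (crossingAtLevel w hw n))
        then f (w.closure.crossing (crossingAtLevel w hw n)).a +
          f (w.closure.crossing (crossingAtLevel w hw n)).c else 0) =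
        (if Mixed hw A κ N o s r then 1 else 0) *
          (f (edgeAt w hw 1 n) + f (edgeAt w hw 1 (n + 1))) := by
      intro n hn
      rw [Finset.mem_Ico] at hn
      by_cases hb : s (crossingAtLevel w hw n) = true
      · have h1 := (hB.horizAt_pos hn.1 hn.2 hA).2 hb
        obtain ⟨h2, h3⟩ := conn_ends_of_horizAt hw h1
        rw [hf _ _ h2, hf _ _ h3, family_delB_pos hB hr hr' hn.1 hn.2 hb hA]
        simp [hb]
      · have h1 := (hB.horizAt_pos hn.1 hn.2 hA).not.2 hb
        rw [if_neg fun h => hb h.1,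
          hf _ _ (conn_vertAt hw (s := s) (k := 1) (n := n) fun h => absurd h h1),
          CharTwo.add_self_eq_zero, mul_zero]
    rw [Finset.sum_congr rfl e1, ← Finset.mul_sum,
      sum_telescope (fun n => f (edgeAt w hw 1 n)) hlow.le]
    -- If the next block is negative, both indicators agree; if it is positive, the end of the block
    -- is on the long circle and the factor vanishes.
    have e2 : (if Mixed hw A κ N o s (r + 1) then 1 else 0) *
        (f (edgeAt w hw 1 (low A (r + 1))) + v) = (if Mixed hw A κ N o s r then 1 else 0) *
        (f (edgeAt w hw 1 (low A (r + 1))) + v) := by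
      rcases lt_or_gt_of_ne (hB.ne_zero (r + 1)) with hA' | hA'
      · rw [if_congr (mixed_succ hr hr' hA hA') rfl rfl]
      · rw [hend r hr hr' (.inl ⟨hA, hA'⟩), CharTwo.add_self_eq_zero, mul_zero, mul_zero]
    rw [e2, ← mul_add]
    congr 1
    linear_combination -CharTwo.add_self_eq_zero v

theorem evenFamily (hB : IsBlockWord w hw A N o) (hκ : IsTarget A κ N o) :
    EvenFamily (D := w.closure) (Family hw A κ N o) where
  not_loop s x hx hF := Family.not_loop hB hκ hx hF
  sum_eq_zero s f hf := by
    classical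
    by_cases hex : ∃ x, s x = true ∧ Family hw A κ N o (delB (D := w.closure) s x)
    · obtain ⟨x, hx, hF⟩ := hex
      have hs : Tight hw A N o s := hF.tight_of_le hB hκ fun c hc => delB_le hc
      have h1 := sum_crossings hw (low A o) fun x =>
        if s x = true ∧ Family hw A κ N o (delB (D := w.closure) s x)
          then f (w.closure.crossing x).a + f (w.closure.crossing x).c else 0
      rw [← hB.length, sum_blocks _ (Nat.le_add_right o N)] at h1
      rw [Finset.sum_congr rfl fun r hr => sum_block hB hs f hf (Finset.mem_Ico.1 hr).1
        (Finset.mem_Ico.1 hr).2] at h1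
      -- The two remaining ends are the same level after a full turn, where the factor is `v + v =
      -- 0`.
      rw [sum_telescope (fun r => (if Mixed hw A κ N o s r then 1 else 0) *
        (f (edgeAt w hw 1 (low A r)) + f (edgeAt w hw 1 (low A o)))) (Nat.le_add_right o N),
        hB.length, edgeAt_add_length, CharTwo.add_self_eq_zero, mul_zero, mul_zero,
        add_zero] at h1
      exact h1
    · push Not at hex
      exact Finset.sum_eq_zero fun x _ => if_neg fun h => hex x h.1 h.2

end Sums

end BraidWord

/-! ### The detecting states and their cocycle. -/

namespace BraidWord

open LinkDiagram

section Test

/-- The states that detect the torsion cycle: the first crossings of each positive block are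
labelled `B`, as many as `κ` says, and each negative block has exactly one label `A`. -/
structure Detects {w : BraidWord 2} (hw : 0 < w.length) (A : ℕ → ℤ) (κ : ℕ → ℕ) (N o : ℕ)
    (s : w.closure.State) : Prop where
  pos : ∀ i, o ≤ i → i < o + N → 0 < A i → ∀ n, low A i ≤ n → n < low A (i + 1) →
    (s (crossingAtLevel w hw n) = true ↔ n - low A i < κ i)
  neg : ∀ i, o ≤ i → i < o + N → A i < 0 → ∃ m, low A i ≤ m ∧ m < low A (i + 1) ∧
    ∀ n, low A i ≤ n → n < low A (i + 1) → (s (crossingAtLevel w hw n) = false ↔ n = m)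

/-- The detecting state in which the labels `A` of the negative blocks come first. -/
structure Pinned {w : BraidWord 2} (hw : 0 < w.length) (A : ℕ → ℤ) (κ : ℕ → ℕ) (N o : ℕ)
    (s : w.closure.State) : Prop where
  pos : ∀ i, o ≤ i → i < o + N → 0 < A i → ∀ n, low A i ≤ n → n < low A (i + 1) →
    (s (crossingAtLevel w hw n) = true ↔ n - low A i < κ i)
  neg : ∀ i, o ≤ i → i < o + N → A i < 0 → ∀ n, low A i ≤ n → n < low A (i + 1) →
    (s (crossingAtLevel w hw n) = false ↔ n = low A i)

variable {w : BraidWord 2} {hw : 0 < w.length} {A : ℕ → ℤ} {N o : ℕ} {κ κ' : ℕ → ℕ}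
  {s : w.closure.State}

theorem Pinned.detects (hB : IsBlockWord w hw A N o) (h : Pinned hw A κ N o s) :
    Detects hw A κ N o s :=
  ⟨h.pos, fun i h1 h2 hA => ⟨low A i, le_rfl, hB.low_lt, h.neg i h1 h2 hA⟩⟩

theorem Pinned.unique (hB : IsBlockWord w hw A N o) {t : w.closure.State}
    (hs : Pinned hw A κ N o s) (ht : Pinned hw A κ N o t) : s = t := by
  funext x
  obtain ⟨n, j, h1, h2, h3, h4, rfl⟩ := exists_level_block hB x
  rcases lt_or_gt_of_ne (hB.ne_zero j) with hA | hA
  · have := (hs.neg j h1 h2 hA n h3 h4).trans (ht.neg j h1 h2 hA n h3 h4).symm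
    revert this
    cases s (crossingAtLevel w hw n) <;> cases t (crossingAtLevel w hw n) <;> simp
  · exact Bool.eq_iff_iff.2
      ((hs.pos j h1 h2 hA n h3 h4).trans (ht.pos j h1 h2 hA n h3 h4).symm)

theorem exists_pinned (hB : IsBlockWord w hw A N o) (κ : ℕ → ℕ) :
    ∃ s : w.closure.State, Pinned hw A κ N o s := by
  classical
  choose lev blk h1 h2 h3 h4 h5 using exists_level_block hB
  have hlev : ∀ i n, o ≤ i → i < o + N → low A i ≤ n → n < low A (i + 1) →
      lev (crossingAtLevel w hw n) = n ∧ blk (crossingAtLevel w hw n) = i := by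
    intro i n hi hi' hn hn'
    have h := crossingAtLevel_inj hB (h1 _) (h2 _) hi hi' (h3 _) (h4 _) hn hn'
      (h5 (crossingAtLevel w hw n))
    have h' := h4 (crossingAtLevel w hw n)
    have h'' := h3 (crossingAtLevel w hw n)
    rw [h] at h' h''
    exact ⟨h, block_unique h'' h' hn hn'⟩
  refine ⟨fun x => if 0 < A (blk x) then decide (lev x - low A (blk x) < κ (blk x))
    else decide (lev x ≠ low A (blk x)), ⟨fun i hi hi' hA n hn hn' => ?_,
      fun i hi hi' hA n hn hn' => ?_⟩⟩
  · obtain ⟨e1, e2⟩ := hlev i n hi hi' hn hn'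
    simp only [e1, e2, if_pos hA, decide_eq_true_eq]
  · obtain ⟨e1, e2⟩ := hlev i n hi hi' hn hn'
    simp only [e1, e2, if_neg hA.not_gt, decide_eq_false_iff_not, not_not]

theorem cnt_of_initial {i k : ℕ} (hk : k ≤ (A i).natAbs)
    (h : ∀ n, low A i ≤ n → n < low A (i + 1) →
      (s (crossingAtLevel w hw n) = true ↔ n - low A i < k)) : cnt hw A s i = k := by
  have : ((Finset.Ico (low A i) (low A (i + 1))).filter
      fun n => s (crossingAtLevel w hw n) = true) = Finset.Ico (low A i) (low A i + k) := by
    ext n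
    have := low_succ A i
    simp only [Finset.mem_filter, Finset.mem_Ico]
    constructor
    · rintro ⟨⟨h1, h2⟩, h3⟩
      have := (h n h1 h2).1 h3
      omega
    · rintro ⟨h1, h2⟩
      have h3 : n < low A (i + 1) := by omega
      exact ⟨⟨h1, h3⟩, (h n h1 h3).2 (by omega)⟩
  unfold cnt
  rw [this, Nat.card_Ico]
  omega

/-- A state of the torsion cycle next to a detecting state determines the latter. -/
theorem Detects.pinned (hB : IsBlockWord w hw A N o) (hκ : IsTarget A κ N o)
    (hκ' : ∀ i, o ≤ i → i < o + N → 0 < A i → κ' i ≤ (A i).natAbs)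
    (hs : Detects hw A κ' N o s) {j m : ℕ} (hj : o ≤ j) (hj' : j < o + N) (hm : low A j ≤ m)
    (hm' : m < low A (j + 1)) (hsm : s (crossingAtLevel w hw m) = true)
    (hF : Family hw A κ N o (delB (D := w.closure) s (crossingAtLevel w hw m))) :
    Pinned hw A κ' N o s ∧ 0 < A j ∧
      ∀ i, o ≤ i → i < o + N → 0 < A i → κ' i = κ i + if i = j then 1 else 0 := by
  have hself : delB (D := w.closure) s (crossingAtLevel w hw m) (crossingAtLevel w hw m) = false :=
    delB_self (D := w.closure) s _
  have hrest : ∀ i, o ≤ i → i < o + N → A i < 0 → ∀ n, low A i < n → n < low A (i + 1) →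
      delB (D := w.closure) s (crossingAtLevel w hw m) (crossingAtLevel w hw n) = true := by
    intro i h1 h2 hA
    rcases hF i h1 h2 with ⟨-, h, -⟩ | ⟨h, -⟩
    · exact h
    · omega
  -- In a negative block, the change back to A would leave two labels A, but a state of the family
  -- has A at most at the first crossing.
  have hA : 0 < A j := by
    by_contra hA
    have hA : A j < 0 := by have := hB.ne_zero j; omega
    have hmlow : m = low A j := by
      by_contra hne
      have := hrest j hj hj' hA m (by omega) hm'
      rw [hself] at this
      simp at this
    obtain ⟨m', h1, h2, h3⟩ := hs.neg j hj hj' hA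
    have h4 := (h3 m' h1 h2).2 rfl
    have hne : m' ≠ m := by
      rintro rfl
      rw [hsm] at h4
      simp at h4
    rw [delB_le (hrest j hj hj' hA m' (by omega) h2)] at h4
    simp at h4
  have hneg : ∀ i, o ≤ i → i < o + N → A i < 0 → ∀ n, low A i ≤ n → n < low A (i + 1) →
      (s (crossingAtLevel w hw n) = false ↔ n = low A i) := by
    intro i h1 h2 hAi
    obtain ⟨m', h3, h4, h5⟩ := hs.neg i h1 h2 hAi
    obtain rfl : m' = low A i := by
      by_contra hne
      have h6 := (h5 m' h3 h4).2 rfl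
      rw [delB_le (hrest i h1 h2 hAi m' (by omega) h4)] at h6
      simp at h6
    exact h5
  refine ⟨⟨hs.pos, hneg⟩, hA, ?_⟩
  -- Every negative block now starts with A, so the excess vanishes on both sides of it, hence at
  -- every end of a block. The counts are then equal to the targets.
  have hfirst : ∀ i, o ≤ i → i < o + N → A i < 0 →
      excess hw A κ o (delB (D := w.closure) s (crossingAtLevel w hw m)) i = 0 ∧
      excess hw A κ o (delB (D := w.closure) s (crossingAtLevel w hw m)) (i + 1) = 0 := by
    intro i h1 h2 hAi
    refine hF.excess_of_first hκ h1 h2 hAi ?_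
    have hij : i ≠ j := by rintro rfl; omega
    rw [delB_level hB hj hj' hm hm' h1 h2 le_rfl hB.low_lt]
    · exact (hneg i h1 h2 hAi _ le_rfl hB.low_lt).2 rfl
    · rintro rfl
      exact hij (block_unique le_rfl hB.low_lt hm hm')
  have hzero : ∀ i, o ≤ i → i < o + N →
      excess hw A κ o (delB (D := w.closure) s (crossingAtLevel w hw m)) (i + 1) = 0 := by
    intro i h1 h2
    rcases hF i h1 h2 with ⟨h3, -⟩ | ⟨h3, h4⟩
    · exact (hfirst i h1 h2 h3).2
    · rcases lt_or_gt_of_ne (hB.ne_zero (i + 1)) with h5 | h5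
      · refine (hfirst (i + 1) (by omega) (lt_of_le_of_ne h2 fun h => ?_) h5).1
        have := hB.wrap_pos
        rw [← h] at this
        exact h5.not_gt this
      · exact h4 h5
  intro i h1 h2 hAi
  have h3 : excess hw A κ o (delB (D := w.closure) s (crossingAtLevel w hw m)) i = 0 := by
    rcases h1.eq_or_lt with rfl | h1
    · exact excess_self
    · have := hzero (i - 1) (by omega) (by omega)
      rwa [Nat.sub_add_cancel (by omega)] at this
  have h4 := excess_succ (hw := hw) (A := A) (κ := κ)
    (s := delB (D := w.closure) s (crossingAtLevel w hw m)) h1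
  rw [hzero i h1 h2, h3, cnt_delB hB hj hj' hm hm' hsm h1 h2,
    cnt_of_initial (hκ' i h1 h2 hAi) (hs.pos i h1 h2 hAi)] at h4
  split_ifs at h4 ⊢ <;> omega

theorem Pinned.family_delB (hB : IsBlockWord w hw A N o) (hκ : IsTarget A κ N o)
    (hκ' : ∀ i, o ≤ i → i < o + N → 0 < A i → κ' i ≤ (A i).natAbs)
    (hs : Pinned hw A κ' N o s) {j m : ℕ} (hj : o ≤ j) (hj' : j < o + N) (hA : 0 < A j)
    (hκκ' : ∀ i, o ≤ i → i < o + N → 0 < A i → κ' i = κ i + if i = j then 1 else 0)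
    (hm : low A j ≤ m) (hm' : m < low A (j + 1)) (hsm : s (crossingAtLevel w hw m) = true) :
    Family hw A κ N o (delB (D := w.closure) s (crossingAtLevel w hw m)) := by
  have hcnt : ∀ i, o ≤ i → i < o + N →
      (cnt hw A (delB (D := w.closure) s (crossingAtLevel w hw m)) i : ℤ) = κ i := by
    intro i h1 h2
    rw [cnt_delB hB hj hj' hm hm' hsm h1 h2]
    rcases lt_or_gt_of_ne (hB.ne_zero i) with h3 | h3
    · have h4 := hs.neg i h1 h2 h3
      have h5 : cnt hw A s i + 1 = _ := cnt_of_first h3.ne (fun n hn hn' => by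
        have := (h4 n hn.le hn').not.2 hn.ne'
        simpa using this) ((h4 _ le_rfl hB.low_lt).2 rfl)
      have h6 := hκ.neg i h1 h2 h3
      rw [if_neg (by rintro rfl; omega)]
      omega
    · rw [cnt_of_initial (hκ' i h1 h2 h3) (hs.pos i h1 h2 h3), hκκ' i h1 h2 h3]
      split_ifs <;> simp
  have hzero : ∀ r, r ≤ o + N →
      excess hw A κ o (delB (D := w.closure) s (crossingAtLevel w hw m)) r = 0 := by
    intro r hr
    refine Finset.sum_eq_zero fun i hi => ?_
    rw [Finset.mem_Ico] at hi
    rw [hcnt i hi.1 (by omega), sub_self]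
  intro r h1 h2
  rw [hzero (r + 1) h2]
  rcases lt_or_gt_of_ne (hB.ne_zero r) with h3 | h3
  · have hne : ∀ n, low A r ≤ n → n < low A (r + 1) → n ≠ m := by
      rintro n hn hn' rfl
      obtain rfl := block_unique hn hn' hm hm'
      omega
    refine .inl ⟨h3, fun n hn hn' => ?_, .inl ⟨?_, rfl⟩⟩
    · rw [delB_level hB hj hj' hm hm' h1 h2 hn.le hn' (hne n hn.le hn')]
      have := (hs.neg r h1 h2 h3 n hn.le hn').not.2 hn.ne'
      simpa using this
    · rw [delB_level hB hj hj' hm hm' h1 h2 le_rfl hB.low_lt (hne _ le_rfl hB.low_lt)]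
      exact (hs.neg r h1 h2 h3 _ le_rfl hB.low_lt).2 rfl
  · exact .inr ⟨h3, fun _ => rfl⟩

theorem addB_level (hB : IsBlockWord w hw A N o) {i j m n : ℕ} (hj : o ≤ j) (hj' : j < o + N)
    (h1 : low A j ≤ n) (h2 : n < low A (j + 1)) (hi : o ≤ i) (hi' : i < o + N) (h3 : low A i ≤ m)
    (h4 : m < low A (i + 1)) (hne : m ≠ n) :
    addB (D := w.closure) s (crossingAtLevel w hw n) (crossingAtLevel w hw m) =
      s (crossingAtLevel w hw m) :=
  addB_of_ne (D := w.closure) fun h => hne (crossingAtLevel_inj hB hi hi' hj hj' h3 h4 h1 h2 h)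

/-- The horizontal smoothing at `m` in the same block joins the two vertical strands at `n`. -/
theorem loop_of_neg (hB : IsBlockWord w hw A N o) {j m n : ℕ} (hA : A j < 0)
    (hm : low A j ≤ m) (hm' : m < low A (j + 1)) (hn : low A j ≤ n) (hn' : n < low A (j + 1))
    (hne : m ≠ n) (hsm : s (crossingAtLevel w hw m) = false)
    (hsn : s (crossingAtLevel w hw n) = true) : Loop (D := w.closure) s (crossingAtLevel w hw n) := by
  have hm1 := (hB.horizAt_neg (s := s) hm hm' hA).2 hsm
  rw [loop_iff_of_not_horizAt hw (by rw [hB.horizAt_neg hn hn' hA, hsn]; simp),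
    hB.typeAt hn hn']
  rcases lt_or_gt_of_ne hne with h | h
  · exact conn_of_prev h hm1 fun i hi hi' _ => hB.typeAt (hm.trans hi) (hi'.trans hn')
  · exact conn_of_next h.le hm1 fun i hi hi' _ => hB.typeAt (hn.trans hi) (hi'.trans_lt hm')

theorem even_card_filter_of_pair {α : Type*} [Fintype α] {p : α → Prop} [DecidablePred p] {a b : α}
    (hab : a ≠ b) (h : ∀ x, p x ↔ x = a ∨ x = b) : Even (Finset.univ.filter p).card := by
  classical
  have : Finset.univ.filter p = {a, b} := by
    ext x
    simp [h x]
  rw [this, Finset.card_pair hab]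
  exact even_two

/-- If a change in a negative block leads into the family, that block has exactly two labels A.
Changing either of them works, both changes are merges, and no change in another block can repair
it. Otherwise all changes are in positive blocks, where at least two labels B result and the change
is a split. -/
theorem coevenFamily (hB : IsBlockWord w hw A N o)
    (hκ : ∀ i, o ≤ i → i < o + N → 0 < A i → 2 ≤ κ i ∧ κ i ≤ (A i).natAbs) :
    CoevenFamily (D := w.closure) (Detects hw A κ N o) := by
  classical
  intro s
  by_cases hex : ∃ j n, o ≤ j ∧ j < o + N ∧ A j < 0 ∧ low A j ≤ n ∧ n < low A (j + 1) ∧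
      s (crossingAtLevel w hw n) = false ∧
      Detects hw A κ N o (addB (D := w.closure) s (crossingAtLevel w hw n))
  · obtain ⟨j, n, hj, hj', hA, hn, hn', hsn, hT⟩ := hex
    obtain ⟨m, hm, hm', hm1⟩ := hT.neg j hj hj' hA
    have hself : ∀ n, addB (D := w.closure) s (crossingAtLevel w hw n) (crossingAtLevel w hw n) =
        true := fun n => addB_self (D := w.closure) s _
    have hne : m ≠ n := by
      rintro rfl
      have := (hm1 m hm hm').2 rfl
      rw [hself] at this
      simp at this
    have hsm : s (crossingAtLevel w hw m) = false := by
      exact (addB_level hB hj hj' hn hn' hj hj' hm hm' hne).symm.trans ((hm1 m hm hm').2 rfl)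
    have honly : ∀ i, low A j ≤ i → i < low A (j + 1) → s (crossingAtLevel w hw i) = false →
        i = n ∨ i = m := by
      intro i hi hi' hsi
      by_cases hin : i = n
      · exact .inl hin
      · refine .inr ((hm1 i hi hi').1 ?_)
        rwa [addB_level hB hj hj' hn hn' hj hj' hi hi' hin]
    have hT' : Detects hw A κ N o (addB (D := w.closure) s (crossingAtLevel w hw m)) := by
      have hother : ∀ r, o ≤ r → r < o + N → r ≠ j → ∀ i, low A r ≤ i → i < low A (r + 1) →
          addB (D := w.closure) s (crossingAtLevel w hw m) (crossingAtLevel w hw i) =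
          addB (D := w.closure) s (crossingAtLevel w hw n) (crossingAtLevel w hw i) := by
        intro r hr hr' hrj i hi hi'
        rw [addB_level hB hj hj' hm hm' hr hr' hi hi', addB_level hB hj hj' hn hn' hr hr' hi hi']
        · rintro rfl; exact hrj (block_unique hi hi' hn hn')
        · rintro rfl; exact hrj (block_unique hi hi' hm hm')
      refine ⟨fun r hr hr' hAr i hi hi' => ?_, fun r hr hr' hAr => ?_⟩
      · rw [hother r hr hr' (by rintro rfl; omega) i hi hi']
        exact hT.pos r hr hr' hAr i hi hi'
      · by_cases hrj : r = j
        · subst hrj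
          refine ⟨n, hn, hn', fun i hi hi' => ⟨fun h => ?_, ?_⟩⟩
          · have him : i ≠ m := by
              rintro rfl
              rw [hself] at h
              simp at h
            rw [addB_level hB hj hj' hm hm' hj hj' hi hi' him] at h
            exact (honly i hi hi' h).resolve_right him
          · rintro rfl
            rwa [addB_level hB hj hj' hm hm' hj hj' hi hi' hne.symm]
        · obtain ⟨m', h1, h2, h3⟩ := hT.neg r hr hr' hAr
          refine ⟨m', h1, h2, fun i hi hi' => ?_⟩
          rw [hother r hr hr' hrj i hi hi']
          exact h3 i hi hi'
    have hiff : ∀ x, s x = false ∧ Detects hw A κ N o (addB (D := w.closure) s x) ↔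
        x = crossingAtLevel w hw n ∨ x = crossingAtLevel w hw m := by
      intro x
      constructor
      · rintro ⟨hx, hTx⟩
        obtain ⟨i, r, h1, h2, h3, h4, rfl⟩ := exists_level_block hB x
        by_cases hrj : r = j
        · subst hrj
          exact (honly i h3 h4 hx).imp (congrArg _) (congrArg _)
        · exfalso
          obtain ⟨m', h5, h6, h7⟩ := hTx.neg j hj hj' hA
          refine hne (((h7 m hm hm').1 ?_).trans ((h7 n hn hn').1 ?_).symm)
          · rw [addB_level hB h1 h2 h3 h4 hj hj' hm hm']
            · exact hsm
            · rintro rfl; exact hrj (block_unique h3 h4 hm hm')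
          · rw [addB_level hB h1 h2 h3 h4 hj hj' hn hn']
            · exact hsn
            · rintro rfl; exact hrj (block_unique h3 h4 hn hn')
      · rintro (rfl | rfl)
        · exact ⟨hsn, hT⟩
        · exact ⟨hsm, hT'⟩
    refine .inr ⟨fun x hx hTx => ?_, ?_⟩
    · rcases (hiff x).1 ⟨hx, hTx⟩ with rfl | rfl
      · exact loop_of_neg hB hA hm hm' hn hn' hne ((hm1 m hm hm').2 rfl) (hself n)
      · refine loop_of_neg hB hA hn hn' hm hm' hne.symm ?_ (hself m)
        rwa [addB_level hB hj hj' hm hm' hj hj' hn hn' hne.symm]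
    · exact even_card_filter_of_pair (fun h =>
        hne.symm (crossingAtLevel_inj hB hj hj' hj hj' hn hn' hm hm' h)) hiff
  · refine .inl fun x hx hT => ?_
    obtain ⟨n, j, hj, hj', hn, hn', rfl⟩ := exists_level_block hB x
    have hA : 0 < A j := by
      by_contra hA
      have := hB.ne_zero j
      exact hex ⟨j, n, hj, hj', by omega, hn, hn', hx, hT⟩
    obtain ⟨h2, h3⟩ := hκ j hj hj' hA
    have h4 := low_succ A j
    -- As `κ j` is at least two, one of the first two crossings of the block is a label B other than
    -- `n`.
    obtain ⟨n', h5, h6, h7, h8⟩ : ∃ n', low A j ≤ n' ∧ n' < low A (j + 1) ∧ n' - low A j < κ j ∧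
        n ≠ n' := by
      by_cases h : n = low A j
      · exact ⟨low A j + 1, by omega, by omega, by omega, by omega⟩
      · exact ⟨low A j, by omega, by omega, by omega, h⟩
    have := low_mono A hj
    have := low_mono A (show j + 1 ≤ o + N from hj')
    have := hB.length
    refine not_loop_of_horizAt hw (b := low A o) (by omega) (by omega) (by omega) (by omega) h8
      ((hB.horizAt_pos hn hn' hA).2 (addB_self (D := w.closure) s _))
      ((hB.horizAt_pos h5 h6 hA).2 ((hT.pos j hj hj' hA n' h5 h6).2 h7)) fun m hm hm' _ => ?_
    rw [hB.typeAt hn hn', hB.typeAt (i := j) (by omega) (by omega)]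

/-- The detecting state sees an odd number of states of the torsion cycle. -/
theorem Pinned.odd_card (hB : IsBlockWord w hw A N o) (hκ : IsTarget A κ N o)
    (hκ' : ∀ i, o ≤ i → i < o + N → 0 < A i → κ' i ≤ (A i).natAbs)
    (hs : Pinned hw A κ' N o s) {j : ℕ} (hj : o ≤ j) (hj' : j < o + N) (hA : 0 < A j)
    (hκκ' : ∀ i, o ≤ i → i < o + N → 0 < A i → κ' i = κ i + if i = j then 1 else 0)
    (hodd : Odd (κ' j)) : open Classical in
    Odd (Finset.univ.filter fun x => s x = true ∧
      Family hw A κ N o (delB (D := w.closure) s x)).card := by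
  classical
  have hcard : (Finset.univ.filter fun x => s x = true ∧
      Family hw A κ N o (delB (D := w.closure) s x)).card = cnt hw A s j := by
    symm
    refine Finset.card_bij (fun n _ => crossingAtLevel w hw n) ?_ ?_ ?_
    · intro n hn
      simp only [Finset.mem_filter, Finset.mem_Ico] at hn
      exact Finset.mem_filter.2 ⟨Finset.mem_univ _, hn.2,
        hs.family_delB hB hκ hκ' hj hj' hA hκκ' hn.1.1 hn.1.2 hn.2⟩
    · intro n hn n' hn' h
      simp only [Finset.mem_filter, Finset.mem_Ico] at hn hn'
      exact crossingAtLevel_inj hB hj hj' hj hj' hn.1.1 hn.1.2 hn'.1.1 hn'.1.2 h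
    · intro x hx
      obtain ⟨-, hx1, hx2⟩ := Finset.mem_filter.1 hx
      obtain ⟨n, i, h1, h2, h3, h4, rfl⟩ := exists_level_block hB x
      obtain ⟨-, -, h5⟩ := (hs.detects hB).pinned hB hκ hκ' h1 h2 h3 h4 hx1 hx2
      obtain rfl : j = i := by
        by_contra hne
        have h6 := h5 j hj hj' hA
        have h7 := hκκ' j hj hj' hA
        rw [if_neg hne] at h6
        rw [if_pos rfl] at h7
        omega
      exact ⟨n, Finset.mem_filter.2 ⟨Finset.mem_Ico.2 ⟨h3, h4⟩, hx1⟩, rfl⟩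
  rw [hcard, cnt_of_initial (hκ' j hj hj' hA) (hs.pos j hj hj' hA)]
  exact hodd

end Test

end BraidWord

/-! ### One torsion element for each choice of target numbers. -/

namespace BraidWord

open LinkDiagram

section Count

variable {w : BraidWord 2} {hw : 0 < w.length} {A : ℕ → ℤ} {N o : ℕ}

/-- Each choice of even target numbers in the positive blocks, one of which can be raised, gives a
torsion element of order two, and different choices give different elements. -/
theorem IsBlockWord.card_le_encard_torsion (hB : IsBlockWord w hw A N o) {ι : Type*} [Fintype ι]
    (κ : ι → ℕ → ℕ) (J : ι → ℕ) (hκ : ∀ k, IsTarget A (κ k) N o)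
    (hJ : ∀ k, o ≤ J k ∧ J k < o + N ∧ 0 < A (J k))
    (hle : ∀ k i, o ≤ i → i < o + N → 0 < A i →
      κ k i + (if i = J k then 1 else 0) ≤ (A i).natAbs)
    (heven : ∀ k i, o ≤ i → i < o + N → 0 < A i → Even (κ k i))
    (hinj : ∀ k l, (∀ i, o ≤ i → i < o + N → 0 < A i → κ k i = κ l i) → k = l) :
    (Fintype.card ι : ℕ∞) ≤
      Set.encard {x : Σ hq : ℤ × ℤ, w.closure.Kh hq.1 hq.2 | addOrderOf x.2 = 2} := by
  let κ' : ι → ℕ → ℕ := fun k i => κ k i + if i = J k then 1 else 0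
  choose s₀ hs₀ using fun k => exists_pinned hB (κ' k)
  have key : ∀ k l s x, Detects hw A (κ' k) N o s → s x = true →
      Family hw A (κ l) N o (delB (D := w.closure) s x) → Pinned hw A (κ' k) N o s ∧
      ∃ j, ∀ i, o ≤ i → i < o + N → 0 < A i → κ' k i = κ l i + if i = j then 1 else 0 := by
    intro k l s x hs hx hF
    obtain ⟨n, j, h1, h2, h3, h4, rfl⟩ := exists_level_block hB x
    obtain ⟨h5, -, h6⟩ := hs.pinned hB (hκ l) (hle k) h1 h2 h3 h4 hx hF
    exact ⟨h5, j, h6⟩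
  refine LinkDiagram.card_le_encard_torsion w.planar_closure (fun k => Family hw A (κ k) N o)
    (fun k => Detects hw A (κ' k) N o) s₀ (fun k => evenFamily hB (hκ k))
    (fun k => coevenFamily hB fun i h1 h2 hA => ⟨?_, hle k i h1 h2 hA⟩)
    (fun k => (hs₀ k).detects hB) (fun k s x hs hx hF => ?_)
    (fun k => (hs₀ k).odd_card hB (hκ k) (hle k) (hJ k).1 (hJ k).2.1 (hJ k).2.2
      (fun _ _ _ _ => rfl) ?_) fun k l s x hkl hs hx hF => ?_
  · exact ((hκ k).two_le i h1 h2 hA).trans (Nat.le_add_right _ _)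
  · exact (key k k s x hs hx hF).1.unique hB (hs₀ k)
  · rw [if_pos rfl]
    exact (heven k _ (hJ k).1 (hJ k).2.1 (hJ k).2.2).add_one
  · obtain ⟨-, j, hj⟩ := key k l s x hs hx hF
    refine hkl (hinj k l fun i h1 h2 hA => ?_)
    have h3 := hj i h1 h2 hA
    obtain ⟨b, hb⟩ := heven k i h1 h2 hA
    obtain ⟨c, hc⟩ := heven l i h1 h2 hA
    simp only [κ'] at h3
    -- Both targets are even, so a unit is added on both sides or on neither.
    split_ifs at h3 <;> omega

end Count

end BraidWord

/-! ### The given braid word as a periodic block word. -/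

theorem length_flatten_replicate {α : Type*} (M : ℕ → ℕ) (F : ℕ → α) (n : ℕ) :
    (List.ofFn fun i : Fin n => List.replicate (M i) (F i)).flatten.length =
      ∑ i ∈ Finset.range n, M i := by
  induction n with
  | zero => simp
  | succ n ih =>
    rw [List.ofFn_succ', List.concat_eq_append, List.flatten_append, List.length_append,
      Finset.sum_range_succ]
    simp only [Fin.val_castSucc, Fin.val_last]
    rw [ih]
    simp

theorem getElem?_flatten_replicate {α : Type*} (M : ℕ → ℕ) (F : ℕ → α) {n i p : ℕ} (hi : i < n)
    (h1 : ∑ j ∈ Finset.range i, M j ≤ p) (h2 : p < ∑ j ∈ Finset.range (i + 1), M j) :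
    (List.ofFn fun i : Fin n => List.replicate (M i) (F i)).flatten[p]? = some (F i) := by
  induction n with
  | zero => omega
  | succ n ih =>
    rw [List.ofFn_succ', List.concat_eq_append, List.flatten_append]
    simp only [Fin.val_castSucc, Fin.val_last]
    have hlen := length_flatten_replicate M F n
    rcases Nat.lt_succ_iff_lt_or_eq.1 hi with h | rfl
    · rw [List.getElem?_append_left, ih h]
      rw [hlen]
      exact h2.trans_le (Finset.sum_le_sum_of_subset (Finset.range_mono h))
    · rw [List.getElem?_append_right (by rw [hlen]; exact h1), hlen]
      rw [Finset.sum_range_succ] at h2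
      simp only [List.flatten_cons, List.flatten_nil, List.append_nil]
      rw [List.getElem?_replicate, if_pos (by omega)]

theorem val_finRotate {n : ℕ} (i : Fin n) : (finRotate n i).val = (i.val + 1) % n := by
  cases n with
  | zero => exact i.elim0
  | succ n => rw [finRotate_apply, Fin.val_add]; simp

namespace BraidWord

section Periodic

variable {t : ℕ} (ht : 0 < 2 * t) (a : Fin (2 * t) → ℤ)

/-- The exponents of a closed braid on three strands, repeated periodically. -/
def exponent (i : ℕ) : ℤ := a ⟨i % (2 * t), Nat.mod_lt _ ht⟩

theorem exponent_val (x : Fin (2 * t)) : exponent ht a x.val = a x :=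
  congrArg a (Fin.ext (Nat.mod_eq_of_lt x.2))

theorem exponent_congr {i j : ℕ} (h : i % (2 * t) = j % (2 * t)) :
    exponent ht a i = exponent ht a j := congrArg a (Fin.ext h)

theorem exponent_finRotate (i : ℕ) :
    a (finRotate (2 * t) ⟨i % (2 * t), Nat.mod_lt _ ht⟩) = exponent ht a (i + 1) := by
  refine congrArg a (Fin.ext ?_)
  rw [val_finRotate]
  exact Nat.mod_add_mod _ _ _

theorem exponent_finRotate_symm (i : ℕ) :
    a ((finRotate (2 * t)).symm ⟨(i + 1) % (2 * t), Nat.mod_lt _ ht⟩) = exponent ht a i := by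
  refine congrArg a ((Equiv.symm_apply_eq _).2 (Fin.ext ?_))
  rw [val_finRotate]
  exact (Nat.mod_add_mod _ _ _).symm

theorem low_add_period (i : ℕ) :
    low (exponent ht a) (i + 2 * t) = low (exponent ht a) i + low (exponent ht a) (2 * t) := by
  unfold low
  rw [add_comm i, Finset.sum_range_add, add_comm]
  refine congrArg (· + _) (Finset.sum_congr rfl fun j _ => ?_)
  rw [exponent_congr ht a (Nat.add_mod_left (2 * t) j)]

theorem threeBraidWord_eq : threeBraidWord a = (List.ofFn fun i : Fin (2 * t) =>
    List.replicate (exponent ht a i).natAbs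
      (blockType i, decide (0 < exponent ht a i))).flatten := by
  unfold threeBraidWord
  refine congrArg List.flatten (congrArg List.ofFn (funext fun i => ?_))
  rw [exponent_val]
  rfl

theorem length_threeBraidWord :
    (threeBraidWord a).length = low (exponent ht a) (2 * t) := by
  rw [threeBraidWord_eq ht a]
  exact length_flatten_replicate (fun i => (exponent ht a i).natAbs)
    (fun i => ((blockType i, decide (0 < exponent ht a i)) : Fin 2 × Bool)) _

theorem get_threeBraidWord (hw : 0 < (threeBraidWord a).length) (i n : ℕ)
    (h1 : low (exponent ht a) i ≤ n) (h2 : n < low (exponent ht a) (i + 1)) :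
    (threeBraidWord a).get (crossingAtLevel _ hw n) =
      (blockType i, decide (0 < exponent ht a i)) := by
  have hL := length_threeBraidWord ht a
  induction i using Nat.strong_induction_on generalizing n with
  | _ i ih =>
    by_cases hi : i < 2 * t
    · have hn : n < (threeBraidWord a).length := by
        rw [hL]
        exact h2.trans_le (low_mono _ hi)
      have h3 := getElem?_flatten_replicate (fun i => (exponent ht a i).natAbs)
        (fun i => ((blockType i, decide (0 < exponent ht a i)) : Fin 2 × Bool)) hi h1 h2
      rw [← threeBraidWord_eq ht a] at h3
      have h4 : crossingAtLevel _ hw n = ⟨n, hn⟩ := Fin.ext (Nat.mod_eq_of_lt hn)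
      rw [h4]
      exact (List.getElem?_eq_some_iff.1 h3).2
    · obtain ⟨r, rfl⟩ : ∃ r, i = r + 2 * t := ⟨i - 2 * t, by omega⟩
      have h3 := low_add_period ht a r
      have h4 := low_add_period ht a (r + 1)
      rw [show r + 1 + 2 * t = r + 2 * t + 1 by ring] at h4
      obtain ⟨m, rfl⟩ : ∃ m, n = m + (threeBraidWord a).length :=
        ⟨n - (threeBraidWord a).length, by omega⟩
      have h5 := ih r (by omega) m (by omega) (by omega)
      have h6 : crossingAtLevel _ hw (m + (threeBraidWord a).length) = crossingAtLevel _ hw m :=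
        Fin.ext (Nat.add_mod_right _ _)
      rw [h6, h5, exponent_congr ht a (Nat.add_mod_right r (2 * t)),
        show blockType (r + 2 * t) = blockType r from blockType_eq_iff.2 (by omega)]

/-- The closed braid is cut open right behind the surrounded positive exponent `j`. Then `j` is the
last block and its positive successor the first, so no negative block touches the cut. -/
theorem isBlockWord_threeBraidWord (hne : ∀ i, a i ≠ 0) (h3 : ∀ i, a i < 0 → CyclicallySurrounded a i)
    {j : Fin (2 * t)} (hj : 0 < a j) (hj' : CyclicallySurrounded a j)
    (hw : 0 < (threeBraidWord a).length) :
    IsBlockWord (threeBraidWord a) hw (exponent ht a) (2 * t) (j.val + 1) where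
  letter := get_threeBraidWord ht a hw
  length := by rw [low_add_period, length_threeBraidWord ht a]
  even := even_two_mul t
  pos := ht
  ne_zero _ := hne _
  next_of_neg i hi := by
    rw [← exponent_finRotate]
    exact (h3 _ hi).1
  prev_of_neg i hi := by
    rw [← exponent_finRotate_symm]
    exact (h3 _ hi).2
  first_pos := by
    rw [← exponent_finRotate]
    have : (⟨j.val % (2 * t), Nat.mod_lt _ ht⟩ : Fin (2 * t)) = j :=
      Fin.ext (Nat.mod_eq_of_lt j.2)
    rw [this]
    exact hj'.1
  last_pos := by
    rw [show j.val + 1 + 2 * t - 1 = j.val + 2 * t by omega,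
      exponent_congr ht a (Nat.add_mod_right _ _), exponent_val]
    exact hj
  wrap_pos := by
    rw [exponent_congr ht a (Nat.add_mod_right _ _), ← exponent_finRotate]
    have : (⟨j.val % (2 * t), Nat.mod_lt _ ht⟩ : Fin (2 * t)) = j :=
      Fin.ext (Nat.mod_eq_of_lt j.2)
    rw [this]
    exact hj'.1

end Periodic

end BraidWord

/-! ### Counting the choices and conclusion. -/

/-- The choices of an even number between two and `m i` for all `i`, except for the largest one. -/
abbrev NonmaximalChoice {σ : Type*} (m : σ → ℤ) : Type _ :=
  {k : ∀ i, Fin (m i / 2).toNat // ∃ i, 2 * ((k i : ℤ) + 1) < m i}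

theorem prod_le_card_nonmaximalChoice {σ : Type*} [Fintype σ] (m : σ → ℤ) :
    ∏ i, (m i / 2).toNat - 1 ≤ Nat.card (NonmaximalChoice m) := by
  classical
  have h1 : Fintype.card (∀ i, Fin (m i / 2).toNat) = ∏ i, (m i / 2).toNat := by simp
  have h2 := Fintype.card_congr (Equiv.sumCompl
    fun k : ∀ i, Fin (m i / 2).toNat => ∃ i, 2 * ((k i : ℤ) + 1) < m i)
  rw [Fintype.card_sum, h1] at h2
  -- A choice in which nothing can be raised has every even number as large as possible, so it is
  -- determined.
  have h3 : Fintype.card {k : ∀ i, Fin (m i / 2).toNat // ¬ ∃ i, 2 * ((k i : ℤ) + 1) < m i} ≤ 1 := by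
    refine Fintype.card_le_one_iff.2 fun k l => Subtype.ext (funext fun i => Fin.ext ?_)
    have hk : ¬ 2 * ((k.1 i : ℤ) + 1) < m i := fun h => k.2 ⟨i, h⟩
    have hl : ¬ 2 * ((l.1 i : ℤ) + 1) < m i := fun h => l.2 ⟨i, h⟩
    have hk' := (k.1 i).2
    have hl' := (l.1 i).2
    omega
  rw [Nat.card_eq_fintype_card, ← h2]
  exact Nat.sub_le_of_le_add (Nat.add_le_add_left h3 _)

namespace BraidWord

/-- The target numbers of `B`-labels for a choice of numbers in the surrounded positive blocks. -/
def target {t : ℕ} (ht : 0 < 2 * t) (a : Fin (2 * t) → ℤ)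
    (k : {i // 0 < a i ∧ CyclicallySurrounded a i} → ℕ) (i : ℕ) : ℕ :=
  if h : 0 < a ⟨i % (2 * t), Nat.mod_lt _ ht⟩ ∧
      CyclicallySurrounded a ⟨i % (2 * t), Nat.mod_lt _ ht⟩ then 2 * (k ⟨_, h⟩ + 1)
  else if 0 < exponent ht a i then 2 else (exponent ht a i).natAbs - 1

theorem target_of_mod {t : ℕ} (ht : 0 < 2 * t) (a : Fin (2 * t) → ℤ)
    (k : {i // 0 < a i ∧ CyclicallySurrounded a i} → ℕ)
    (x : {i // 0 < a i ∧ CyclicallySurrounded a i}) {i : ℕ} (hi : i % (2 * t) = x.1.val) :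
    target ht a k i = 2 * (k x + 1) := by
  obtain ⟨x, hx⟩ := x
  obtain rfl : (⟨i % (2 * t), Nat.mod_lt _ ht⟩ : Fin (2 * t)) = x := Fin.ext hi
  unfold target
  rw [dif_pos hx]

theorem target_pos_cases {t : ℕ} (ht : 0 < 2 * t) (a : Fin (2 * t) → ℤ)
    (k : {i // 0 < a i ∧ CyclicallySurrounded a i} → ℕ) {i : ℕ} (hi : 0 < exponent ht a i) :
    (∃ x : {i // 0 < a i ∧ CyclicallySurrounded a i}, i % (2 * t) = x.1.val ∧
      target ht a k i = 2 * (k x + 1) ∧ a x = exponent ht a i) ∨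
    ((∀ x : {i // 0 < a i ∧ CyclicallySurrounded a i}, i % (2 * t) ≠ x.1.val) ∧
      target ht a k i = 2) := by
  by_cases h : 0 < a ⟨i % (2 * t), Nat.mod_lt _ ht⟩ ∧
      CyclicallySurrounded a ⟨i % (2 * t), Nat.mod_lt _ ht⟩
  · exact .inl ⟨⟨_, h⟩, rfl, target_of_mod ht a k ⟨_, h⟩ rfl, rfl⟩
  · refine .inr ⟨fun x hx => h ?_, ?_⟩
    · rw [show (⟨i % (2 * t), Nat.mod_lt _ ht⟩ : Fin (2 * t)) = x.1 from Fin.ext hx]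
      exact x.2
    · unfold target
      rw [dif_neg h, if_pos hi]

theorem isTarget_target {t : ℕ} (ht : 0 < 2 * t) (a : Fin (2 * t) → ℤ)
    (k : {i // 0 < a i ∧ CyclicallySurrounded a i} → ℕ) (o : ℕ) :
    IsTarget (exponent ht a) (target ht a k) (2 * t) o where
  two_le i _ _ hA := by
    rcases target_pos_cases ht a k hA with ⟨x, -, h, -⟩ | ⟨-, h⟩ <;> omega
  neg i _ _ hA := by
    unfold target
    rw [dif_neg fun h => hA.not_gt h.1, if_neg hA.not_gt]
    omega

end BraidWord

theorem corollary8p3 (t : ℕ) (a : Fin (2 * t) → ℤ)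
    (hne : ∀ i, a i ≠ 0)
    (h1 : ∀ i, a i ≠ 1)
    (h2 : ∃ j, 2 < a j ∧ CyclicallySurrounded a j)
    (h3 : ∀ i, a i < 0 → CyclicallySurrounded a i) :
    (((∏ i : Fin (2 * t) with 0 < a i ∧ CyclicallySurrounded a i, (a i / 2).toNat) - 1 : ℕ) : ℕ∞) ≤
      Set.encard {x : Σ hq : ℤ × ℤ, (threeBraidWord a).closure.Kh hq.1 hq.2 |
        addOrderOf x.2 = 2} := by
  classical
  obtain ⟨j, hj, hj'⟩ := h2
  have ht : 0 < 2 * t := j.pos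
  have hw : 0 < (threeBraidWord a).length := by
    rw [BraidWord.length_threeBraidWord ht]
    refine lt_of_lt_of_le ?_ (BraidWord.low_mono _ (show 1 ≤ 2 * t from ht))
    have : BraidWord.exponent ht a 0 ≠ 0 := hne _
    rw [BraidWord.low_succ]
    omega
  have hB := BraidWord.isBlockWord_threeBraidWord ht a hne h3 (by omega) hj' hw
  let m : {i // 0 < a i ∧ CyclicallySurrounded a i} → ℤ := fun i => a i
  have hprod : ∏ i : Fin (2 * t) with 0 < a i ∧ CyclicallySurrounded a i, (a i / 2).toNat =
      ∏ i, (m i / 2).toNat := Finset.prod_subtype _ (by simp) _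
  rw [hprod]
  choose i₀ hi₀ using fun k : NonmaximalChoice m => k.2
  -- `J` is the index of a surrounded block inside the turn that starts behind `j`.
  choose J hJ1 hJ2 hJ3 using fun x : {i // 0 < a i ∧ CyclicallySurrounded a i} =>
    BraidWord.exists_level ht (j.val + 1) x.1.val
  have hJ4 : ∀ x, J x % (2 * t) = x.1.val := fun x => (hJ3 x).trans (Nat.mod_eq_of_lt x.1.2)
  have hJ5 : ∀ x, BraidWord.exponent ht a (J x) = a x.1 := fun x =>
    (BraidWord.exponent_congr ht a (hJ3 x)).trans (BraidWord.exponent_val ht a x.1)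
  refine le_trans (Nat.cast_le.2 (prod_le_card_nonmaximalChoice m)) ?_
  rw [Nat.card_eq_fintype_card]
  refine (hB.card_le_encard_torsion (fun k => BraidWord.target ht a fun x => (k.1 x : ℕ)) (fun k => J (i₀ k))
      (fun k => BraidWord.isTarget_target ht a _ _) (fun k => ⟨hJ1 _, hJ2 _, ?_⟩) ?_ ?_ ?_)
  · rw [hJ5]
    exact (i₀ k).2.1
  · intro k i hi hi' hA
    have hA1 : BraidWord.exponent ht a i ≠ 1 := h1 _
    rcases BraidWord.target_pos_cases ht a (fun x => (k.1 x : ℕ)) hA with ⟨x, h4, h5, h6⟩ | ⟨h4, h5⟩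
    · rw [h5]
      have h7 : (k.1 x : ℕ) < (a x / 2).toNat := (k.1 x).2
      split_ifs with h
      · obtain rfl : i₀ k = x := by
          refine Subtype.ext (Fin.ext ?_)
          rw [← hJ4, ← h, h4]
        have h8 : 2 * ((k.1 (i₀ k) : ℤ) + 1) < a (i₀ k) := hi₀ k
        omega
      · omega
    -- In the other positive blocks the target is two and is never raised; it fits because the
    -- exponent is positive and not one.
    · rw [h5, if_neg]
      · omega
      · rintro rfl
        exact h4 _ (hJ4 _)
  · intro k i hi hi' hA
    rcases BraidWord.target_pos_cases ht a (fun x => (k.1 x : ℕ)) hA with ⟨x, -, h5, -⟩ | ⟨-, h5⟩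
    · rw [h5]; exact even_two_mul _
    · rw [h5]; exact even_two
  · intro k l h
    refine Subtype.ext (funext fun x => Fin.ext ?_)
    have h4 := h (J x) (hJ1 x) (hJ2 x) (by rw [hJ5]; exact x.2.1)
    rw [BraidWord.target_of_mod ht a _ x (hJ4 x), BraidWord.target_of_mod ht a _ x (hJ4 x)] at h4
    omega
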